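/- **Setting.** Let $B\subset\mathbb R^3$ be a bounded, strictly convex domain with $C^\infty$ boundary, containing the origin. Let $\mathcal S_B$ be the static single-layer potential (kernel $-\frac{1}{4\pi|x-y|}$), let $\mathcal S_{B,2}$ be the operator with kernel $\frac{|x-y|}{8\pi}$, and let $\mathcal K_B^*$ be the Neumann–Poincaré operator (kernel $\frac{(x-y)\cdot\nu(x)}{4\pi|x-y|^3}$), all acting on $H^{-1/2}(\partial B)$. Put $\langle u,v\rangle_{\mathcal H^*}=-\langle u,\mathcal S_B[v]\rangle_{-1/2,1/2}$. Let $(\lambda_j,\phi_j)$, $1\le j\le J$, be eigenpairs of $\mathcal K_B^*$ with $\langle\phi_j,\phi_j\rangle_{\mathcal H^*}=1$ and $\lambda_j\neq\frac12$, and set $$\alpha_j=\Big\langle\big(\tfrac12I-\mathcal K_B^*\big)\mathcal S_B^{-1}\mathcal S_{B,2}[\phi_j],\phi_j\Big\rangle_{\mathcal H^*}.$$ Let $\varepsilon_0,\varepsilon_m,\mu_m,\omega_p,\mathrm T,\delta>0$, let $c=1/\sqrt{\varepsilon_m\mu_m}$, and let $$\varepsilon_c(\Omega)=\varepsilon_0\Big(1-\frac{\omega_p^2}{\Omega^2+i\Omega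 \mathrm T^{-1}}\Big)$$ be the Drude permittivity. A number $\Omega\in\mathbb C$ with $\Omega^2+i\Omega \mathrm T^{-1}\ne0$ and $\varepsilon_c(\Omega)\notin\{0,\varepsilon_m\}$ is a *first-order corrected plasmonic resonance* of index $j$ if $$\tau_j+(\Omega\delta c^{-1})^2\tau_{j,2}=0,\qquad \tau_j=\Big(\frac1{\varepsilon_c}-\frac1{\varepsilon_m}\Big)\Big(\frac{\varepsilon_m+\varepsilon_c}{2(\varepsilon_m-\varepsilon_c)}-\lambda_j\Big),\qquad \tau_{j,2}=\frac{\varepsilon_m-\varepsilon_c}{\varepsilon_m\varepsilon_c}\,\alpha_j .$$ **Proposition.** (i) *General medium.* Given $B$, the eigenpairs, $\varepsilon_0$ and $\varepsilon_m$, there are $\kappa,\eta,M>0$ such that, for all $\mu_m,\omega_p,\mathrm T,\delta>0$ with $\omega_p\delta c^{-1}<\kappa$ and all $j$, every first-order corrected resonance $\Omega$ of index $j$ in the low-frequency region $|\Omega|\delta c^{-1}<\eta$ satisfies $\operatorname{Im}\Omega<0$ and $|\Omega|\le M\max\{\mathrm T^{-1},\omega_p\}$. If moreover $\mathrm T^{-1}\delta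 c^{-1}<\kappa$, the set of these resonances is $\{\Omega_j^+,\Omega_j^-\}$ with $\Omega_j^\pm=\pm\Omega_j'+i\Omega_j''$ for some real $\Omega_j''$ and some real or purely imaginary $\Omega_j'$. (ii) *Vacuum* ($\varepsilon_m=\varepsilon_0$). Given $B$ and the eigenpairs, there is $\kappa>0$ such that, for all $\varepsilon_0,\mu_m,\omega_p,\mathrm T,\delta>0$ with $\omega_p\delta c^{-1}<\kappa$ and all $j$, one has $\lambda_j+\frac12>0$ and $1+(\omega_p\delta c^{-1})^2\alpha_j>0$, and the following holds. Put $\Omega_j^\pm=\pm\Omega_j'+i\Omega_j''$ with $$\Omega_j'=\sqrt{\frac{\omega_p^2(\lambda_j+1/2)}{1+(\omega_p\delta c^{-1})^2\alpha_j}-\frac{\mathrm T^{-2}}{4[1+(\omega_p\delta c^{-1})^2\alpha_j]^2}},\qquad \Omega_j''=-\frac{\mathrm T^{-1}}{2[1+(\omega_p\delta c^{-1})^2\alpha_j]},$$ where the square root is the principal one (so $\Omega_j'$ is imaginary if the radicand is negative). - Any $\Omega$ with $\Omega^2+i\Omega \mathrm T^{-1}\neq0$ and $\varepsilon_c(\Omega)\neq0$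 is a first-order corrected resonance of index $j$ if and only if $\Omega\in\{\Omega_j^+,\Omega_j^-\}$. If also $\mathrm T^{-1}\delta c^{-1}<\kappa$, the set of these resonances is exactly $\{\Omega_j^+,\Omega_j^-\}$. - If the radicand is nonnegative, $\operatorname{Re}\Omega_j^\pm=\pm\Omega_j'$ and $\operatorname{Im}\Omega_j^\pm=\Omega_j''$. - In all cases $\operatorname{Im}\Omega_j^\pm<0$ and $$|\Omega_j^\pm|\le2\max\left\{\frac{\mathrm T^{-1}}{|1+(\omega_p\delta c^{-1})^2\alpha_j|},\ \frac{\omega_p\sqrt{\lambda_j+1/2}}{\sqrt{|1+(\omega_p\delta c^{-1})^2\alpha_j|}}\right\}.$$ -/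

import Mathlib

open MeasureTheory Set Topology
open scoped ContDiff RealInnerProductSpace

noncomputable section

namespace Plasmon

/-- Euclidean three-space. -/
abbrev E3 : Type := EuclideanSpace ℝ (Fin 3)

/-! ### The reference particle and its boundary -/

/-- The set `B` has a `C^∞` boundary: near each boundary point it is the sublevel set
`{ρ < 0}` of a smooth function whose differential does not vanish there. -/
def HasSmoothBoundary (B : Set E3) : Prop :=
  ∀ x ∈ frontier B, ∃ ρ : E3 → ℝ,
    ContDiff ℝ ∞ ρ ∧ fderiv ℝ ρ x ≠ 0 ∧ ∀ᶠ y in 𝓝 x, (y ∈ B ↔ ρ y < 0)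

/-- Reference particles: bounded, strictly convex, smooth domains containing the origin.
(For an open set strict convexity has to be asked of the closure.) -/
structure IsReferenceParticle (B : Set E3) : Prop where
  isOpen : IsOpen B
  isBounded : Bornology.IsBounded B
  zero_mem : (0 : E3) ∈ B
  convex : Convex ℝ B
  strictConvex_closure : StrictConvex ℝ (closure B)
  smoothBoundary : HasSmoothBoundary B

/-- The outward unit normal `ν` on `∂B`. As `B = {p < 1}` and `∂B = {p = 1}` for the Minkowski
gauge `p` of `B`, it is the normalised gradient of `p`. -/
def normal (B : Set E3) (x : E3) : E3 :=
  ‖gradient (gauge B) x‖⁻¹ • gradient (gauge B) x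

/-- The distance from the origin to `∂B` in the direction `θ`; the boundary `∂B` is the radial
graph `{r(θ) θ : |θ| = 1}`. -/
def radius (B : Set E3) (θ : E3) : ℝ := (gauge B θ)⁻¹

/-- The surface measure `σ` on `∂B`, as a measure on `ℝ³` carried by `∂B`. In the global
parametrisation `θ ↦ x = r(θ) θ` of `∂B` by the unit sphere, the surface element is
`dσ(x) = r(θ)² / (θ · ν(x)) dθ`, with `dθ` the surface measure of the unit sphere. -/
def surfaceMeasure (B : Set E3) : Measure E3 :=
  Measure.map (fun θ : Metric.sphere (0 : E3) 1 => radius B θ • (θ : E3))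
    ((volume : Measure E3).toSphere.withDensity fun θ =>
      ENNReal.ofReal
        (radius B θ ^ 2 / ⟪(θ : E3), normal B (radius B θ • (θ : E3))⟫))

instance (B : Set E3) : SFinite (surfaceMeasure B) := by
  unfold surfaceMeasure
  infer_instance

/-! ### The spaces `L²(∂B)`, `H^{1/2}(∂B)` and `H^{-1/2}(∂B)` -/

/-- Real `L²(∂B)`. -/
abbrev L2 (B : Set E3) : Type := Lp ℝ 2 (surfaceMeasure B)

/-- Real `L²(∂B × ∂B)`. -/
abbrev L2Prod (B : Set E3) : Type := Lp ℝ 2 ((surfaceMeasure B).prod (surfaceMeasure B))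

/-- The Sobolev–Slobodeckij space `H^{1/2}(∂B)`: the functions `f ∈ L²(∂B)` with
`(f(x) - f(y)) / |x - y|^{3/2} ∈ L²(∂B × ∂B)`. An element is stored as `f` together with this
quotient, so that the induced norm is
`‖f‖² = ∫ |f|² dσ + ∫∫ |f(x) - f(y)|² / |x - y|³ dσ(x) dσ(y)`. -/
def HHalf (B : Set E3) : Submodule ℝ (WithLp 2 (L2 B × L2Prod B)) where
  carrier := {p | ∀ᵐ z ∂((surfaceMeasure B).prod (surfaceMeasure B)),
    p.snd z = (p.fst z.1 - p.fst z.2) / ‖z.1 - z.2‖ ^ (3 / 2 : ℝ)}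
  zero_mem' := by
    have h1 := (Measure.quasiMeasurePreserving_fst (μ := surfaceMeasure B)
      (ν := surfaceMeasure B)).ae (Lp.coeFn_zero ℝ 2 (surfaceMeasure B))
    have h2 := (Measure.quasiMeasurePreserving_snd (μ := surfaceMeasure B)
      (ν := surfaceMeasure B)).ae (Lp.coeFn_zero ℝ 2 (surfaceMeasure B))
    have h3 := Lp.coeFn_zero ℝ 2 ((surfaceMeasure B).prod (surfaceMeasure B))
    filter_upwards [h1, h2, h3] with z h1 h2 h3
    simp only [WithLp.zero_fst, WithLp.zero_snd]
    rw [h1, h2, h3]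
    simp
  add_mem' := by
    intro p q hp hq
    have h1 := (Measure.quasiMeasurePreserving_fst (μ := surfaceMeasure B)
      (ν := surfaceMeasure B)).ae (Lp.coeFn_add p.fst q.fst)
    have h2 := (Measure.quasiMeasurePreserving_snd (μ := surfaceMeasure B)
      (ν := surfaceMeasure B)).ae (Lp.coeFn_add p.fst q.fst)
    have h3 := Lp.coeFn_add p.snd q.snd
    rw [Set.mem_ofPred_eq] at hp hq ⊢
    filter_upwards [h1, h2, h3, hp, hq] with z h1 h2 h3 hp hq
    simp only [WithLp.add_fst, WithLp.add_snd]
    rw [h1, h2, h3]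
    simp only [Pi.add_apply]
    rw [hp, hq]
    ring
  smul_mem' := by
    intro a p hp
    have h1 := (Measure.quasiMeasurePreserving_fst (μ := surfaceMeasure B)
      (ν := surfaceMeasure B)).ae (Lp.coeFn_smul a p.fst)
    have h2 := (Measure.quasiMeasurePreserving_snd (μ := surfaceMeasure B)
      (ν := surfaceMeasure B)).ae (Lp.coeFn_smul a p.fst)
    have h3 := Lp.coeFn_smul a p.snd
    rw [Set.mem_ofPred_eq] at hp ⊢
    filter_upwards [h1, h2, h3, hp] with z h1 h2 h3 hp
    simp only [WithLp.smul_fst, WithLp.smul_snd]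
    rw [h1, h2, h3]
    simp only [Pi.smul_apply, smul_eq_mul]
    rw [hp]
    ring

/-- The embedding `H^{1/2}(∂B) → L²(∂B)`. -/
def toL2 (B : Set E3) : HHalf B →L[ℝ] L2 B :=
  (WithLp.fstL 2 ℝ (L2 B) (L2Prod B)).comp (HHalf B).subtypeL

/-- `H^{-1/2}(∂B)`, the dual space of `H^{1/2}(∂B)`; the duality pairing is evaluation. -/
abbrev HNegHalf (B : Set E3) : Type := HHalf B →L[ℝ] ℝ

/-- The embedding `L²(∂B) → H^{-1/2}(∂B)`, `ψ ↦ (f ↦ ∫ ψ f dσ)`. -/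
def ofL2 (B : Set E3) (ψ : L2 B) : HNegHalf B := (innerSL ℝ ψ).comp (toL2 B)

/-! ### Boundary integral operators

Each operator is the bounded operator on `H^{-1/2}(∂B)` that is given on densities in `L²(∂B)`,
which are dense in `H^{-1/2}(∂B)`, by the integral over `∂B` against its kernel. -/

/-- The bounded operator `H^{-1/2}(∂B) → H^{1/2}(∂B)` with
`T[ψ](x) = ∫ G(x, y) ψ(y) dσ(y)` for `ψ ∈ L²(∂B)`. -/
def potential (B : Set E3) (G : E3 → E3 → ℝ) : HNegHalf B →L[ℝ] HHalf B :=
  Classical.epsilon fun T => ∀ ψ : L2 B,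
    ∀ᵐ x ∂(surfaceMeasure B), toL2 B (T (ofL2 B ψ)) x = ∫ y, G x y * ψ y ∂(surfaceMeasure B)

/-- The static single-layer potential `S_B`, with kernel `Γ(x, y) = -1 / (4π|x - y|)`. -/
def singleLayer (B : Set E3) : HNegHalf B →L[ℝ] HHalf B :=
  potential B fun x y => -(1 / (4 * Real.pi * ‖x - y‖))

/-- The second-order term `S_{B,2}` in the expansion of the Helmholtz single-layer potential in
the wavenumber; its kernel is `-(i/4π) (i|x - y|) / 2! = |x - y| / (8π)`. -/
def singleLayerTwo (B : Set E3) : HNegHalf B →L[ℝ] HHalf B :=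
  potential B fun x y => ‖x - y‖ / (8 * Real.pi)

/-- The inverse `S_B⁻¹ : H^{1/2}(∂B) → H^{-1/2}(∂B)`. -/
def singleLayerInv (B : Set E3) : HHalf B →L[ℝ] HNegHalf B :=
  ContinuousLinearMap.inverse (singleLayer B)

/-- The Neumann–Poincaré operator `K_B^*`, with kernel
`∂Γ(x, y)/∂ν(x) = (x - y) · ν(x) / (4π|x - y|³)`. -/
def neumannPoincare (B : Set E3) : HNegHalf B →L[ℝ] HNegHalf B :=
  Classical.epsilon fun T => ∀ ψ : L2 B, ∃ χ : L2 B,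
    (∀ᵐ x ∂(surfaceMeasure B), χ x =
      ∫ y, ⟪x - y, normal B x⟫ / (4 * Real.pi * ‖x - y‖ ^ 3) * ψ y ∂(surfaceMeasure B)) ∧
    T (ofL2 B ψ) = ofL2 B χ

/-- The inner product of `H^*(∂B)`: `⟨u, v⟩ = -⟨u, S_B[v]⟩_{-1/2,1/2}`. -/
def hstarInner (B : Set E3) (u v : HNegHalf B) : ℝ := -(u (singleLayer B v))

/-- `(l, φ)` is an eigenvalue of `K_B^*` with an eigenfunction normalised in `H^*(∂B)`. -/
def IsNormalisedEigenpair (B : Set E3) (l : ℝ) (φ : HNegHalf B) : Prop :=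
  neumannPoincare B φ = l • φ ∧ hstarInner B φ φ = 1

/-- `α = ⟨(I/2 - K_B^*) S_B⁻¹ S_{B,2}[φ], φ⟩_{H^*(∂B)}`. -/
def alpha (B : Set E3) (φ : HNegHalf B) : ℝ :=
  hstarInner B
    ((1 / 2 : ℝ) • singleLayerInv B (singleLayerTwo B φ)
      - neumannPoincare B (singleLayerInv B (singleLayerTwo B φ))) φ

/-! ### Drude model and resonances -/

/-- The speed of light `c = 1 / √(ε_m μ_m)` in the surrounding medium. -/
def lightSpeed (εm μm : ℝ) : ℝ := 1 / √(εm * μm)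

/-- The denominator `Ω² + iΩ/T` of the Drude model. -/
def drudeDenom (T : ℝ) (Ω : ℂ) : ℂ := Ω ^ 2 + Complex.I * Ω * (T : ℂ)⁻¹

/-- The Drude permittivity `ε_c(Ω) = ε₀ (1 - ω_p² / (Ω² + iΩ/T))`. -/
def drude (ε₀ ωp T : ℝ) (Ω : ℂ) : ℂ := ε₀ * (1 - (ωp : ℂ) ^ 2 / drudeDenom T Ω)

/-- The contrast `λ = (ε_m + ε_c) / (2 (ε_m - ε_c))`. -/
def contrast (εm : ℝ) (εc : ℂ) : ℂ := (εm + εc) / (2 * (εm - εc))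

/-- The eigenvalue `τ_j = (1/ε_c - 1/ε_m) (λ - λ_j)` of the limiting operator. -/
def tau (εm : ℝ) (εc : ℂ) (l : ℝ) : ℂ := (1 / εc - 1 / εm) * (contrast εm εc - l)

/-- `τ_{j,2} = ⟨A_{B,2} φ_j, φ_j⟩_{H^*(∂B)}` with
`A_{B,2} = (ε_m - ε_c) / (ε_m ε_c) (I/2 - K_B^*) S_B⁻¹ S_{B,2}`. -/
def tauTwo (B : Set E3) (εm : ℝ) (εc : ℂ) (φ : HNegHalf B) : ℂ :=
  (εm - εc) / (εm * εc) * alpha B φ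

/-- `Ω` is a first-order corrected plasmonic resonance (dimension three) of the particle of size
`δ` for the eigenpair `(l, φ)`: all quantities involved are defined at `Ω`, and
`τ_j + (Ωδ/c)² τ_{j,2} = 0`. -/
def IsCorrectedResonance (B : Set E3) (ε₀ εm μm ωp T δ : ℝ) (l : ℝ) (φ : HNegHalf B)
    (Ω : ℂ) : Prop :=
  drudeDenom T Ω ≠ 0 ∧ drude ε₀ ωp T Ω ≠ 0 ∧ drude ε₀ ωp T Ω ≠ εm ∧
  ‖tau εm (drude ε₀ ωp T Ω) l
    + (Ω * δ / lightSpeed εm μm) ^ 2 * tauTwo B εm (drude ε₀ ωp T Ω) φ‖ = 0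

/-- `1 + (ω_p δ / c)² α`. -/
def correction (c ωp δ a : ℝ) : ℝ := 1 + (ωp * δ / c) ^ 2 * a

/-- `ω_p² (l + 1/2) / [1 + (ω_p δ/c)² α] - T⁻² / (4 [1 + (ω_p δ/c)² α]²)`. -/
def radicand (c ωp T δ l a : ℝ) : ℝ :=
  ωp ^ 2 * (l + 1 / 2) / correction c ωp δ a - T⁻¹ ^ 2 / (4 * correction c ωp δ a ^ 2)

/-- `Ω'`, the principal square root of the radicand (imaginary if the radicand is negative). -/
def omegaPrime (c ωp T δ l a : ℝ) : ℂ := (radicand c ωp T δ l a : ℂ) ^ (1 / 2 : ℂ)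

/-- `Ω'' = -T⁻¹ / (2 [1 + (ω_p δ/c)² α])`. -/
def omegaDoublePrime (c ωp T δ a : ℝ) : ℝ := -(T⁻¹ / (2 * correction c ωp δ a))

/-- `Ω⁺ = Ω' + iΩ''`. -/
def omegaPlus (c ωp T δ l a : ℝ) : ℂ :=
  omegaPrime c ωp T δ l a + Complex.I * omegaDoublePrime c ωp T δ a

/-- `Ω⁻ = -Ω' + iΩ''`. -/
def omegaMinus (c ωp T δ l a : ℝ) : ℂ :=
  -omegaPrime c ωp T δ l a + Complex.I * omegaDoublePrime c ωp T δ a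

end Plasmon

end

noncomputable section

namespace Plasmon

/-! ### Geometry of the boundary -/

open Filter Asymptotics

namespace IsReferenceParticle

variable {B : Set E3} (hB : IsReferenceParticle B)

include hB

/-! The argument has an analytic half, which shows `-1/2 < λ_j < 1/2`, and an algebraic half, which
uses nothing else about the operators: the single-layer potentials enter only through the real
number `α_j`.

Spectral bound. By strict convexity the kernel of `K_B^*` is positive off the diagonal, and its
integral in `x` for fixed `y` is the solid angle of `∂B` seen from `y`, divided by `4π`, hence at
most `1/2` (`lintegral_solidAngle_le`). So `K_B^*` has `L¹` norm at most `1/2`. An eigenfunction in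
`H^{-1/2}` for a nonzero eigenvalue lies in `L²`, hence in `L¹`, because the transposed operator
maps `L²` into `H^{1/2}` (`exists_transpose`, `exists_L2_eigenfunction`); this gives `|λ_j| ≤ 1/2`.
For `λ_j = -1/2` the triangle inequality is an equality, so the eigenfunction has opposite signs at
almost any two points of its support, which is impossible for three points. The value `1/2` is
excluded by assumption.

Algebra. With `w = Ωδ/c`, `P = ω_p δ/c`, `g = δ/(cT)`, `u = λ_j + 1/2 - α_j w²` and `v = 1/2 - λ_j +
α_j w²`, clearing denominators turns the resonance condition into `(w² + igw)(ε₀ u + ε_m v) = ε₀ P²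
u`, the relation `Dispersion`. Since `u + v = 1`, in vacuum this collapses to a quadratic with
explicit roots. In general it is a quartic in `w` (possibly degenerate). For small `g` and `P` it
splits into a factor `w² + ipw - q` with small real `p`, `q` and a cofactor without roots in `|w| <
η` (`exists_quadratic_factor`, `exists_dispersion_pair`); the roots of the first factor are `±√(q -
p²/4) - ip/2`. Decay in time follows by separating real and imaginary parts
(`not_dispersion_of_im_nonneg`), and the size bound from the triangle inequality. The spectral bound
makes `u`, `v` and `ε₀ u + ε_m v` nonzero at low frequency, so no root is lost to a vanishing
denominator. -/

theorem mem_nhds_zero : B ∈ 𝓝 (0 : E3) := hB.isOpen.mem_nhds hB.zero_mem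

theorem absorbent : Absorbent ℝ B := absorbent_nhds_zero hB.mem_nhds_zero

theorem mem_iff_gauge {x : E3} : x ∈ B ↔ gauge B x < 1 := by
  rw [gauge_lt_one_iff_mem_interior hB.convex hB.mem_nhds_zero, hB.isOpen.interior_eq]

theorem mem_frontier_iff_gauge {x : E3} : x ∈ frontier B ↔ gauge B x = 1 :=
  (gauge_eq_one_iff_mem_frontier hB.convex hB.mem_nhds_zero).symm

theorem continuous_gauge : Continuous (gauge B) :=
  _root_.continuous_gauge hB.convex hB.mem_nhds_zero

theorem gauge_pos {x : E3} (hx : x ≠ 0) : 0 < gauge B x :=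
  (_root_.gauge_pos hB.absorbent (NormedSpace.isVonNBounded_of_isBounded ℝ hB.isBounded)).2 hx

theorem ne_zero_of_mem_frontier {x : E3} (hx : x ∈ frontier B) : x ≠ 0 := by
  rintro rfl
  have := hB.mem_frontier_iff_gauge.1 hx
  simp at this

omit hB in
theorem gauge_smul {t : ℝ} (ht : 0 ≤ t) (x : E3) : gauge B (t • x) = t * gauge B x := by
  simpa using gauge_smul_of_nonneg (s := B) ht x

theorem inv_gauge_smul_mem_frontier {z : E3} (hz : z ≠ 0) :
    (gauge B z)⁻¹ • z ∈ frontier B := by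
  have := hB.gauge_pos hz
  rw [hB.mem_frontier_iff_gauge, gauge_smul (inv_nonneg.2 this.le), inv_mul_cancel₀ this.ne']

theorem isCompact_frontier : IsCompact (frontier B) :=
  Metric.isCompact_of_isClosed_isBounded isClosed_frontier
    (hB.isBounded.closure.subset frontier_subset_closure)

theorem exists_ball_subset : ∃ r : ℝ, 0 < r ∧ Metric.ball (0 : E3) r ⊆ B :=
  Metric.isOpen_iff.1 hB.isOpen 0 hB.zero_mem

theorem exists_gauge_le : ∃ C : ℝ, 0 < C ∧ ∀ x : E3, gauge B x ≤ C * ‖x‖ := by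
  obtain ⟨r, hr, h⟩ := hB.exists_ball_subset
  refine ⟨r⁻¹, inv_pos.2 hr, fun x => ?_⟩
  have := mul_gauge_le_norm (x := x) h
  rw [inv_mul_eq_div, le_div_iff₀ hr]
  linarith

theorem exists_le_gauge : ∃ R : ℝ, 0 < R ∧ ∀ x : E3, ‖x‖ ≤ R * gauge B x := by
  obtain ⟨R, hR, h⟩ := hB.isBounded.subset_closedBall_lt 0 0
  refine ⟨R, hR, fun x => ?_⟩
  have := le_gauge_of_subset_closedBall (x := x) hB.absorbent hR.le h
  rwa [div_le_iff₀ hR, mul_comm] at this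

/-- A local defining function vanishes on the boundary, and its differential is a positive
multiple of the outward normal covector. -/
theorem definingFunction {ρ : E3 → ℝ} {y : E3} (hy : y ∈ frontier B) (hρ : ContDiff ℝ ∞ ρ)
    (hd : fderiv ℝ ρ y ≠ 0) (hloc : ∀ᶠ z in 𝓝 y, (z ∈ B ↔ ρ z < 0)) :
    ρ y = 0 ∧ 0 < fderiv ℝ ρ y y := by
  have hyB : y ∉ B := fun h => by
    have := hB.mem_iff_gauge.1 h
    rw [hB.mem_frontier_iff_gauge.1 hy] at this
    exact lt_irrefl _ this
  have h0 : ρ y = 0 := by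
    apply le_antisymm
    · have hc : y ∈ closure {z | ρ z < 0} := by
        have hy' : ∃ᶠ z in 𝓝 y, z ∈ B :=
          mem_closure_iff_frequently.1 (frontier_subset_closure hy)
        exact mem_closure_iff_frequently.2
          ((hy'.and_eventually hloc).mono fun z hz => hz.2.1 hz.1)
      exact closure_lt_subset_le hρ.continuous continuous_const hc
    · by_contra h
      exact hyB (hloc.self_of_nhds.2 (not_le.1 h))
  have hdiff : DifferentiableAt ℝ ρ y := (hρ.differentiable (by simp)) y
  -- The segment from `y` to `b` enters `B`, where `ρ < 0 = ρ y`, so the one-sided derivative along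
  -- it is nonpositive: the covector `fderiv ℝ ρ y` supports `B` at `y`.
  have hle : ∀ b ∈ B, fderiv ℝ ρ y b ≤ fderiv ℝ ρ y y := by
    intro b hb
    have hline : HasDerivAt (fun t : ℝ => ρ (y + t • (b - y))) (fderiv ℝ ρ y (b - y)) 0 := by
      have h1 : HasDerivAt (fun t : ℝ => y + t • (b - y)) (b - y) 0 := by
        simpa using ((hasDerivAt_id (0 : ℝ)).smul_const (b - y)).const_add y
      have h2 : HasFDerivAt ρ (fderiv ℝ ρ y) (y + (0 : ℝ) • (b - y)) := by
        simpa using hdiff.hasFDerivAt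
      exact h2.comp_hasDerivAt (0 : ℝ) h1
    have hev : ∀ᶠ t : ℝ in 𝓝[>] 0, ρ (y + t • (b - y)) < 0 := by
      have ht : Tendsto (fun t : ℝ => y + t • (b - y)) (𝓝[>] 0) (𝓝 y) := by
        have : Tendsto (fun t : ℝ => y + t • (b - y)) (𝓝 0) (𝓝 (y + (0 : ℝ) • (b - y))) :=
          (Continuous.tendsto (by fun_prop) 0)
        simpa using this.mono_left nhdsWithin_le_nhds
      filter_upwards [ht.eventually hloc, self_mem_nhdsWithin,
        nhdsWithin_le_nhds (gt_mem_nhds one_pos)] with t h1 h2 h3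
      rw [← h1, hB.mem_iff_gauge]
      have h2' : (0 : ℝ) < t := h2
      have e : y + t • (b - y) = (1 - t) • y + t • b := by
        rw [smul_sub, sub_smul, one_smul]; abel
      rw [e]
      calc _ ≤ gauge B ((1 - t) • y) + gauge B (t • b) := gauge_add_le hB.convex hB.absorbent _ _
        _ = (1 - t) + t * gauge B b := by
          rw [gauge_smul (by linarith), gauge_smul h2'.le,
            hB.mem_frontier_iff_gauge.1 hy, mul_one]
        _ < 1 := by nlinarith [hB.mem_iff_gauge.1 hb]
    have hslope := (hasDerivAt_iff_tendsto_slope.1 hline).mono_left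
      (nhdsWithin_mono (0 : ℝ) (fun t (ht : t ∈ Ioi (0 : ℝ)) => ne_of_gt ht))
    have : fderiv ℝ ρ y (b - y) ≤ 0 := by
      refine le_of_tendsto hslope ?_
      filter_upwards [hev, self_mem_nhdsWithin] with t h1 h2
      have h2' : (0 : ℝ) < t := h2
      rw [slope_def_field]
      simp only [zero_smul, add_zero, h0, sub_zero]
      exact div_nonpos_of_nonpos_of_nonneg h1.le h2'.le
    rw [map_sub] at this
    linarith
  refine ⟨h0, ?_⟩
  obtain ⟨h, hh⟩ : ∃ h, fderiv ℝ ρ y h ≠ 0 := by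
    by_contra! hcon
    exact hd (ContinuousLinearMap.ext hcon)
  wlog hpos : 0 < fderiv ℝ ρ y h generalizing h
  · exact this (-h) (by simpa using hh) (by
      rw [map_neg]; linarith [lt_of_le_of_ne (not_lt.1 hpos) hh])
  -- The origin is interior, so a small multiple of a direction with positive derivative lies in
  -- `B`; the supporting inequality at that point gives strict positivity.
  have hsm : ∀ᶠ t : ℝ in 𝓝[>] 0, t • h ∈ B := by
    have : Tendsto (fun t : ℝ => t • h) (𝓝 0) (𝓝 ((0 : ℝ) • h)) :=
      Continuous.tendsto (by fun_prop) 0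
    rw [zero_smul] at this
    exact nhdsWithin_le_nhds (this hB.mem_nhds_zero)
  obtain ⟨t, ht, ht0⟩ := (hsm.and self_mem_nhdsWithin).exists
  have ht0' : (0 : ℝ) < t := ht0
  have := hle _ ht
  rw [map_smul, smul_eq_mul] at this
  exact (mul_pos ht0' hpos).trans_le this

/-- The radial projection `q z = z / gauge z` lands on the boundary, where `ρ` vanishes, and `q z -
y = O(z - y)` because the gauge is Lipschitz. Hence `dρ(q z - y) = o(z - y)`. Inserting `gauge z •
(q z - y) = (z - y) - (gauge z - 1) • y` isolates `gauge z - 1` to first order, since `dρ(y) ≠ 0`.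
No implicit function is needed. -/
theorem hasFDerivAt_gauge_of_definingFunction {ρ : E3 → ℝ} {y : E3} (hy : y ∈ frontier B)
    (hρ : ContDiff ℝ ∞ ρ) (hd : fderiv ℝ ρ y ≠ 0) (hloc : ∀ᶠ z in 𝓝 y, (z ∈ B ↔ ρ z < 0)) :
    HasFDerivAt (gauge B) ((fderiv ℝ ρ y y)⁻¹ • fderiv ℝ ρ y) y := by
  obtain ⟨h0, hpos⟩ := hB.definingFunction hy hρ hd hloc
  have hy1 : gauge B y = 1 := hB.mem_frontier_iff_gauge.1 hy
  have hy0 := hB.ne_zero_of_mem_frontier hy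
  set q : E3 → E3 := fun z => (gauge B z)⁻¹ • z with hq
  have hqy : q y = y := by simp [hq, hy1]
  have hqc : ContinuousAt q y :=
    (hB.continuous_gauge.continuousAt.inv₀ (by rw [hy1]; exact one_ne_zero)).smul continuousAt_id
  have hqt : Tendsto q (𝓝 y) (𝓝 y) := by simpa [ContinuousAt, hqy] using hqc
  have hne : ∀ᶠ z in 𝓝 y, z ≠ 0 := eventually_ne_nhds hy0
  obtain ⟨K, hK⟩ := hB.convex.lipschitz_gauge hB.mem_nhds_zero
  have key : ∀ z, z ≠ 0 → gauge B z • (q z - y) = (z - y) - (gauge B z - 1) • y := by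
    intro z hz
    simp only [hq]
    rw [smul_sub, smul_smul, mul_inv_cancel₀ (hB.gauge_pos hz).ne', sub_smul, one_smul, one_smul]
    abel
  have hO : (fun z => q z - y) =O[𝓝 y] fun z => z - y := by
    refine IsBigO.of_bound (2 * (1 + K * ‖y‖)) ?_
    have hhalf : ∀ᶠ z in 𝓝 y, (1 / 2 : ℝ) < gauge B z :=
      hB.continuous_gauge.continuousAt.eventually (lt_mem_nhds (by rw [hy1]; norm_num))
    filter_upwards [hne, hhalf] with z hz hz2
    have h1 := congrArg norm (key z hz)
    rw [norm_smul, Real.norm_of_nonneg (by linarith)] at h1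
    have h2 : ‖(z - y) - (gauge B z - 1) • y‖ ≤ ‖z - y‖ + K * ‖z - y‖ * ‖y‖ := by
      refine (norm_sub_le _ _).trans ?_
      rw [norm_smul]
      gcongr
      have := hK.dist_le_mul z y
      rwa [hy1, Real.dist_eq, dist_eq_norm] at this
    nlinarith [norm_nonneg (q z - y)]
  have hqz : ∀ᶠ z in 𝓝 y, ρ (q z) = 0 := by
    have hev : ∀ᶠ z in 𝓝 y, z ∈ frontier B → ρ z = 0 := by
      have hfd : ∀ᶠ z in 𝓝 y, fderiv ℝ ρ z ≠ 0 :=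
        (hρ.continuous_fderiv (by simp)).continuousAt.eventually_ne hd
      filter_upwards [hloc.eventually_nhds, hfd] with z h1 h2 hz
      exact (hB.definingFunction hz hρ h2 h1).1
    filter_upwards [hqt.eventually hev, hne] with z h1 h2
    exact h1 (hB.inv_gauge_smul_mem_frontier h2)
  have hdiff : HasFDerivAt ρ (fderiv ℝ ρ y) y := (hρ.differentiable (by simp) y).hasFDerivAt
  have ho : (fun z => fderiv ℝ ρ y (q z - y)) =o[𝓝 y] fun z => z - y := by
    have h1 := ((hasFDerivAt_iff_isLittleO.1 hdiff).comp_tendsto hqt).trans_isBigO hO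
    refine h1.neg_left.congr' ?_ EventuallyEq.rfl
    filter_upwards [hqz] with z hz
    simp [hz, h0]
  rw [hasFDerivAt_iff_isLittleO]
  have hg : (fun z => -((fderiv ℝ ρ y y)⁻¹ * gauge B z)) =O[𝓝 y] (fun _ => (1 : ℝ)) :=
    (continuousAt_const.mul hB.continuous_gauge.continuousAt).neg.tendsto.isBigO_one ℝ
  have := hg.mul_isLittleO ho.norm_right
  refine ((this.congr' ?_ ?_).of_norm_right)
  · filter_upwards [hne] with z hz
    have := congrArg (fderiv ℝ ρ y) (key z hz)
    rw [map_smul, map_sub _ (z - y), map_smul, smul_eq_mul, smul_eq_mul] at this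
    simp only [smul_apply, smul_eq_mul, hy1]
    field_simp
    linarith
  · exact Eventually.of_forall fun z => by simp

theorem differentiableAt_gauge {z : E3} (hz : z ≠ 0) : DifferentiableAt ℝ (gauge B) z := by
  have hp := hB.gauge_pos hz
  have hy := hB.inv_gauge_smul_mem_frontier hz
  obtain ⟨ρ, hρ, hd, hloc⟩ := hB.smoothBoundary _ hy
  have h1 := (hB.hasFDerivAt_gauge_of_definingFunction hy hρ hd hloc).differentiableAt
  have h2 : DifferentiableAt ℝ (fun w : E3 => gauge B ((gauge B z)⁻¹ • w)) z :=
    DifferentiableAt.comp (g := gauge B) z h1 (by fun_prop)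
  have h3 : gauge B = fun w => gauge B z * gauge B ((gauge B z)⁻¹ • w) := by
    funext w
    rw [gauge_smul (inv_nonneg.2 hp.le), mul_inv_cancel_left₀ hp.ne']
  rw [h3]
  exact h2.const_mul _

theorem hasFDerivAt_gauge {z : E3} (hz : z ≠ 0) : HasFDerivAt (gauge B) (fderiv ℝ (gauge B) z) z :=
  (hB.differentiableAt_gauge hz).hasFDerivAt

theorem fderiv_gauge_self {z : E3} (hz : z ≠ 0) : fderiv ℝ (gauge B) z z = gauge B z := by
  have h1 : HasDerivAt (fun t : ℝ => gauge B (t • z)) (fderiv ℝ (gauge B) z z) 1 := by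
    have h2 : HasFDerivAt (gauge B) (fderiv ℝ (gauge B) z) ((1 : ℝ) • z) := by
      simpa using hB.hasFDerivAt_gauge hz
    simpa [Function.comp_def] using
      h2.comp_hasDerivAt (1 : ℝ) ((hasDerivAt_id (1 : ℝ)).smul_const z)
  have h3 : HasDerivAt (fun t : ℝ => t * gauge B z) (gauge B z) 1 := by
    simpa using (hasDerivAt_id (1 : ℝ)).mul_const (gauge B z)
  refine h1.unique (h3.congr_of_eventuallyEq ?_)
  filter_upwards [lt_mem_nhds one_pos] with t ht
  exact gauge_smul (le_of_lt ht) z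

theorem fderiv_gauge_smul {z : E3} (hz : z ≠ 0) {t : ℝ} (ht : 0 < t) :
    fderiv ℝ (gauge B) (t • z) = fderiv ℝ (gauge B) z := by
  have h1 : HasFDerivAt (fun w : E3 => t⁻¹ * gauge B (t • w)) (fderiv ℝ (gauge B) (t • z)) z := by
    have h2 := (hB.hasFDerivAt_gauge (smul_ne_zero ht.ne' hz)).comp z
      ((hasFDerivAt_id (𝕜 := ℝ) z).const_smul t)
    have h3 := h2.const_mul t⁻¹
    refine h3.congr_fderiv ?_
    ext w
    simp [ht.ne']
  refine h1.unique ((hB.hasFDerivAt_gauge hz).congr_of_eventuallyEq (Eventually.of_forall ?_))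
  intro w
  simp only
  rw [gauge_smul ht.le, inv_mul_cancel_left₀ ht.ne']

/-- Subadditivity bounds the right difference quotients. Together with Euler's identity
`fderiv_gauge_self` this is the supporting hyperplane inequality, from which the signs of normal
components and of the Jacobian of `recenter` are read off. -/
theorem fderiv_gauge_le {z : E3} (hz : z ≠ 0) (h : E3) : fderiv ℝ (gauge B) z h ≤ gauge B h := by
  have hline : HasDerivAt (fun t : ℝ => gauge B (z + t • h)) (fderiv ℝ (gauge B) z h) 0 := by
    have h1 : HasDerivAt (fun t : ℝ => z + t • h) h 0 := by
      simpa using ((hasDerivAt_id (0 : ℝ)).smul_const h).const_add z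
    have h2 : HasFDerivAt (gauge B) (fderiv ℝ (gauge B) z) (z + (0 : ℝ) • h) := by
      simpa using hB.hasFDerivAt_gauge hz
    exact h2.comp_hasDerivAt (0 : ℝ) h1
  have hslope := (hasDerivAt_iff_tendsto_slope.1 hline).mono_left
    (nhdsWithin_mono (0 : ℝ) (fun t (ht : t ∈ Ioi (0 : ℝ)) => ne_of_gt ht))
  refine le_of_tendsto hslope ?_
  filter_upwards [self_mem_nhdsWithin] with t ht
  have ht' : (0 : ℝ) < t := ht
  rw [slope_def_field]
  simp only [zero_smul, add_zero, sub_zero]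
  rw [div_le_iff₀ ht', mul_comm, ← gauge_smul ht'.le]
  linarith [gauge_add_le hB.convex hB.absorbent z (t • h)]

omit hB in
theorem inner_gradient_gauge (z h : E3) : ⟪h, gradient (gauge B) z⟫ = fderiv ℝ (gauge B) z h := by
  rw [real_inner_comm, gradient, InnerProductSpace.toDual_symm_apply]

theorem norm_gradient_gauge_pos {z : E3} (hz : z ≠ 0) : 0 < ‖gradient (gauge B) z‖ := by
  rw [norm_pos_iff]
  intro h
  have h1 := inner_gradient_gauge (B := B) z z
  rw [h, inner_zero_right, hB.fderiv_gauge_self hz] at h1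
  exact (hB.gauge_pos hz).ne h1

omit hB in
theorem inner_normal (z h : E3) :
    ⟪h, normal B z⟫ = ‖gradient (gauge B) z‖⁻¹ * fderiv ℝ (gauge B) z h := by
  rw [normal, inner_smul_right, inner_gradient_gauge]

theorem inner_sub_normal_nonneg {x y : E3} (hx : x ∈ closure B) (hy : y ∈ frontier B) :
    0 ≤ ⟪y - x, normal B y⟫ := by
  have hy0 := hB.ne_zero_of_mem_frontier hy
  have hx1 := (gauge_le_one_iff_mem_closure hB.convex hB.mem_nhds_zero).2 hx
  rw [inner_normal, map_sub, hB.fderiv_gauge_self hy0, hB.mem_frontier_iff_gauge.1 hy]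
  exact mul_nonneg (inv_nonneg.2 (norm_nonneg _))
    (by linarith [hB.fderiv_gauge_le hy0 x])

theorem gauge_lt_one_of_openSegment {x y z : E3} (hx : x ∈ closure B) (hy : y ∈ closure B)
    (hxy : x ≠ y) (hz : z ∈ openSegment ℝ x y) : gauge B z < 1 := by
  have h := hB.strictConvex_closure.openSegment_subset hx hy hxy hz
  rwa [hB.convex.interior_closure_eq_interior_of_nonempty_interior
    (by rw [hB.isOpen.interior_eq]; exact ⟨0, hB.zero_mem⟩),
    ← gauge_lt_one_iff_mem_interior hB.convex hB.mem_nhds_zero] at h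

/-- The supporting inequality is applied to the midpoint of `x` and `y`, whose gauge is strictly
below one by strict convexity. -/
theorem inner_sub_normal_pos {x y : E3} (hx : x ∈ frontier B) (hy : y ∈ frontier B)
    (hxy : x ≠ y) : 0 < ⟪y - x, normal B y⟫ := by
  have hy0 := hB.ne_zero_of_mem_frontier hy
  have hm : gauge B ((1 / 2 : ℝ) • x + (1 / 2 : ℝ) • y) < 1 :=
    hB.gauge_lt_one_of_openSegment (frontier_subset_closure hx) (frontier_subset_closure hy) hxy
      ⟨1 / 2, 1 / 2, by norm_num, by norm_num, by norm_num, rfl⟩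
  have h1 := hB.fderiv_gauge_le hy0 ((1 / 2 : ℝ) • x + (1 / 2 : ℝ) • y)
  have h2 := hB.fderiv_gauge_self hy0
  rw [hB.mem_frontier_iff_gauge.1 hy] at h2
  rw [map_add, map_smul, map_smul, h2, smul_eq_mul, smul_eq_mul] at h1
  rw [inner_normal, map_sub, h2]
  exact mul_pos (inv_pos.2 (hB.norm_gradient_gauge_pos hy0)) (by linarith)

theorem normal_eq_of_definingFunction {ρ : E3 → ℝ} {y : E3} (hy : y ∈ frontier B)
    (hρ : ContDiff ℝ ∞ ρ) (hd : fderiv ℝ ρ y ≠ 0) (hloc : ∀ᶠ z in 𝓝 y, (z ∈ B ↔ ρ z < 0)) :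
    normal B y = ‖gradient ρ y‖⁻¹ • gradient ρ y := by
  have hpos := (hB.definingFunction hy hρ hd hloc).2
  have h : gradient (gauge B) y = (fderiv ℝ ρ y y)⁻¹ • gradient ρ y := by
    rw [gradient, (hB.hasFDerivAt_gauge_of_definingFunction hy hρ hd hloc).fderiv, map_smulₛₗ]
    rfl
  rw [normal, h, norm_smul, Real.norm_of_nonneg (inv_nonneg.2 hpos.le), smul_smul]
  congr 1
  field_simp

/-- Near a boundary point the normal is the normalised gradient of a smooth defining function, hence
`C¹`; compactness of the boundary makes the Lipschitz constant global. -/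
theorem exists_lipschitzOnWith_normal : ∃ K, LipschitzOnWith K (normal B) (frontier B) := by
  refine LocallyLipschitzOn.exists_lipschitzOnWith_of_compact hB.isCompact_frontier ?_
  intro x hx
  obtain ⟨ρ, hρ, hd, hloc⟩ := hB.smoothBoundary x hx
  have hgrad : ContDiff ℝ 1 (gradient ρ) :=
    (InnerProductSpace.toDual ℝ E3).symm.toContinuousLinearEquiv.contDiff.comp
      (hρ.fderiv_right (m := 1) (by norm_cast))
  have hne : gradient ρ x ≠ 0 := fun h => hd (by simpa [gradient] using h)
  have hn : ContDiffAt ℝ 1 (fun y => ‖gradient ρ y‖⁻¹ • gradient ρ y) x :=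
    ((hgrad.contDiffAt.norm ℝ hne).inv (norm_ne_zero_iff.2 hne)).smul hgrad.contDiffAt
  obtain ⟨K, t, ht, hK⟩ := hn.exists_lipschitzOnWith
  have hfd : ∀ᶠ z in 𝓝 x, fderiv ℝ ρ z ≠ 0 :=
    (hρ.continuous_fderiv (by simp)).continuousAt.eventually_ne hd
  refine ⟨K, frontier B ∩ {y | y ∈ t ∧ (∀ᶠ z in 𝓝 y, (z ∈ B ↔ ρ z < 0)) ∧ fderiv ℝ ρ y ≠ 0},
    inter_mem_nhdsWithin _ (Filter.inter_mem ht (hloc.eventually_nhds.and hfd)), ?_⟩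
  intro y hy z hz
  rw [hB.normal_eq_of_definingFunction hy.1 hρ hy.2.2.2 hy.2.2.1,
    hB.normal_eq_of_definingFunction hz.1 hρ hz.2.2.2 hz.2.2.1]
  exact hK hy.2.1 hz.2.1

end IsReferenceParticle

/-! ### The surface measure -/

open scoped Pointwise ENNReal

abbrev unitSphere : Set E3 := Metric.sphere (0 : E3) 1

/-- The measure of a spherical cap is at most quadratic in its radius. -/
theorem exists_toSphere_closedBall_le : ∃ C : ℝ, 0 ≤ C ∧ ∀ (θ : unitSphere) (r : ℝ), 0 < r →
    (volume : Measure E3).toSphere (Metric.closedBall θ r) ≤ ENNReal.ofReal (C * r ^ 2) := by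
  set v : ℝ := (volume : Measure E3).real (Metric.closedBall 0 1) with hv
  have hv0 : 0 ≤ v := measureReal_nonneg
  have hvol : ∀ (x : E3) {r : ℝ}, 0 ≤ r →
      (volume : Measure E3).real (Metric.closedBall x r) = r ^ 3 * v := by
    intro x r hr
    rw [measureReal_def, Measure.addHaar_closedBall' volume x hr, ENNReal.toReal_mul, hv]
    rw [ENNReal.toReal_ofReal (by positivity)]
    simp [measureReal_def]
  -- `toSphere` is three times the volume of the cone over the cap, and that cone has volume at most
  -- `8 r² v`.
  refine ⟨24 * v, by positivity, fun θ r hr => ?_⟩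
  set A : Set unitSphere := Metric.closedBall θ r with hA
  set V : ℝ := (volume : Measure E3).real (Ioo (0 : ℝ) 1 • ((↑) '' A)) with hV
  have hV0 : 0 ≤ V := measureReal_nonneg
  have hsub1 : Ioo (0 : ℝ) 1 • ((↑) '' A : Set E3) ⊆ Metric.closedBall 0 1 := by
    rintro _ ⟨t, ht, _, ⟨a, -, rfl⟩, rfl⟩
    have : ‖(a : E3)‖ = 1 := by simp
    simp only [mem_closedBall_zero_iff, norm_smul, this, mul_one, Real.norm_of_nonneg ht.1.le]
    exact ht.2.le
  have hfin : (volume : Measure E3) (Ioo (0 : ℝ) 1 • ((↑) '' A)) ≠ ⊤ :=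
    measure_ne_top_of_subset hsub1 measure_closedBall_lt_top.ne
  have hVle : V ≤ 8 * r ^ 2 * v := by
    rcases le_or_gt 1 r with h1 | h1
    · have : V ≤ v := measureReal_mono hsub1 measure_closedBall_lt_top.ne
      nlinarith [mul_nonneg hv0 (by nlinarith : (0 : ℝ) ≤ r ^ 2 - 1)]
    -- The cone is cut at radius `1 - r`: the inner part is the cone scaled by `1 - r`, the outer
    -- part lies in a ball of radius `2r`. Thus `V ≤ (1 - r)³ V + (2r)³ v`, and `1 - (1 - r)³ ≥ r`
    -- allows `V` to be absorbed.
    · have hsub2 : Ioo (0 : ℝ) 1 • ((↑) '' A : Set E3) ⊆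
          (1 - r) • (Ioo (0 : ℝ) 1 • ((↑) '' A : Set E3)) ∪ Metric.closedBall (θ : E3) (2 * r) := by
        rintro _ ⟨t, ht, _, ⟨a, ha, rfl⟩, rfl⟩
        have hn : ‖(a : E3)‖ = 1 := by simp
        rcases lt_or_ge t (1 - r) with h2 | h2
        · left
          refine ⟨((1 - r)⁻¹ * t) • (a : E3), ⟨(1 - r)⁻¹ * t, ⟨?_, ?_⟩, (a : E3), ⟨a, ha, rfl⟩, rfl⟩,
            ?_⟩
          · exact mul_pos (inv_pos.2 (by linarith)) ht.1
          · rw [inv_mul_lt_iff₀ (by linarith)]; linarith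
          · simp only [smul_smul]
            rw [mul_inv_cancel_left₀ (by linarith)]
        · right
          have ha' : ‖(a : E3) - θ‖ ≤ r := by
            have : dist a θ ≤ r := ha
            rwa [Subtype.dist_eq, dist_eq_norm] at this
          rw [mem_closedBall_iff_norm]
          have e : t • (a : E3) - θ = ((a : E3) - θ) - (1 - t) • (a : E3) := by
            rw [sub_smul, one_smul]; abel
          simp only [e]
          refine (norm_sub_le _ _).trans ?_
          rw [norm_smul, hn, Real.norm_of_nonneg (by linarith [ht.2])]
          linarith
      have h3 : V ≤ (1 - r) ^ 3 * V + (2 * r) ^ 3 * v := by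
        calc V ≤ (volume : Measure E3).real ((1 - r) • (Ioo (0 : ℝ) 1 • ((↑) '' A : Set E3)) ∪
                Metric.closedBall (θ : E3) (2 * r)) := by
              refine measureReal_mono hsub2 ?_
              refine (measure_union_lt_top ?_ measure_closedBall_lt_top).ne
              rw [Measure.addHaar_smul]
              exact ENNReal.mul_lt_top ENNReal.ofReal_lt_top hfin.lt_top
          _ ≤ _ := measureReal_union_le _ _
          _ = _ := by
              rw [hvol _ (by linarith)]
              congr 1
              rw [measureReal_def, Measure.addHaar_smul, ENNReal.toReal_mul,
                ENNReal.toReal_ofReal (abs_nonneg _)]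
              simp only [finrank_euclideanSpace, Fintype.card_fin]
              rw [abs_of_nonneg (pow_nonneg (by linarith) 3), hV, measureReal_def]
      have h4 : r * V ≤ (1 - (1 - r) ^ 3) * V := by
        refine mul_le_mul_of_nonneg_right ?_ hV0
        nlinarith [mul_nonneg hr.le (by linarith : 0 ≤ 1 - r), sq_nonneg (1 - r)]
      have h5 : r * V ≤ r * (8 * r ^ 2 * v) := by nlinarith
      exact le_of_mul_le_mul_left h5 hr
  rw [Measure.toSphere_apply' _ Metric.isClosed_closedBall.measurableSet]
  rw [← ENNReal.ofReal_toReal hfin, ← measureReal_def, ← hV]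
  simp only [finrank_euclideanSpace, Fintype.card_fin, Nat.cast_ofNat]
  rw [← ENNReal.ofReal_ofNat, ← ENNReal.ofReal_mul (by norm_num)]
  exact ENNReal.ofReal_le_ofReal (by linarith)

/-- The parametrisation `θ ↦ r(θ) θ` of `∂B` by the unit sphere. -/
def radialMap (B : Set E3) (θ : unitSphere) : E3 := radius B θ • (θ : E3)

/-- The density of the surface measure in the radial parametrisation. -/
def radialDensity (B : Set E3) (θ : unitSphere) : ℝ :=
  radius B θ ^ 2 / ⟪(θ : E3), normal B (radialMap B θ)⟫

theorem measurable_normal (B : Set E3) : Measurable (normal B) := by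
  have h : Measurable (gradient (gauge B)) :=
    (InnerProductSpace.toDual ℝ E3).symm.continuous.measurable.comp (measurable_fderiv ℝ (gauge B))
  exact h.norm.inv.smul h

theorem unitSphere.ne_zero (θ : unitSphere) : (θ : E3) ≠ 0 := by
  rw [← norm_ne_zero_iff]
  simp

/-! ### Radial parametrisation, upper Ahlfors regularity and Riesz potentials. -/

namespace IsReferenceParticle

variable {B : Set E3} (hB : IsReferenceParticle B)

include hB

theorem radius_pos (θ : unitSphere) : 0 < radius B θ :=
  inv_pos.2 (hB.gauge_pos (unitSphere.ne_zero θ))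

theorem radialMap_mem_frontier (θ : unitSphere) : radialMap B θ ∈ frontier B :=
  hB.inv_gauge_smul_mem_frontier (unitSphere.ne_zero θ)

theorem measurable_radius : Measurable (radius B) := hB.continuous_gauge.measurable.inv

theorem measurable_radialMap : Measurable (radialMap B) :=
  (hB.measurable_radius.comp measurable_subtype_coe).smul measurable_subtype_coe

theorem measurable_radialDensity : Measurable (radialDensity B) :=
  ((hB.measurable_radius.comp measurable_subtype_coe).pow_const 2).div
    (measurable_subtype_coe.inner ((measurable_normal B).comp hB.measurable_radialMap))

theorem lintegral_surfaceMeasure {g : E3 → ℝ≥0∞} (hg : Measurable g) :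
    ∫⁻ y, g y ∂(surfaceMeasure B) = ∫⁻ θ, ENNReal.ofReal (radialDensity B θ) * g (radialMap B θ)
      ∂(volume : Measure E3).toSphere := by
  have h1 : surfaceMeasure B = Measure.map (radialMap B) ((volume : Measure E3).toSphere.withDensity
      fun θ => ENNReal.ofReal (radialDensity B θ)) := rfl
  rw [h1, lintegral_map hg hB.measurable_radialMap]
  exact lintegral_withDensity_eq_lintegral_mul _ hB.measurable_radialDensity.ennreal_ofReal
    (hg.comp hB.measurable_radialMap)

theorem ae_mem_frontier : ∀ᵐ x ∂(surfaceMeasure B), x ∈ frontier B := by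
  have h : MeasurableSet {x | x ∈ frontier B} := isClosed_frontier.measurableSet
  have h1 : surfaceMeasure B = Measure.map (radialMap B) ((volume : Measure E3).toSphere.withDensity
      fun θ => ENNReal.ofReal (radialDensity B θ)) := rfl
  rw [h1, ae_map_iff hB.measurable_radialMap.aemeasurable h]
  exact Filter.Eventually.of_forall hB.radialMap_mem_frontier

theorem inner_normal_radialMap (θ : unitSphere) (h : E3) :
    ⟪h, normal B (radialMap B θ)⟫ =
      ‖gradient (gauge B) (radialMap B θ)‖⁻¹ * fderiv ℝ (gauge B) θ h := by
  rw [inner_normal, radialMap, hB.fderiv_gauge_smul (unitSphere.ne_zero θ) (hB.radius_pos θ)]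

/-- Euler's identity evaluates the obliqueness factor `θ · ν` and removes the quotient; positivity
and boundedness of the density become visible. -/
theorem radialDensity_eq (θ : unitSphere) :
    radialDensity B θ = radius B θ ^ 3 * ‖gradient (gauge B) (radialMap B θ)‖ := by
  have h0 := hB.gauge_pos (unitSphere.ne_zero θ)
  rw [radialDensity, hB.inner_normal_radialMap, hB.fderiv_gauge_self (unitSphere.ne_zero θ), radius]
  field_simp

theorem exists_radialDensity_le : ∃ C : ℝ, 0 ≤ C ∧ ∀ θ, radialDensity B θ ≤ C := by
  obtain ⟨C, hC, h1⟩ := hB.exists_gauge_le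
  obtain ⟨R, hR, h2⟩ := hB.exists_le_gauge
  refine ⟨R ^ 3 * C, by positivity, fun θ => ?_⟩
  rw [hB.radialDensity_eq]
  have hr : radius B θ ≤ R := by
    have := h2 θ
    rw [radius, inv_le_comm₀ (hB.gauge_pos (unitSphere.ne_zero θ)) hR]
    rw [inv_le_iff_one_le_mul₀ hR]
    have hn : ‖(θ : E3)‖ = 1 := by simp
    linarith
  have hg : ‖gradient (gauge B) (radialMap B θ)‖ ≤ C := by
    have hne := hB.ne_zero_of_mem_frontier (hB.radialMap_mem_frontier θ)
    have h3 := (hB.fderiv_gauge_le hne (gradient (gauge B) (radialMap B θ))).trans (h1 _)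
    rw [← inner_gradient_gauge, real_inner_self_eq_norm_mul_norm] at h3
    exact le_of_mul_le_mul_right h3 (hB.norm_gradient_gauge_pos hne)
  have := (hB.radius_pos θ).le
  gcongr

/-- The surface measure is upper Ahlfors regular of dimension two. -/
theorem exists_surfaceMeasure_closedBall_le : ∃ C : ℝ, 0 ≤ C ∧ ∀ x ∈ frontier B, ∀ r : ℝ, 0 < r →
    surfaceMeasure B (Metric.closedBall x r) ≤ ENNReal.ofReal (C * r ^ 2) := by
  obtain ⟨C, hC, h1⟩ := hB.exists_radialDensity_le
  obtain ⟨C', hC', h2⟩ := exists_toSphere_closedBall_le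
  obtain ⟨s, hs, h3⟩ := hB.exists_gauge_le
  refine ⟨C * (C' * (2 * s) ^ 2), by positivity, fun x hx r hr => ?_⟩
  have hx0 := hB.ne_zero_of_mem_frontier hx
  have hxn : 0 < ‖x‖ := norm_pos_iff.2 hx0
  set θ₀ : unitSphere := ⟨‖x‖⁻¹ • x, by simp [norm_smul, hx0]⟩ with hθ₀
  have hxs : 1 ≤ s * ‖x‖ := by
    have := h3 x
    rwa [hB.mem_frontier_iff_gauge.1 hx] at this
  have hsub : radialMap B ⁻¹' Metric.closedBall x r ⊆ Metric.closedBall θ₀ (2 * s * r) := by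
    intro θ hθ
    rw [mem_preimage, mem_closedBall_iff_norm] at hθ
    rw [Metric.mem_closedBall, Subtype.dist_eq, dist_eq_norm]
    set ρ := radius B θ
    have hρ : 0 < ρ := hB.radius_pos θ
    -- With `y = radialMap B θ`, one has `‖x‖ (θ - x/‖x‖) = (y - x) + (‖x‖ - ‖y‖) θ`, and both terms
    -- have norm at most `r`. The factor `s` comes from `‖x‖ ≥ 1/s` on the boundary.
    have hn : ‖radialMap B θ‖ = ρ := by
      rw [radialMap, norm_smul, Real.norm_of_nonneg hρ.le]; simp
    have e : ‖x‖ • ((θ : E3) - ‖x‖⁻¹ • x) = (radialMap B θ - x) + (‖x‖ - ρ) • (θ : E3) := by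
      rw [smul_sub, smul_smul, mul_inv_cancel₀ hxn.ne', one_smul, radialMap, sub_smul]
      abel
    have h4 := congrArg norm e
    rw [norm_smul, norm_norm] at h4
    have h5 : ‖(radialMap B θ - x) + (‖x‖ - ρ) • (θ : E3)‖ ≤ r + r := by
      refine (norm_add_le _ _).trans (add_le_add hθ ?_)
      rw [norm_smul, ← hn]
      have : ‖(θ : E3)‖ = 1 := by simp
      rw [this, mul_one, Real.norm_eq_abs]
      exact (abs_norm_sub_norm_le x _).trans (by rwa [norm_sub_rev])
    have h6 : ‖x‖ * ‖(θ : E3) - ‖x‖⁻¹ • x‖ ≤ 2 * r := by linarith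
    calc _ ≤ (s * ‖x‖) * ‖(θ : E3) - ‖x‖⁻¹ • x‖ := le_mul_of_one_le_left (norm_nonneg _) hxs
      _ = s * (‖x‖ * ‖(θ : E3) - ‖x‖⁻¹ • x‖) := by ring
      _ ≤ s * (2 * r) := by gcongr
      _ = _ := by ring
  have hball : MeasurableSet (Metric.closedBall x r) := Metric.isClosed_closedBall.measurableSet
  rw [← lintegral_indicator_one hball,
    hB.lintegral_surfaceMeasure (measurable_one.indicator hball)]
  calc _ ≤ ∫⁻ θ, (Metric.closedBall θ₀ (2 * s * r)).indicator (fun _ => ENNReal.ofReal C) θ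
        ∂(volume : Measure E3).toSphere := by
        refine lintegral_mono fun θ => ?_
        by_cases hθ : radialMap B θ ∈ Metric.closedBall x r
        · rw [indicator_of_mem hθ, indicator_of_mem (hsub hθ)]
          simpa using ENNReal.ofReal_le_ofReal (h1 θ)
        · rw [indicator_of_notMem hθ]; simp
    _ = ENNReal.ofReal C * (volume : Measure E3).toSphere (Metric.closedBall θ₀ (2 * s * r)) :=
        lintegral_indicator_const Metric.isClosed_closedBall.measurableSet _
    _ ≤ ENNReal.ofReal C * ENNReal.ofReal (C' * (2 * s * r) ^ 2) := by
        gcongr; exact h2 _ _ (by positivity)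
    _ = _ := by rw [← ENNReal.ofReal_mul hC]; congr 1; ring

theorem isFiniteMeasure_surfaceMeasure : IsFiniteMeasure (surfaceMeasure B) := by
  obtain ⟨C, hC, h1⟩ := hB.exists_radialDensity_le
  refine ⟨?_⟩
  rw [← lintegral_one, hB.lintegral_surfaceMeasure measurable_const]
  calc _ ≤ ∫⁻ _, ENNReal.ofReal C ∂(volume : Measure E3).toSphere :=
        lintegral_mono fun θ => by simpa using ENNReal.ofReal_le_ofReal (h1 θ)
    _ < ⊤ := by
        rw [lintegral_const]
        exact ENNReal.mul_lt_top ENNReal.ofReal_lt_top (measure_lt_top _ _)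

theorem surfaceMeasure_singleton {x : E3} (hx : x ∈ frontier B) : surfaceMeasure B {x} = 0 := by
  obtain ⟨C, hC, h⟩ := hB.exists_surfaceMeasure_closedBall_le
  have h1 : ∀ᶠ r : ℝ in 𝓝[>] 0, surfaceMeasure B {x} ≤ ENNReal.ofReal (C * r ^ 2) := by
    filter_upwards [self_mem_nhdsWithin] with r hr
    refine (measure_mono ?_).trans (h x hx r hr)
    exact singleton_subset_iff.2 (Metric.mem_closedBall_self (le_of_lt hr))
  have h2 : Filter.Tendsto (fun r : ℝ => ENNReal.ofReal (C * r ^ 2)) (𝓝[>] 0) (𝓝 0) := by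
    have : Filter.Tendsto (fun r : ℝ => ENNReal.ofReal (C * r ^ 2)) (𝓝 0)
        (𝓝 (ENNReal.ofReal (C * 0 ^ 2))) :=
      (ENNReal.continuous_ofReal.comp (by fun_prop : Continuous fun r : ℝ => C * r ^ 2)).tendsto 0
    simpa using this.mono_left nhdsWithin_le_nhds
  exact le_antisymm (ge_of_tendsto h2 h1) zero_le

/-- The Riesz potentials of order less than two of the surface measure are bounded on `∂B`. -/
theorem exists_lintegral_rpow_le {s : ℝ} (hs0 : 0 < s) (hs : s < 2) : ∃ A : ℝ≥0∞, A ≠ ⊤ ∧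
    ∀ x ∈ frontier B, ∫⁻ y, ENNReal.ofReal (‖x - y‖ ^ (-s)) ∂(surfaceMeasure B) ≤ A := by
  obtain ⟨C, hC, h⟩ := hB.exists_surfaceMeasure_closedBall_le
  have := hB.isFiniteMeasure_surfaceMeasure
  refine ⟨surfaceMeasure B univ + ∫⁻ t in Ioi (1 : ℝ), ENNReal.ofReal (C * t ^ (-(2 / s))),
    ?_, fun x hx => ?_⟩
  · refine ENNReal.add_ne_top.2 ⟨measure_ne_top _ _, ?_⟩
    have hint : IntegrableOn (fun t : ℝ => C * t ^ (-(2 / s))) (Ioi 1) :=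
      (integrableOn_Ioi_rpow_of_lt (by
        rw [neg_lt_neg_iff, lt_div_iff₀ hs0]; linarith) one_pos).const_mul C
    exact hint.lintegral_lt_top.ne
  -- Layer-cake formula. Levels up to one contribute at most the total mass; the superlevel set at
  -- `t > 1` lies in a ball of radius `t^(-1/s)`, of measure at most `C t^(-2/s)`, which is
  -- integrable exactly because `s < 2`.
  · rw [lintegral_eq_lintegral_meas_le _
      (Filter.Eventually.of_forall fun y => Real.rpow_nonneg (norm_nonneg _) _)
      (by fun_prop), ← Ioc_union_Ioi_eq_Ioi zero_le_one]
    refine (lintegral_union_le _ _ _).trans (add_le_add ?_ ?_)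
    · calc _ ≤ ∫⁻ _ in Ioc (0 : ℝ) 1, surfaceMeasure B univ :=
            lintegral_mono fun t => measure_mono (subset_univ _)
        _ = _ := by simp
    · refine setLIntegral_mono' measurableSet_Ioi fun t ht => ?_
      have ht1 : (1 : ℝ) < t := ht
      have ht0 : 0 < t := one_pos.trans ht1
      have hsub : {a : E3 | t ≤ ‖x - a‖ ^ (-s)} ⊆ Metric.closedBall x (t ^ (-(1 / s))) := by
        intro a ha
        have ha' : t ≤ ‖x - a‖ ^ (-s) := ha
        rw [mem_closedBall_iff_norm, norm_sub_rev]
        -- At `a = x` the kernel has the default value `0 ^ (-s) = 0`, so the centre is not in the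
        -- superlevel set.
        have hpos : 0 < ‖x - a‖ := by
          refine lt_of_le_of_ne (norm_nonneg _) fun h0 => ?_
          rw [← h0, Real.zero_rpow (by linarith)] at ha'
          linarith
        have h3 := Real.rpow_le_rpow_of_nonpos ht0 ha'
          (by rw [Left.neg_nonpos_iff]; positivity : -(1 / s) ≤ 0)
        rw [← Real.rpow_mul hpos.le] at h3
        have : -s * -(1 / s) = 1 := by field_simp
        rwa [this, Real.rpow_one] at h3
      refine (measure_mono hsub).trans ((h x hx _ (Real.rpow_pos_of_pos ht0 _)).trans_eq ?_)
      rw [← Real.rpow_natCast, ← Real.rpow_mul ht0.le]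
      congr 3
      push_cast
      ring

end IsReferenceParticle

/-! ### The solid angle at a boundary point -/

/-- Integration in polar coordinates. -/
theorem lintegral_polar {f : E3 → ℝ≥0∞} (hf : Measurable f) :
    ∫⁻ z, f z = ∫⁻ θ : unitSphere, ∫⁻ s : Ioi (0 : ℝ), f (s.1 • (θ : E3))
      ∂(Measure.volumeIoiPow 2) ∂(volume : Measure E3).toSphere := by
  have hm := (volume : Measure E3).measurePreserving_homeomorphUnitSphereProd
  have hd : Module.finrank ℝ E3 - 1 = 2 := by simp
  rw [hd] at hm
  have h1 : ∫⁻ z, f z = ∫⁻ z in ({0}ᶜ : Set E3), f z := by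
    rw [restrict_compl_singleton]
  rw [h1, ← lintegral_subtype_comap (measurableSet_singleton (0 : E3)).compl]
  have hm' := hm.symm (homeomorphUnitSphereProd E3).toMeasurableEquiv
  refine (hm'.lintegral_comp (hf.comp measurable_subtype_coe)).symm.trans ?_
  exact lintegral_prod _ ((hf.comp measurable_subtype_coe).comp hm'.measurable).aemeasurable

/-- The map that sends `t • y`, `y ∈ ∂B`, to `t • (y - x)`. -/
def recenter (B : Set E3) (x z : E3) : E3 := z - gauge B z • x

namespace IsReferenceParticle

variable {B : Set E3} (hB : IsReferenceParticle B)

include hB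

omit hB in
theorem recenter_smul (x z : E3) {t : ℝ} (ht : 0 ≤ t) :
    recenter B x (t • z) = t • recenter B x z := by
  rw [recenter, recenter, gauge_smul ht, smul_sub, smul_smul]

theorem continuous_recenter (x : E3) : Continuous (recenter B x) :=
  continuous_id.sub (hB.continuous_gauge.smul continuous_const)

theorem recenter_eq {z : E3} (hz : z ≠ 0) (x : E3) :
    recenter B x z = gauge B z • ((gauge B z)⁻¹ • z - x) := by
  rw [recenter, smul_sub, smul_smul, mul_inv_cancel₀ (hB.gauge_pos hz).ne', one_smul]

omit hB in
theorem ne_zero_of_recenter {x z : E3} (h : recenter B x z ≠ 0) : z ≠ 0 := by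
  rintro rfl
  simp [recenter] at h

/-- If two points with different gauges had the same nonzero image, the boundary point under the one
with larger gauge would lie strictly between `x` and the other boundary point, against strict
convexity. -/
theorem injOn_recenter {x : E3} (hx : x ∈ frontier B) :
    InjOn (recenter B x) {z | recenter B x z ≠ 0} := by
  suffices H : ∀ z z' : E3, recenter B x z ≠ 0 → recenter B x z = recenter B x z' →
      gauge B z ≤ gauge B z' by
    intro z hz z' hz' h
    have h1 := le_antisymm (H z z' hz h) (H z' z hz' h.symm)
    simp only [recenter, h1] at h
    exact sub_left_injective h
  intro z z' hw h
  by_contra! hlt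
  have hz' : z' ≠ 0 := ne_zero_of_recenter (h ▸ hw)
  have hz : z ≠ 0 := ne_zero_of_recenter hw
  have ha' := hB.gauge_pos hz'
  have ha := hB.gauge_pos hz
  have hy := hB.inv_gauge_smul_mem_frontier hz
  have hy' := hB.inv_gauge_smul_mem_frontier hz'
  set y := (gauge B z)⁻¹ • z
  set y' := (gauge B z')⁻¹ • z'
  rw [hB.recenter_eq hz] at h hw
  rw [hB.recenter_eq hz'] at h
  set a := gauge B z
  set a' := gauge B z'
  have hne : x ≠ y' := by
    rintro e
    rw [show (a')⁻¹ • z' = x from e.symm, sub_self, smul_zero] at h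
    exact hw h
  have hseg : y ∈ openSegment ℝ x y' := by
    refine ⟨1 - a' / a, a' / a, ?_, by positivity, by ring, ?_⟩
    · rw [sub_pos, div_lt_one ha]; exact hlt
    · have h2 : y - x = (a' / a) • (y' - x) := by
        have := congrArg (fun w => a⁻¹ • w) h
        simp only [smul_smul, inv_mul_cancel₀ ha.ne', one_smul] at this
        rw [this, div_eq_inv_mul]
      rw [smul_sub] at h2
      rw [sub_smul, one_smul, sub_add_eq_add_sub, add_sub_assoc, ← h2]
      abel
  have := hB.gauge_lt_one_of_openSegment (frontier_subset_closure hx)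
    (frontier_subset_closure hy') hne hseg
  rw [hB.mem_frontier_iff_gauge.1 hy] at this
  exact lt_irrefl _ this

theorem hasFDerivAt_recenter (x : E3) {z : E3} (hz : z ≠ 0) :
    HasFDerivAt (recenter B x)
      (ContinuousLinearMap.id ℝ E3 - (fderiv ℝ (gauge B) z).smulRight x) z :=
  (hasFDerivAt_id z).sub ((hB.hasFDerivAt_gauge hz).smul_const x)

omit hB in
theorem det_id_sub_smulRight (f : E3 →L[ℝ] ℝ) (x : E3) :
    (ContinuousLinearMap.id ℝ E3 - f.smulRight x).det = 1 - f x := by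
  have h : ((ContinuousLinearMap.id ℝ E3 - f.smulRight x : E3 →L[ℝ] E3) : E3 →ₗ[ℝ] E3) =
      LinearMap.transvection (f : E3 →ₗ[ℝ] ℝ) (-x) := by
    ext1 w
    simp [LinearMap.transvection.apply, sub_eq_add_neg]
  rw [ContinuousLinearMap.det, h, LinearMap.transvection.det]
  simp [sub_eq_add_neg]

omit hB in
theorem volume_halfBall_le (n : E3) :
    (volume : Measure E3) {w | ‖w‖ < 1 ∧ ⟪w, n⟫ < 0} ≤ ENNReal.ofReal (2 * Real.pi / 3) := by
  set H : Set E3 := {w | ‖w‖ < 1 ∧ ⟪w, n⟫ < 0} with hH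
  have hHm : MeasurableSet H :=
    ((isOpen_lt continuous_norm continuous_const).inter
      (isOpen_lt (f := fun w : E3 => ⟪w, n⟫) (by fun_prop) continuous_const)).measurableSet
  have hd : Disjoint H (-H) := by
    rw [Set.disjoint_left]
    rintro w ⟨-, h1⟩ ⟨-, h2⟩
    rw [inner_neg_left] at h2
    linarith
  have hsub : H ∪ -H ⊆ Metric.ball 0 1 := by
    rintro w (⟨h1, -⟩ | ⟨h1, -⟩)
    · simpa using h1
    · simpa using h1
  have h1 := measure_mono (μ := (volume : Measure E3)) hsub
  rw [measure_union hd hHm.neg, Measure.measure_neg, EuclideanSpace.volume_ball_fin_three] at h1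
  simp only [ENNReal.ofReal_one, one_pow, one_mul] at h1
  have h2 : 2 * volume H ≤ 2 * ENNReal.ofReal (2 * Real.pi / 3) := by
    rw [two_mul]
    refine h1.trans_eq ?_
    rw [← ENNReal.ofReal_ofNat, ← ENNReal.ofReal_mul (by norm_num)]
    congr 1
    ring
  exact (ENNReal.mul_le_mul_iff_right (by norm_num) (by norm_num)).1 h2

/-- The Jacobian of `recenter B x` is `1 - fderiv ℝ (gauge B) θ x`, and `‖recenter B x θ‖⁻¹ ^ 3 / 3`
is the integral of `s²` up to the radius where the ray through `θ` leaves the preimage of the unit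
ball. So the solid angle is `3/(4π)` times a volume. At `radialMap B θ = x` both sides vanish by
division by zero. -/
theorem solidAngle_integrand {x : E3} (θ : unitSphere) :
    radialDensity B θ * (⟪radialMap B θ - x, normal B (radialMap B θ)⟫ /
      (4 * Real.pi * ‖radialMap B θ - x‖ ^ 3)) =
    3 / (4 * Real.pi) * ((1 - fderiv ℝ (gauge B) θ x) * ((‖recenter B x θ‖⁻¹) ^ 3 / 3)) := by
  have h0 := unitSphere.ne_zero θ
  have hg := hB.gauge_pos h0
  have hn := hB.norm_gradient_gauge_pos (hB.ne_zero_of_mem_frontier (hB.radialMap_mem_frontier θ))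
  have h1 : ‖recenter B x θ‖ = gauge B θ * ‖radialMap B θ - x‖ := by
    rw [hB.recenter_eq h0, norm_smul, Real.norm_of_nonneg hg.le]
    rfl
  have h2 : fderiv ℝ (gauge B) (θ : E3) (radialMap B θ - x) = 1 - fderiv ℝ (gauge B) θ x := by
    rw [map_sub, radialMap, map_smul, hB.fderiv_gauge_self h0, radius, smul_eq_mul,
      inv_mul_cancel₀ hg.ne']
  rw [hB.radialDensity_eq, hB.inner_normal_radialMap, h2, h1, radius]
  by_cases hy : ‖radialMap B θ - x‖ = 0
  · simp [hy]
  · field_simp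

/-- The left side is, in polar coordinates, the integral of the Jacobian of `recenter B x` over the
points mapped into the punctured unit ball. By injectivity it equals the volume of the image, which
lies in the half ball `w · ν(x) < 0` because `∂B` is on one side of its tangent plane at `x`. -/
theorem lintegral_polar_recenter {x : E3} (hx : x ∈ frontier B) :
    ∫⁻ θ : unitSphere, ENNReal.ofReal ((1 - fderiv ℝ (gauge B) θ x) *
        ((‖recenter B x θ‖⁻¹) ^ 3 / 3)) ∂(volume : Measure E3).toSphere ≤
      ENNReal.ofReal (2 * Real.pi / 3) := by
  set E : Set E3 := {z | recenter B x z ≠ 0 ∧ ‖recenter B x z‖ < 1} with hE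
  have hEm : MeasurableSet E :=
    ((isOpen_ne_fun (hB.continuous_recenter x) continuous_const).inter
      (isOpen_lt (hB.continuous_recenter x).norm continuous_const)).measurableSet
  have hdet : ∀ z : E3, z ≠ 0 → 0 ≤ 1 - fderiv ℝ (gauge B) z x := by
    intro z hz
    have := hB.fderiv_gauge_le hz x
    rw [hB.mem_frontier_iff_gauge.1 hx] at this
    linarith
  have himage : recenter B x '' E ⊆ {w | ‖w‖ < 1 ∧ ⟪w, normal B x⟫ < 0} := by
    rintro _ ⟨z, ⟨h1, h2⟩, rfl⟩
    refine ⟨h2, ?_⟩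
    have hz := ne_zero_of_recenter h1
    rw [hB.recenter_eq hz] at h1 ⊢
    rw [inner_smul_left]
    have hne : (gauge B z)⁻¹ • z ≠ x := fun e => h1 (by rw [e, sub_self, smul_zero])
    have := hB.inner_sub_normal_pos (hB.inv_gauge_smul_mem_frontier hz) hx hne
    rw [← neg_sub, inner_neg_left] at this
    exact mul_neg_of_pos_of_neg (hB.gauge_pos hz) (by linarith)
  have hcv := lintegral_abs_det_fderiv_eq_addHaar_image (volume : Measure E3) hEm
    (f := recenter B x)
    (fun z hz => (hB.hasFDerivAt_recenter x (ne_zero_of_recenter hz.1)).hasFDerivWithinAt)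
    ((hB.injOn_recenter hx).mono fun z hz => hz.1)
  have hfm : Measurable fun z : E3 => ENNReal.ofReal |1 - fderiv ℝ (gauge B) z x| :=
    ((measurable_const.sub ((measurable_fderiv_apply_const ℝ (gauge B) x))).abs).ennreal_ofReal
  simp only [det_id_sub_smulRight] at hcv
  rw [← lintegral_indicator hEm, lintegral_polar (hfm.indicator hEm)] at hcv
  calc _ = _ := by
        refine lintegral_congr fun θ => ?_
        have hθ := unitSphere.ne_zero θ
        by_cases h0 : recenter B x θ = 0
        -- This is the direction of `x` itself: the whole ray is sent to the origin and contributes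
        -- nothing on either side.
        · have : ∀ s : Ioi (0 : ℝ), (s.1 • (θ : E3)) ∉ E := fun s hs =>
            hs.1 (by rw [recenter_smul _ _ (le_of_lt s.2), h0, smul_zero])
          simp [h0, indicator_of_notMem (this _)]
        · have hpos : 0 < ‖recenter B x θ‖ := norm_pos_iff.2 h0
          have hind : ∀ s : Ioi (0 : ℝ),
              E.indicator (fun z => ENNReal.ofReal |1 - fderiv ℝ (gauge B) z x|) (s.1 • (θ : E3)) =
              (Iio (⟨‖recenter B x θ‖⁻¹, inv_pos.2 hpos⟩ : Ioi (0 : ℝ))).indicator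
                (fun _ => ENNReal.ofReal (1 - fderiv ℝ (gauge B) θ x)) s := by
            intro s
            have hs : 0 < s.1 := s.2
            have hiff : s.1 • (θ : E3) ∈ E ↔
                s ∈ Iio (⟨‖recenter B x θ‖⁻¹, inv_pos.2 hpos⟩ : Ioi (0 : ℝ)) := by
              rw [hE, mem_ofPred_eq, recenter_smul _ _ hs.le, norm_smul, Real.norm_of_nonneg hs.le,
                mem_Iio, ← Subtype.coe_lt_coe, lt_inv_comm₀ hs hpos]
              rw [← one_div, lt_div_iff₀ hs, mul_comm]
              exact and_iff_right (smul_ne_zero hs.ne' h0)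
            by_cases hm : s.1 • (θ : E3) ∈ E
            · rw [indicator_of_mem hm, indicator_of_mem (hiff.1 hm),
                hB.fderiv_gauge_smul hθ hs, abs_of_nonneg (hdet _ hθ)]
            · rw [indicator_of_notMem hm, indicator_of_notMem (fun h => hm (hiff.2 h))]
          rw [lintegral_congr hind, lintegral_indicator_const measurableSet_Iio,
            Measure.volumeIoiPow_apply_Iio, ENNReal.ofReal_mul (hdet _ hθ)]
          norm_num
    _ = _ := hcv
    _ ≤ _ := (measure_mono himage).trans (volume_halfBall_le _)

/-- Seen from a boundary point, `∂B` subtends at most half of the full solid angle. -/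
theorem lintegral_solidAngle_le {x : E3} (hx : x ∈ frontier B) :
    ∫⁻ y, ENNReal.ofReal (⟪y - x, normal B y⟫ / (4 * Real.pi * ‖y - x‖ ^ 3))
      ∂(surfaceMeasure B) ≤ ENNReal.ofReal (1 / 2) := by
  have hm : Measurable fun y : E3 =>
      ENNReal.ofReal (⟪y - x, normal B y⟫ / (4 * Real.pi * ‖y - x‖ ^ 3)) := by
    have := measurable_normal B
    fun_prop
  rw [hB.lintegral_surfaceMeasure hm]
  have hnn : ∀ θ, 0 ≤ radialDensity B θ := fun θ => by
    rw [hB.radialDensity_eq]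
    exact mul_nonneg (pow_nonneg (hB.radius_pos θ).le 3) (norm_nonneg _)
  simp_rw [← ENNReal.ofReal_mul (hnn _), hB.solidAngle_integrand,
    ENNReal.ofReal_mul (show 0 ≤ 3 / (4 * Real.pi) by positivity)]
  rw [lintegral_const_mul' _ _ ENNReal.ofReal_ne_top]
  refine (mul_le_mul_right (hB.lintegral_polar_recenter hx) _).trans_eq ?_
  rw [← ENNReal.ofReal_mul (by positivity)]
  congr 1
  field_simp
  norm_num

end IsReferenceParticle

/-! ### The Neumann–Poincaré kernel -/

/-- The kernel of `K_B^*`. -/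
def npKernel (B : Set E3) (x y : E3) : ℝ :=
  ⟪x - y, normal B x⟫ / (4 * Real.pi * ‖x - y‖ ^ 3)

theorem measurable_npKernel (B : Set E3) : Measurable fun z : E3 × E3 => npKernel B z.1 z.2 := by
  have h : Measurable fun z : E3 × E3 => normal B z.1 := (measurable_normal B).comp measurable_fst
  unfold npKernel
  fun_prop

theorem div_cube_le {L N a : ℝ} (ha : 0 ≤ a) (hN : N ≤ L * a ^ 2) :
    N / a ^ 3 ≤ L * a ^ (-1 : ℝ) := by
  rcases ha.eq_or_lt with rfl | ha
  · simp
  · rw [Real.rpow_neg_one, div_le_iff₀ (by positivity)]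
    calc N ≤ L * a ^ 2 := hN
      _ = _ := by field_simp

/-- Where `a` is at most comparable to `d`, a factor `d ^ s` can be extracted at the price of a
stronger singularity in `a`. -/
theorem rpow_neg_one_le {a c d s : ℝ} (ha : 0 ≤ a) (hs0 : 0 ≤ s) (hs1 : s ≤ 1) (hc : 1 ≤ c)
    (had : a ≤ c * d) : a ^ (-1 : ℝ) ≤ c * (d ^ s * a ^ (-1 - s)) := by
  rcases ha.eq_or_lt with rfl | ha
  · rw [Real.zero_rpow (by norm_num), Real.zero_rpow (by linarith)]
    simp
  · have hd : 0 ≤ d := by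
      by_contra! h
      nlinarith
    have h1 : a ^ s ≤ c * d ^ s := by
      calc a ^ s ≤ (c * d) ^ s := Real.rpow_le_rpow ha.le had hs0
        _ = c ^ s * d ^ s := Real.mul_rpow (by linarith) hd
        _ ≤ c * d ^ s := by
          gcongr
          exact (Real.rpow_le_rpow_of_exponent_le hc hs1).trans_eq (Real.rpow_one c)
    calc a ^ (-1 : ℝ) = a ^ s * a ^ (-1 - s) := by rw [← Real.rpow_add ha]; congr 1; ring
      _ ≤ (c * d ^ s) * a ^ (-1 - s) := by gcongr
      _ = _ := by ring

/-- Hölder continuity of a kernel of the form `N / a³` from quadratic bounds for `N`. -/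
theorem abs_div_cube_sub_le {L N N' a b d s : ℝ} (hs0 : 0 ≤ s) (hs1 : s ≤ 1) (hL : 0 ≤ L)
    (ha : 0 ≤ a) (hb : 0 ≤ b) (hd : 0 ≤ d) (hbd : b ≤ a + d) (had : a ≤ b + d)
    (hN0 : 0 ≤ N) (hN : N ≤ L * a ^ 2) (hN0' : 0 ≤ N') (hN' : N' ≤ L * b ^ 2)
    (hNN : |N - N'| ≤ L * d ^ 2 + L * d * a) :
    |N / a ^ 3 - N' / b ^ 3| ≤ 12 * L * (d ^ s * (a ^ (-1 - s) + b ^ (-1 - s))) := by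
  have hpa : 0 ≤ d ^ s * a ^ (-1 - s) := by positivity
  have hpb : 0 ≤ d ^ s * b ^ (-1 - s) := by positivity
  rcases le_or_gt a (2 * d) with h | h
  -- Near the diagonal there is no cancellation to exploit and the two terms are bounded separately;
  -- `3` comes from `b ≤ a + d ≤ 3d`.
  · have h1 : N / a ^ 3 ≤ L * (3 * (d ^ s * a ^ (-1 - s))) :=
      (div_cube_le ha hN).trans (mul_le_mul_of_nonneg_left
        (rpow_neg_one_le ha hs0 hs1 (by norm_num) (by linarith)) hL)
    have h2 : N' / b ^ 3 ≤ L * (3 * (d ^ s * b ^ (-1 - s))) :=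
      (div_cube_le hb hN').trans (mul_le_mul_of_nonneg_left
        (rpow_neg_one_le hb hs0 hs1 (by norm_num) (by linarith)) hL)
    have h3 : 0 ≤ N / a ^ 3 := by positivity
    have h4 : 0 ≤ N' / b ^ 3 := by positivity
    have h5 := mul_nonneg hL hpa
    have h6 := mul_nonneg hL hpb
    rw [abs_le]
    constructor <;> nlinarith
  -- Away from the diagonal `a` and `b` are comparable. The difference of numerators costs `2Ld/a²`,
  -- that of denominators `10Ld/a²`, and `d/a² ≤ d^s a^(-1-s)` as `d ≤ a`.
  · have ha' : 0 < a := by linarith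
    have hb' : a / 2 ≤ b := by linarith
    have hb0 : 0 < b := by linarith
    have hb2 : b ≤ 3 / 2 * a := by linarith
    have e : N / a ^ 3 - N' / b ^ 3 = (N - N') / a ^ 3 +
        N' * ((b - a) * (a ^ 2 + a * b + b ^ 2) / (a ^ 3 * b ^ 3)) := by
      field_simp
      ring
    have h1 : |(N - N') / a ^ 3| ≤ 2 * L * d / a ^ 2 := by
      rw [abs_div, abs_of_pos (by positivity : 0 < a ^ 3), div_le_div_iff₀ (by positivity)
        (by positivity)]
      have : |N - N'| ≤ 2 * L * d * a := by nlinarith [mul_nonneg hL hd]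
      calc _ ≤ 2 * L * d * a * a ^ 2 := by gcongr
        _ = _ := by ring
    have h2 : |N' * ((b - a) * (a ^ 2 + a * b + b ^ 2) / (a ^ 3 * b ^ 3))| ≤ 10 * L * d / a ^ 2 := by
      rw [abs_mul, abs_of_nonneg hN0', abs_div, abs_mul,
        abs_of_pos (by positivity : 0 < a ^ 2 + a * b + b ^ 2),
        abs_of_pos (by positivity : 0 < a ^ 3 * b ^ 3)]
      have hab : |b - a| ≤ d := abs_le.2 ⟨by linarith, by linarith⟩
      have hq : a ^ 2 + a * b + b ^ 2 ≤ 10 * (a * b) := by nlinarith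
      calc _ ≤ L * b ^ 2 * (d * (10 * (a * b)) / (a ^ 3 * b ^ 3)) := by gcongr
        _ = _ := by field_simp
    have h3 : d / a ^ 2 ≤ d ^ s * a ^ (-1 - s) := by
      rcases hd.eq_or_lt with rfl | hd
      · simpa using hpa
      · have e1 : d = d ^ s * d ^ (1 - s) := by
          rw [← Real.rpow_add hd]; simp
        have e2 : a ^ (-1 - s) = a ^ (1 - s) / a ^ 2 := by
          rw [← Real.rpow_natCast, ← Real.rpow_sub ha']
          congr 1
          push_cast
          ring
        have h4 : d ^ (1 - s) ≤ a ^ (1 - s) := Real.rpow_le_rpow hd.le (by linarith) (by linarith)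
        calc d / a ^ 2 = d ^ s * d ^ (1 - s) / a ^ 2 := by rw [← e1]
          _ ≤ d ^ s * a ^ (1 - s) / a ^ 2 := by gcongr
          _ = _ := by rw [e2]; ring
    rw [e]
    refine (abs_add_le _ _).trans ((add_le_add h1 h2).trans ?_)
    have h5 := mul_le_mul_of_nonneg_left h3 hL
    have h6 := mul_nonneg hL hpb
    calc 2 * L * d / a ^ 2 + 10 * L * d / a ^ 2 = 12 * (L * (d / a ^ 2)) := by ring
      _ ≤ _ := by nlinarith

namespace IsReferenceParticle

variable {B : Set E3} (hB : IsReferenceParticle B)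

include hB

theorem npKernel_nonneg {x y : E3} (hx : x ∈ frontier B) (hy : y ∈ frontier B) :
    0 ≤ npKernel B x y :=
  div_nonneg (hB.inner_sub_normal_nonneg (frontier_subset_closure hy) hx) (by positivity)

theorem npKernel_pos {x y : E3} (hx : x ∈ frontier B) (hy : y ∈ frontier B) (h : y ≠ x) :
    0 < npKernel B x y := by
  have : 0 < ‖x - y‖ := norm_pos_iff.2 (sub_ne_zero.2 h.symm)
  exact div_pos (hB.inner_sub_normal_pos hy hx h) (by positivity)

/-- Convexity gives `⟪y - x, ν(y)⟫ ≥ 0`, so replacing `ν(x)` by `ν(x) - ν(y)` only increases the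
inner product; the Lipschitz normal then supplies the second power of `‖x - y‖`. -/
theorem exists_inner_sub_normal_le : ∃ L : ℝ, 0 ≤ L ∧ (∀ x ∈ frontier B, ∀ y ∈ frontier B,
    ‖normal B x - normal B y‖ ≤ L * ‖x - y‖) ∧ ∀ x ∈ frontier B, ∀ y ∈ frontier B,
    ⟪x - y, normal B x⟫ ≤ L * ‖x - y‖ ^ 2 := by
  obtain ⟨K, hK⟩ := hB.exists_lipschitzOnWith_normal
  have h1 : ∀ x ∈ frontier B, ∀ y ∈ frontier B, ‖normal B x - normal B y‖ ≤ K * ‖x - y‖ := by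
    intro x hx y hy
    simpa [dist_eq_norm] using hK.dist_le_mul x hx y hy
  refine ⟨K, K.2, h1, fun x hx y hy => ?_⟩
  have h2 := hB.inner_sub_normal_nonneg (frontier_subset_closure hx) hy
  have h3 : ⟪x - y, normal B x⟫ = ⟪x - y, normal B x - normal B y⟫ - ⟪y - x, normal B y⟫ := by
    rw [inner_sub_right, ← neg_sub x y, inner_neg_left]
    ring
  have h4 := real_inner_le_norm (x - y) (normal B x - normal B y)
  calc _ ≤ ‖x - y‖ * ‖normal B x - normal B y‖ := by linarith
    _ ≤ ‖x - y‖ * (K * ‖x - y‖) := by gcongr; exact h1 x hx y hy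
    _ = _ := by ring

/-- The Hölder estimate is in the variable that does not carry the normal, which is the outer
variable of the transposed operator. The exponent `s = 3/4` has to satisfy `1 + s < 2`, for the
Riesz kernels on the right, and `2(3/2 - s) < 2`, for the squared weight left after division by `‖x
- x'‖^(3/2)`; any `s` strictly between `1/2` and `1` would serve. -/
theorem exists_npKernel_bounds : ∃ C : ℝ, 0 ≤ C ∧ (∀ x ∈ frontier B, ∀ y ∈ frontier B,
      |npKernel B x y| ≤ C * ‖x - y‖ ^ (-1 : ℝ)) ∧
    ∀ x ∈ frontier B, ∀ x' ∈ frontier B, ∀ y ∈ frontier B,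
      |npKernel B y x - npKernel B y x'| ≤
        C * (‖x - x'‖ ^ (3 / 4 : ℝ) * (‖x - y‖ ^ (-(7 / 4) : ℝ) + ‖x' - y‖ ^ (-(7 / 4) : ℝ))) := by
  obtain ⟨L, hL, h1, h2⟩ := hB.exists_inner_sub_normal_le
  have hpi : (4 * Real.pi)⁻¹ ≤ 1 := inv_le_one_of_one_le₀ (by linarith [Real.pi_gt_three])
  have hpi0 : 0 ≤ (4 * Real.pi)⁻¹ := by positivity
  refine ⟨12 * L, by positivity, fun x hx y hy => ?_, fun x hx x' hx' y hy => ?_⟩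
  · rw [abs_of_nonneg (hB.npKernel_nonneg hx hy)]
    have h3 := div_cube_le (norm_nonneg (x - y)) (h2 x hx y hy)
    have h4 : 0 ≤ L * ‖x - y‖ ^ (-1 : ℝ) := by positivity
    have e : npKernel B x y = (4 * Real.pi)⁻¹ * (⟪x - y, normal B x⟫ / ‖x - y‖ ^ 3) := by
      rw [npKernel]; field_simp
    rw [e]
    nlinarith
  · have e : ∀ w : E3, npKernel B y w = (4 * Real.pi)⁻¹ * (⟪y - w, normal B y⟫ / ‖w - y‖ ^ 3) := by
      intro w
      rw [npKernel, norm_sub_rev w y]; field_simp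
    rw [e, e, ← mul_sub, abs_mul, abs_of_nonneg hpi0]
    have h3 := abs_div_cube_sub_le (s := 3 / 4) (by norm_num) (by norm_num) hL
      (norm_nonneg (x - y)) (norm_nonneg (x' - y)) (norm_nonneg (x - x'))
      (by rw [norm_sub_rev x x', add_comm]; exact norm_sub_le_norm_sub_add_norm_sub _ _ _)
      (by rw [add_comm]; exact norm_sub_le_norm_sub_add_norm_sub _ _ _)
      (hB.inner_sub_normal_nonneg (frontier_subset_closure hx) hy)
      (by rw [norm_sub_rev]; exact h2 y hy x hx)
      (hB.inner_sub_normal_nonneg (frontier_subset_closure hx') hy)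
      (by rw [norm_sub_rev]; exact h2 y hy x' hx') (by
        have e1 : ⟪y - x, normal B y⟫ - ⟪y - x', normal B y⟫ =
            ⟪x - x', normal B x - normal B y⟫ - ⟪x - x', normal B x⟫ := by
          rw [← inner_sub_left, inner_sub_right, sub_sub_cancel_left, ← inner_neg_left]
          congr 1
          abel
        have e2 := abs_real_inner_le_norm (x - x') (normal B x - normal B y)
        have e3 := hB.inner_sub_normal_nonneg (frontier_subset_closure hx') hx
        have e4 := h2 x hx x' hx'
        have e5 : ‖x - x'‖ * ‖normal B x - normal B y‖ ≤ ‖x - x'‖ * (L * ‖x - y‖) := by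
          gcongr
          exact h1 x hx y hy
        rw [e1]
        refine (abs_sub _ _).trans ?_
        rw [abs_of_nonneg e3]
        linarith)
    have h4 : (-1 - 3 / 4 : ℝ) = -(7 / 4) := by norm_num
    rw [h4] at h3
    refine (mul_le_mul_of_nonneg_left h3 hpi0).trans ?_
    exact mul_le_of_le_one_left (by positivity) hpi

end IsReferenceParticle

/-! ### Schur's test and weakly singular operators on `L²(∂B)` -/

section Schur

variable {X Y : Type*} [MeasurableSpace X] [MeasurableSpace Y] {μ : Measure X} {ν : Measure Y}

/-- Cauchy–Schwarz with the weight split as `√g · (√g f)`. -/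
theorem lintegral_mul_sq_le {g f : Y → ℝ≥0∞} (hg : Measurable g) (hf : Measurable f) :
    (∫⁻ y, g y * f y ∂ν) ^ 2 ≤ (∫⁻ y, g y ∂ν) * ∫⁻ y, g y * f y ^ 2 ∂ν := by
  have h := ENNReal.lintegral_mul_le_Lp_mul_Lq ν Real.HolderConjugate.two_two
    (hg.pow_const (1 / 2 : ℝ)).aemeasurable ((hg.pow_const (1 / 2 : ℝ)).mul hf).aemeasurable
  have e1 : ∀ a : ℝ≥0∞, a ^ (1 / 2 : ℝ) * a ^ (1 / 2 : ℝ) = a := fun a => by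
    rw [← ENNReal.rpow_add_of_nonneg _ _ (by norm_num) (by norm_num)]
    norm_num
  have e2 : ∀ a : ℝ≥0∞, (a ^ (1 / 2 : ℝ)) ^ (2 : ℝ) = a := fun a => by
    rw [← ENNReal.rpow_mul]; norm_num
  simp only [Pi.mul_apply, ← mul_assoc, e1, ENNReal.mul_rpow_of_nonneg _ _ zero_le_two, e2] at h
  have e3 : ∀ a : ℝ≥0∞, (a ^ (1 / 2 : ℝ)) ^ 2 = a := fun a => by rw [sq, e1]
  have h2 := pow_le_pow_left₀ zero_le h 2
  simpa only [mul_pow, e3, ENNReal.rpow_two] using h2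

theorem lintegral_schur [SFinite μ] [SFinite ν] {g : X → Y → ℝ≥0∞}
    (hg : Measurable (Function.uncurry g)) {A A' : ℝ≥0∞}
    (h1 : ∀ᵐ x ∂μ, ∫⁻ y, g x y ∂ν ≤ A) (h2 : ∀ᵐ y ∂ν, ∫⁻ x, g x y ∂μ ≤ A') {f : Y → ℝ≥0∞}
    (hf : Measurable f) :
    ∫⁻ x, (∫⁻ y, g x y * f y ∂ν) ^ 2 ∂μ ≤ A * A' * ∫⁻ y, f y ^ 2 ∂ν := by
  have hgx : ∀ x, Measurable (g x) := fun x => hg.comp measurable_prodMk_left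
  have hgy : ∀ y, Measurable fun x => g x y := fun y => hg.comp measurable_prodMk_right
  have hm : Measurable (Function.uncurry fun x y => g x y * f y ^ 2) :=
    hg.mul ((hf.comp measurable_snd).pow_const 2)
  calc _ ≤ ∫⁻ x, A * ∫⁻ y, g x y * f y ^ 2 ∂ν ∂μ := by
        refine lintegral_mono_ae ?_
        filter_upwards [h1] with x hx
        exact (lintegral_mul_sq_le (hgx x) hf).trans (mul_le_mul_left hx _)
    _ = A * ∫⁻ y, ∫⁻ x, g x y * f y ^ 2 ∂μ ∂ν := by
        rw [← lintegral_lintegral_swap hm.aemeasurable]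
        exact lintegral_const_mul _ hm.lintegral_prod_right'
    _ ≤ A * ∫⁻ y, A' * f y ^ 2 ∂ν := by
        refine mul_le_mul_right (lintegral_mono_ae ?_) _
        filter_upwards [h2] with y hy
        rw [lintegral_mul_const _ (hgy y)]
        exact mul_le_mul_left hy _
    _ = _ := by rw [lintegral_const_mul _ (hf.pow_const 2), mul_assoc]

theorem eLpNorm_two_eq {h : X → ℝ} : eLpNorm h 2 μ = (∫⁻ x, ‖h x‖ₑ ^ 2 ∂μ) ^ (1 / 2 : ℝ) := by
  rw [eLpNorm_eq_lintegral_rpow_enorm_toReal two_ne_zero ENNReal.ofNat_ne_top]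
  simp

theorem lintegral_enorm_sq_lt_top {h : X → ℝ} (hh : MemLp h 2 μ) : ∫⁻ x, ‖h x‖ₑ ^ 2 ∂μ < ⊤ := by
  have := hh.2
  rw [eLpNorm_two_eq] at this
  exact (ENNReal.rpow_lt_top_iff_of_pos (by norm_num)).1 this

theorem memLp_two_of_lintegral_le {h : X → ℝ} (hm : AEStronglyMeasurable h μ) {D : ℝ≥0∞}
    (hD : D ≠ ⊤) (f : Lp ℝ 2 ν) (hle : ∫⁻ x, ‖h x‖ₑ ^ 2 ∂μ ≤ D * ∫⁻ y, ‖f y‖ₑ ^ 2 ∂ν) :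
    MemLp h 2 μ := by
  refine ⟨hm, ?_⟩
  rw [eLpNorm_two_eq]
  exact ENNReal.rpow_lt_top_of_nonneg (by norm_num) (hle.trans_lt (ENNReal.mul_lt_top hD.lt_top
    (lintegral_enorm_sq_lt_top (Lp.memLp f)))).ne

theorem norm_toLp_le {h : X → ℝ} (hm : MemLp h 2 μ) {D : ℝ≥0∞}
    (hD : D ≠ ⊤) (f : Lp ℝ 2 ν) (hle : ∫⁻ x, ‖h x‖ₑ ^ 2 ∂μ ≤ D * ∫⁻ y, ‖f y‖ₑ ^ 2 ∂ν) :
    ‖hm.toLp h‖ ≤ (D ^ (1 / 2 : ℝ)).toReal * ‖f‖ := by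
  rw [Lp.norm_toLp, Lp.norm_def, ← ENNReal.toReal_mul]
  refine ENNReal.toReal_mono (ENNReal.mul_ne_top
    (ENNReal.rpow_ne_top_of_nonneg (by norm_num) hD) (Lp.eLpNorm_ne_top f)) ?_
  rw [eLpNorm_two_eq, eLpNorm_two_eq, ← ENNReal.mul_rpow_of_nonneg _ _ (by norm_num)]
  exact ENNReal.rpow_le_rpow hle (by norm_num)

end Schur

/-- Measurable kernels on `∂B` that are bounded by a multiple of `|x - y|⁻¹`. -/
structure WeaklySingular (B : Set E3) (k : E3 → E3 → ℝ) : Prop where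
  measurable : Measurable fun z : E3 × E3 => k z.1 z.2
  bound : ∃ C : ℝ, 0 ≤ C ∧ ∀ x ∈ frontier B, ∀ y ∈ frontier B, |k x y| ≤ C * ‖x - y‖ ^ (-1 : ℝ)

theorem WeaklySingular.swap {B : Set E3} {k : E3 → E3 → ℝ} (hk : WeaklySingular B k) :
    WeaklySingular B fun x y => k y x := by
  obtain ⟨C, hC, h⟩ := hk.bound
  exact ⟨hk.measurable.comp measurable_swap, C, hC, fun x hx y hy => by
    rw [norm_sub_rev]; exact h y hy x hx⟩

/-- The integral operator on `∂B` with kernel `k`. -/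
def boundaryIntegral (B : Set E3) (k : E3 → E3 → ℝ) (f : E3 → ℝ) (x : E3) : ℝ :=
  ∫ y, k x y * f y ∂(surfaceMeasure B)

/-- The Riesz potential of order `2 - s` of `|f|` on `∂B`. -/
def rieszPotential (B : Set E3) (s : ℝ) (f : E3 → ℝ) (x : E3) : ℝ≥0∞ :=
  ∫⁻ y, ENNReal.ofReal (‖x - y‖ ^ (-s)) * ‖f y‖ₑ ∂(surfaceMeasure B)

theorem measurable_rieszKernel (s : ℝ) :
    Measurable (Function.uncurry fun x y : E3 => ENNReal.ofReal (‖x - y‖ ^ (-s))) := by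
  unfold Function.uncurry
  fun_prop

theorem measurable_rieszPotential (B : Set E3) (s : ℝ) {f : E3 → ℝ} (hf : Measurable f) :
    Measurable (rieszPotential B s f) :=
  Measurable.lintegral_prod_right'
    (f := fun z : E3 × E3 => ENNReal.ofReal (‖z.1 - z.2‖ ^ (-s)) * ‖f z.2‖ₑ)
    ((measurable_rieszKernel s).mul (hf.comp measurable_snd).enorm)

theorem stronglyMeasurable_boundaryIntegral {B : Set E3} {k : E3 → E3 → ℝ}
    (hk : WeaklySingular B k) {f : E3 → ℝ} (hf : Measurable f) :
    StronglyMeasurable (boundaryIntegral B k f) :=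
  StronglyMeasurable.integral_prod_right' (f := fun z : E3 × E3 => k z.1 z.2 * f z.2)
    (hk.measurable.mul (hf.comp measurable_snd)).stronglyMeasurable

/-! ### Bounds on `L²(∂B)` and transposition for weakly singular kernels. -/

namespace IsReferenceParticle

variable {B : Set E3} (hB : IsReferenceParticle B)

include hB

theorem exists_lintegral_rieszPotential_sq_le {s : ℝ} (hs0 : 0 < s) (hs : s < 2) :
    ∃ A : ℝ≥0∞, A ≠ ⊤ ∧ ∀ f : E3 → ℝ, Measurable f →
      ∫⁻ x, rieszPotential B s f x ^ 2 ∂(surfaceMeasure B) ≤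
        A * ∫⁻ y, ‖f y‖ₑ ^ 2 ∂(surfaceMeasure B) := by
  obtain ⟨A, hA, h⟩ := hB.exists_lintegral_rpow_le hs0 hs
  refine ⟨A * A, ENNReal.mul_ne_top hA hA, fun f hf => ?_⟩
  refine lintegral_schur (measurable_rieszKernel s) ?_ ?_ hf.enorm
  · filter_upwards [hB.ae_mem_frontier] with x hx using h x hx
  · filter_upwards [hB.ae_mem_frontier] with y hy
    simp_rw [norm_sub_rev _ y]
    exact h y hy

theorem ae_rieszPotential_lt_top {s : ℝ} (hs0 : 0 < s) (hs : s < 2) {f : E3 → ℝ}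
    (hf : Measurable f) (hf2 : MemLp f 2 (surfaceMeasure B)) :
    ∀ᵐ x ∂(surfaceMeasure B), rieszPotential B s f x < ⊤ := by
  obtain ⟨A, hA, h⟩ := hB.exists_lintegral_rieszPotential_sq_le hs0 hs
  have h1 : ∫⁻ x, rieszPotential B s f x ^ 2 ∂(surfaceMeasure B) ≠ ⊤ :=
    ((h f hf).trans_lt (ENNReal.mul_lt_top hA.lt_top (lintegral_enorm_sq_lt_top hf2))).ne
  filter_upwards [ae_lt_top ((measurable_rieszPotential B s hf).pow_const 2) h1] with x hx
  exact (ENNReal.pow_lt_top_iff (n := 2)).1 hx |>.resolve_right two_ne_zero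

theorem lintegral_kernel_mul_le {k : E3 → E3 → ℝ} {C : ℝ} (hC : 0 ≤ C)
    (h : ∀ x ∈ frontier B, ∀ y ∈ frontier B, |k x y| ≤ C * ‖x - y‖ ^ (-1 : ℝ)) {f : E3 → ℝ}
    (hf : Measurable f) {x : E3} (hx : x ∈ frontier B) :
    ∫⁻ y, ‖k x y * f y‖ₑ ∂(surfaceMeasure B) ≤ ENNReal.ofReal C * rieszPotential B 1 f x := by
  rw [rieszPotential, ← lintegral_const_mul _ (by fun_prop)]
  refine lintegral_mono_ae ?_
  filter_upwards [hB.ae_mem_frontier] with y hy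
  rw [enorm_mul, ← mul_assoc, ← ENNReal.ofReal_mul hC]
  gcongr
  rw [← ofReal_norm, Real.norm_eq_abs]
  exact ENNReal.ofReal_le_ofReal (h x hx y hy)

variable {k : E3 → E3 → ℝ} (hk : WeaklySingular B k)

include hk

theorem ae_integrable_kernel_mul {f : E3 → ℝ} (hf : Measurable f)
    (hf2 : MemLp f 2 (surfaceMeasure B)) :
    ∀ᵐ x ∂(surfaceMeasure B), Integrable (fun y => k x y * f y) (surfaceMeasure B) := by
  obtain ⟨C, hC, h⟩ := hk.bound
  filter_upwards [hB.ae_mem_frontier, hB.ae_rieszPotential_lt_top one_pos one_lt_two hf hf2]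
    with x hx hx2
  refine ⟨((hk.measurable.comp measurable_prodMk_left).mul hf).aestronglyMeasurable, ?_⟩
  exact (hB.lintegral_kernel_mul_le hC h hf hx).trans_lt
    (ENNReal.mul_lt_top ENNReal.ofReal_lt_top hx2)

theorem exists_lintegral_boundaryIntegral_sq_le :
    ∃ D : ℝ≥0∞, D ≠ ⊤ ∧ ∀ f : E3 → ℝ, Measurable f →
      ∫⁻ x, ‖boundaryIntegral B k f x‖ₑ ^ 2 ∂(surfaceMeasure B) ≤
        D * ∫⁻ y, ‖f y‖ₑ ^ 2 ∂(surfaceMeasure B) := by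
  obtain ⟨C, hC, h⟩ := hk.bound
  obtain ⟨A, hA, h2⟩ := hB.exists_lintegral_rieszPotential_sq_le one_pos one_lt_two
  refine ⟨ENNReal.ofReal C ^ 2 * A, ENNReal.mul_ne_top (by simp) hA, fun f hf => ?_⟩
  calc _ ≤ ∫⁻ x, ENNReal.ofReal C ^ 2 * rieszPotential B 1 f x ^ 2 ∂(surfaceMeasure B) := by
        refine lintegral_mono_ae ?_
        filter_upwards [hB.ae_mem_frontier] with x hx
        rw [← mul_pow]
        gcongr
        exact (enorm_integral_le_lintegral_enorm _).trans
          (hB.lintegral_kernel_mul_le hC h hf hx)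
    _ ≤ _ := by
        rw [lintegral_const_mul _ ((measurable_rieszPotential B 1 hf).pow_const 2), mul_assoc]
        gcongr
        exact h2 f hf

theorem memLp_boundaryIntegral (f : L2 B) :
    MemLp (boundaryIntegral B k f) 2 (surfaceMeasure B) := by
  obtain ⟨D, hD, h⟩ := hB.exists_lintegral_boundaryIntegral_sq_le hk
  have hf : Measurable f := (Lp.stronglyMeasurable f).measurable
  exact memLp_two_of_lintegral_le
    (stronglyMeasurable_boundaryIntegral hk hf).aestronglyMeasurable hD f (h f hf)

theorem integrable_prod_kernel {ψ f : E3 → ℝ} (hψ : Measurable ψ) (hf : Measurable f)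
    (hψ2 : MemLp ψ 2 (surfaceMeasure B)) (hf2 : MemLp f 2 (surfaceMeasure B)) :
    Integrable (fun z : E3 × E3 => ψ z.1 * (k z.1 z.2 * f z.2))
      ((surfaceMeasure B).prod (surfaceMeasure B)) := by
  obtain ⟨C, hC, h⟩ := hk.bound
  obtain ⟨A, hA, h2⟩ := hB.exists_lintegral_rieszPotential_sq_le one_pos one_lt_two
  have hm : Measurable fun z : E3 × E3 => ψ z.1 * (k z.1 z.2 * f z.2) :=
    (hψ.comp measurable_fst).mul (hk.measurable.mul (hf.comp measurable_snd))
  refine ⟨hm.aestronglyMeasurable, ?_⟩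
  rw [HasFiniteIntegral, lintegral_prod _ hm.enorm.aemeasurable]
  calc _ ≤ ∫⁻ x, ‖ψ x‖ₑ * (ENNReal.ofReal C * rieszPotential B 1 f x) ∂(surfaceMeasure B) := by
        refine lintegral_mono_ae ?_
        filter_upwards [hB.ae_mem_frontier] with x hx
        simp only [enorm_mul ((ψ x))]
        have hmx : Measurable fun y => k x y * f y :=
          (hk.measurable.comp measurable_prodMk_left).mul hf
        rw [lintegral_const_mul _ hmx.enorm]
        gcongr
        exact hB.lintegral_kernel_mul_le hC h hf hx
    _ ≤ (∫⁻ x, ‖ψ x‖ₑ ^ (2 : ℝ) ∂(surfaceMeasure B)) ^ (1 / (2 : ℝ)) *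
        (∫⁻ x, (ENNReal.ofReal C * rieszPotential B 1 f x) ^ (2 : ℝ)
          ∂(surfaceMeasure B)) ^ (1 / (2 : ℝ)) :=
        ENNReal.lintegral_mul_le_Lp_mul_Lq _ Real.HolderConjugate.two_two hψ.enorm.aemeasurable
          ((measurable_rieszPotential B 1 hf).const_mul _).aemeasurable
    _ < ⊤ := by
        simp only [ENNReal.rpow_two, mul_pow]
        rw [lintegral_const_mul _ ((measurable_rieszPotential B 1 hf).pow_const 2)]
        refine ENNReal.mul_lt_top (ENNReal.rpow_lt_top_of_nonneg (by norm_num)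
          (lintegral_enorm_sq_lt_top hψ2).ne) (ENNReal.rpow_lt_top_of_nonneg (by norm_num)
          (ENNReal.mul_ne_top (by simp) ?_))
        exact ((h2 f hf).trans_lt
          (ENNReal.mul_lt_top hA.lt_top (lintegral_enorm_sq_lt_top hf2))).ne

/-- Fubini's theorem for a weakly singular kernel and its transpose. -/
theorem integral_mul_boundaryIntegral (ψ f : L2 B) :
    ∫ x, ψ x * boundaryIntegral B k f x ∂(surfaceMeasure B) =
      ∫ y, boundaryIntegral B (fun y x => k x y) ψ y * f y ∂(surfaceMeasure B) := by
  have hi := hB.integrable_prod_kernel hk (Lp.stronglyMeasurable ψ).measurable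
    (Lp.stronglyMeasurable f).measurable (Lp.memLp ψ) (Lp.memLp f)
  calc _ = ∫ x, ∫ y, ψ x * (k x y * f y) ∂(surfaceMeasure B) ∂(surfaceMeasure B) := by
        simp only [boundaryIntegral, integral_const_mul]
    _ = ∫ y, ∫ x, ψ x * (k x y * f y) ∂(surfaceMeasure B) ∂(surfaceMeasure B) :=
        integral_integral_swap hi
    _ = _ := by
        refine integral_congr_ae (Eventually.of_forall fun y => ?_)
        simp only [boundaryIntegral]
        rw [← integral_mul_const]
        refine integral_congr_ae (Eventually.of_forall fun x => ?_)
        simp only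
        ring

end IsReferenceParticle

/-! ### The Neumann–Poincaré operator on `H^{-1/2}(∂B)` -/

theorem toL2_injective (B : Set E3) : Function.Injective (toL2 B) := by
  rw [injective_iff_map_eq_zero]
  intro p hp
  have hp1 : p.1.fst = 0 := hp
  have h0 : ∀ᵐ x ∂(surfaceMeasure B), (p.1.fst : E3 → ℝ) x = 0 := by
    rw [hp1]; exact Lp.coeFn_zero ℝ 2 (surfaceMeasure B)
  have h1 := (Measure.quasiMeasurePreserving_fst (μ := surfaceMeasure B)
    (ν := surfaceMeasure B)).ae h0
  have h2 := (Measure.quasiMeasurePreserving_snd (μ := surfaceMeasure B)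
    (ν := surfaceMeasure B)).ae h0
  have hp2 : p.1.snd = 0 := by
    rw [Lp.eq_zero_iff_ae_eq_zero]
    have h3 : ∀ᵐ z ∂((surfaceMeasure B).prod (surfaceMeasure B)),
      p.1.snd z = (p.1.fst z.1 - p.1.fst z.2) / ‖z.1 - z.2‖ ^ (3 / 2 : ℝ) := p.2
    filter_upwards [h1, h2, h3] with z h1 h2 h3
    rw [h3, h1, h2]
    simp
  apply Subtype.ext
  apply (WithLp.ofLp_injective 2)
  exact Prod.ext hp1 hp2

/-- The pointwise relation between a function and its quotient survives `L²` limits along a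
subsequence on which both components converge almost everywhere. Completeness makes `HHalf B` a
Hilbert space, as adjoints and Riesz representation require. -/
theorem isClosed_HHalf (B : Set E3) : IsClosed (HHalf B : Set (WithLp 2 (L2 B × L2Prod B))) := by
  refine IsSeqClosed.isClosed fun u p hu hp => ?_
  have hfst : Tendsto (fun n => (u n).fst) atTop (𝓝 p.fst) :=
    ((WithLp.fstL 2 ℝ (L2 B) (L2Prod B)).continuous.tendsto p).comp hp
  have hsnd : Tendsto (fun n => (u n).snd) atTop (𝓝 p.snd) :=
    ((WithLp.sndL 2 ℝ (L2 B) (L2Prod B)).continuous.tendsto p).comp hp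
  obtain ⟨m, hm, h1⟩ := (tendstoInMeasure_of_tendsto_Lp hfst).exists_seq_tendsto_ae
  obtain ⟨m', hm', h2⟩ :=
    (tendstoInMeasure_of_tendsto_Lp (hsnd.comp hm.tendsto_atTop)).exists_seq_tendsto_ae
  have h1a := (Measure.quasiMeasurePreserving_fst (μ := surfaceMeasure B)
    (ν := surfaceMeasure B)).ae h1
  have h1b := (Measure.quasiMeasurePreserving_snd (μ := surfaceMeasure B)
    (ν := surfaceMeasure B)).ae h1
  have hu' : ∀ᵐ z ∂((surfaceMeasure B).prod (surfaceMeasure B)), ∀ n,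
      (u n).snd z = ((u n).fst z.1 - (u n).fst z.2) / ‖z.1 - z.2‖ ^ (3 / 2 : ℝ) :=
    ae_all_iff.2 hu
  change ∀ᵐ z ∂((surfaceMeasure B).prod (surfaceMeasure B)),
    p.snd z = (p.fst z.1 - p.fst z.2) / ‖z.1 - z.2‖ ^ (3 / 2 : ℝ)
  filter_upwards [h1a, h1b, h2, hu'] with z ha hb h2 hz
  refine tendsto_nhds_unique h2 ?_
  have h3 := ((ha.sub hb).div_const (‖z.1 - z.2‖ ^ (3 / 2 : ℝ))).comp hm'.tendsto_atTop
  refine h3.congr fun n => ?_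
  simp only [Function.comp_apply, hz]

instance (B : Set E3) : CompleteSpace (HHalf B) := (isClosed_HHalf B).completeSpace_coe

/-- `L²(∂B)` is dense in `H^{-1/2}(∂B)`. -/
theorem denseRange_ofL2 (B : Set E3) : DenseRange (ofL2 B) := by
  -- Up to the Riesz isometry, `ofL2 B` is the adjoint of the embedding `toL2 B`, and the adjoint of
  -- an injective operator has dense range.
  set A : L2 B →L[ℝ] HHalf B := ContinuousLinearMap.adjoint (toL2 B) with hA
  have h1 : DenseRange A := by
    have hker : (LinearMap.range (A : L2 B →ₗ[ℝ] HHalf B))ᗮ = ⊥ := by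
      rw [Submodule.eq_bot_iff]
      intro p hp
      apply toL2_injective B
      rw [map_zero, ← inner_self_eq_zero (𝕜 := ℝ), ← ContinuousLinearMap.adjoint_inner_left]
      exact (Submodule.mem_orthogonal _ _).1 hp _ ⟨toL2 B p, rfl⟩
    have := (Submodule.topologicalClosure_eq_top_iff
      (K := LinearMap.range (A : L2 B →ₗ[ℝ] HHalf B))).2 hker
    exact Submodule.dense_iff_topologicalClosure_eq_top.2 this
  have h2 : ofL2 B = InnerProductSpace.toDual ℝ (HHalf B) ∘ A := by
    funext ψ
    ext p
    simp only [Function.comp_apply, InnerProductSpace.toDual_apply_apply, hA,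
      ContinuousLinearMap.adjoint_inner_left]
    rfl
  rw [h2]
  exact (InnerProductSpace.toDual ℝ (HHalf B)).surjective.denseRange.comp h1
    (InnerProductSpace.toDual ℝ (HHalf B)).continuous

theorem ofL2_apply (B : Set E3) (ψ : L2 B) (p : HHalf B) : ofL2 B ψ p = ⟪ψ, toL2 B p⟫ := rfl

/-- The difference quotient that enters the norm of `H^{1/2}(∂B)`. -/
def halfQuotient (u : E3 → ℝ) (z : E3 × E3) : ℝ :=
  (u z.1 - u z.2) / ‖z.1 - z.2‖ ^ (3 / 2 : ℝ)

theorem ennreal_add_sq_le (a b : ℝ≥0∞) : (a + b) ^ 2 ≤ 2 * (a ^ 2 + b ^ 2) := by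
  have h := ENNReal.rpow_add_le_mul_rpow_add_rpow a b one_le_two
  have e : (2 : ℝ) - 1 = 1 := by norm_num
  simpa only [e, ENNReal.rpow_one, ENNReal.rpow_two] using h

theorem lintegral_prod_mul_sq_add_le {X : Type*} [MeasurableSpace X] {σ : Measure X} [SFinite σ]
    {R : X → X → ℝ≥0∞} (hR : Measurable (Function.uncurry R)) (hsymm : ∀ x y, R x y = R y x)
    {A : ℝ≥0∞} (hA : ∀ᵐ x ∂σ, ∫⁻ y, R x y ∂σ ≤ A) {I : X → ℝ≥0∞} (hI : Measurable I) :
    ∫⁻ z, (R z.1 z.2 * I z.1 ^ 2 + R z.1 z.2 * I z.2 ^ 2) ∂(σ.prod σ) ≤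
      2 * (A * ∫⁻ x, I x ^ 2 ∂σ) := by
  have hRx : ∀ x, Measurable (R x) := fun x => hR.comp measurable_prodMk_left
  have hmain : ∫⁻ x, ∫⁻ y, R x y * I x ^ 2 ∂σ ∂σ ≤ A * ∫⁻ x, I x ^ 2 ∂σ := by
    rw [← lintegral_const_mul _ (hI.pow_const 2)]
    refine lintegral_mono_ae ?_
    filter_upwards [hA] with x hx
    rw [lintegral_mul_const _ (hRx x)]
    gcongr
  have hm1 : Measurable fun z : X × X => R z.1 z.2 * I z.1 ^ 2 :=
    hR.mul ((hI.comp measurable_fst).pow_const 2)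
  have hm2 : Measurable fun z : X × X => R z.1 z.2 * I z.2 ^ 2 :=
    hR.mul ((hI.comp measurable_snd).pow_const 2)
  rw [lintegral_add_left hm1, lintegral_prod _ hm1.aemeasurable,
    lintegral_prod_symm _ hm2.aemeasurable, two_mul]
  refine add_le_add hmain (le_of_eq_of_le ?_ hmain)
  exact lintegral_congr fun x => lintegral_congr fun y => by rw [hsymm]

/-! ### The transposed operator gains half a derivative; regularity of eigenfunctions. -/

namespace IsReferenceParticle

variable {B : Set E3} (hB : IsReferenceParticle B)

include hB

theorem weaklySingular_npKernel : WeaklySingular B (npKernel B) := by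
  obtain ⟨C, hC, h, -⟩ := hB.exists_npKernel_bounds
  exact ⟨measurable_npKernel B, C, hC, h⟩

theorem weaklySingular_npKernel_swap : WeaklySingular B fun x y => npKernel B y x :=
  hB.weaklySingular_npKernel.swap

/-- The Hölder bound for the kernel is integrated against `f`; the exponent `-3/4` is the Hölder
gain `3/4` minus the `3/2` of the Slobodeckij quotient. -/
theorem exists_enorm_halfQuotient_le : ∃ C : ℝ, 0 ≤ C ∧ ∀ f : E3 → ℝ, Measurable f →
    ∀ x ∈ frontier B, ∀ x' ∈ frontier B,
      Integrable (fun y => npKernel B y x * f y) (surfaceMeasure B) →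
      Integrable (fun y => npKernel B y x' * f y) (surfaceMeasure B) →
      ‖halfQuotient (boundaryIntegral B (fun x y => npKernel B y x) f) (x, x')‖ₑ ≤
        ENNReal.ofReal C * ENNReal.ofReal (‖x - x'‖ ^ (-(3 / 4) : ℝ)) *
          (rieszPotential B (7 / 4) f x + rieszPotential B (7 / 4) f x') := by
  obtain ⟨C, hC, -, h⟩ := hB.exists_npKernel_bounds
  refine ⟨C, hC, fun f hf x hx x' hx' hi hi' => ?_⟩
  rcases eq_or_ne x x' with rfl | hne
  · simp [halfQuotient]
  set d := ‖x - x'‖ with hd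
  have hd0 : 0 < d := norm_pos_iff.2 (sub_ne_zero.2 hne)
  have h1 : ‖boundaryIntegral B (fun x y => npKernel B y x) f x -
      boundaryIntegral B (fun x y => npKernel B y x) f x'‖ₑ ≤
      ENNReal.ofReal (C * d ^ (3 / 4 : ℝ)) *
        (rieszPotential B (7 / 4) f x + rieszPotential B (7 / 4) f x') := by
    rw [boundaryIntegral, boundaryIntegral, ← integral_sub hi hi', rieszPotential, rieszPotential,
      ← lintegral_add_left (by fun_prop), ← lintegral_const_mul _ (by fun_prop)]
    refine (enorm_integral_le_lintegral_enorm _).trans (lintegral_mono_ae ?_)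
    filter_upwards [hB.ae_mem_frontier] with y hy
    rw [← sub_mul, enorm_mul, ← add_mul, ← mul_assoc,
      ← ENNReal.ofReal_add (by positivity) (by positivity), ← ENNReal.ofReal_mul (by positivity)]
    gcongr
    rw [← ofReal_norm, Real.norm_eq_abs]
    refine ENNReal.ofReal_le_ofReal ((h x hx x' hx' y hy).trans_eq ?_)
    ring
  have e : ∀ a : ℝ, ‖a / d ^ (3 / 2 : ℝ)‖ₑ = ENNReal.ofReal ((d ^ (3 / 2 : ℝ))⁻¹) * ‖a‖ₑ := by
    intro a
    rw [div_eq_mul_inv, mul_comm, enorm_mul, Real.enorm_of_nonneg (by positivity)]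
  rw [halfQuotient]
  simp only
  rw [← hd, e]
  refine (mul_le_mul_right h1 _).trans_eq ?_
  rw [← mul_assoc, ← ENNReal.ofReal_mul (by positivity), ← ENNReal.ofReal_mul hC]
  congr 2
  rw [← Real.rpow_neg hd0.le, mul_left_comm, ← Real.rpow_add hd0]
  norm_num

/-- After squaring, the weight `‖x - x'‖^(-3/2)` is integrable in either variable and the Riesz
potential with exponent `7/4` is bounded on `L²`; both exponents are below the dimension two. -/
theorem exists_lintegral_halfQuotient_sq_le : ∃ D : ℝ≥0∞, D ≠ ⊤ ∧ ∀ f : E3 → ℝ, Measurable f →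
    MemLp f 2 (surfaceMeasure B) →
    ∫⁻ z, ‖halfQuotient (boundaryIntegral B (fun x y => npKernel B y x) f) z‖ₑ ^ 2
      ∂((surfaceMeasure B).prod (surfaceMeasure B)) ≤
    D * ∫⁻ y, ‖f y‖ₑ ^ 2 ∂(surfaceMeasure B) := by
  obtain ⟨C, hC, h⟩ := hB.exists_enorm_halfQuotient_le
  obtain ⟨A, hA, hR⟩ := hB.exists_lintegral_rpow_le (s := 3 / 2) (by norm_num) (by norm_num)
  obtain ⟨A', hA', hI⟩ := hB.exists_lintegral_rieszPotential_sq_le (s := 7 / 4)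
    (by norm_num) (by norm_num)
  refine ⟨ENNReal.ofReal C ^ 2 * (2 * (2 * (A * A'))), by
    refine ENNReal.mul_ne_top (by simp) (ENNReal.mul_ne_top (by simp) (ENNReal.mul_ne_top (by simp)
      (ENNReal.mul_ne_top hA hA'))), fun f hf hf2 => ?_⟩
  have hIm : Measurable (rieszPotential B (7 / 4) f) := measurable_rieszPotential B _ hf
  have hi := hB.ae_integrable_kernel_mul hB.weaklySingular_npKernel_swap hf hf2
  have h1 : ∀ᵐ z ∂((surfaceMeasure B).prod (surfaceMeasure B)),
      ‖halfQuotient (boundaryIntegral B (fun x y => npKernel B y x) f) z‖ₑ ^ 2 ≤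
      ENNReal.ofReal C ^ 2 * (2 *
        (ENNReal.ofReal (‖z.1 - z.2‖ ^ (-(3 / 2) : ℝ)) * rieszPotential B (7 / 4) f z.1 ^ 2 +
        ENNReal.ofReal (‖z.1 - z.2‖ ^ (-(3 / 2) : ℝ)) * rieszPotential B (7 / 4) f z.2 ^ 2)) := by
    have ha := (Measure.quasiMeasurePreserving_fst (μ := surfaceMeasure B)
      (ν := surfaceMeasure B)).ae (hB.ae_mem_frontier.and hi)
    have hb := (Measure.quasiMeasurePreserving_snd (μ := surfaceMeasure B)
      (ν := surfaceMeasure B)).ae (hB.ae_mem_frontier.and hi)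
    filter_upwards [ha, hb] with z ha hb
    refine (pow_le_pow_left₀ zero_le (h f hf z.1 ha.1 z.2 hb.1 ha.2 hb.2) 2).trans ?_
    rw [mul_pow, mul_pow, mul_assoc, ← mul_add, mul_left_comm 2]
    refine mul_le_mul_right (mul_le_mul' (le_of_eq ?_) (ennreal_add_sq_le _ _)) _
    rw [← ENNReal.ofReal_pow (by positivity), ← Real.rpow_natCast, ← Real.rpow_mul (norm_nonneg _)]
    norm_num
  have hm := lintegral_prod_mul_sq_add_le (measurable_rieszKernel (3 / 2))
    (fun x y => by rw [norm_sub_rev]) (hB.ae_mem_frontier.mono hR) hIm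
  refine (lintegral_mono_ae h1).trans ?_
  rw [lintegral_const_mul' _ _ (by simp), lintegral_const_mul' _ _ (by simp), mul_assoc, mul_assoc,
    mul_assoc, mul_assoc]
  gcongr
  refine hm.trans ?_
  gcongr
  exact hI f hf

/-- The transpose of `K_B^*` maps `L²(∂B)` boundedly to `H^{1/2}(∂B)`. -/
theorem exists_transpose : ∃ K : L2 B →L[ℝ] HHalf B, ∀ f : L2 B,
    toL2 B (K f) =ᵐ[surfaceMeasure B] boundaryIntegral B (fun x y => npKernel B y x) f := by
  have hk := hB.weaklySingular_npKernel_swap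
  obtain ⟨D₁, hD₁, h₁⟩ := hB.exists_lintegral_boundaryIntegral_sq_le hk
  obtain ⟨D₂, hD₂, h₂⟩ := hB.exists_lintegral_halfQuotient_sq_le
  have hfm : ∀ f : L2 B, Measurable f := fun f => (Lp.stronglyMeasurable f).measurable
  set u : L2 B → E3 → ℝ := fun f => boundaryIntegral B (fun x y => npKernel B y x) f with hu
  have hum : ∀ f, StronglyMeasurable (u f) := fun f =>
    stronglyMeasurable_boundaryIntegral hk (hfm f)
  have hqm : ∀ f, Measurable (halfQuotient (u f)) := fun f => by
    have := (hum f).measurable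
    unfold halfQuotient
    fun_prop
  have hu2 : ∀ f, MemLp (u f) 2 (surfaceMeasure B) := fun f => hB.memLp_boundaryIntegral hk f
  have hq2 : ∀ f, MemLp (halfQuotient (u f)) 2 ((surfaceMeasure B).prod (surfaceMeasure B)) :=
    fun f => memLp_two_of_lintegral_le (hqm f).aestronglyMeasurable hD₂ f
      (h₂ f (hfm f) (Lp.memLp f))
  let K₀ : L2 B → HHalf B := fun f => ⟨WithLp.toLp 2 ((hu2 f).toLp, (hq2 f).toLp), by
    have ha := (Measure.quasiMeasurePreserving_fst (μ := surfaceMeasure B)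
      (ν := surfaceMeasure B)).ae (hu2 f).coeFn_toLp
    have hb := (Measure.quasiMeasurePreserving_snd (μ := surfaceMeasure B)
      (ν := surfaceMeasure B)).ae (hu2 f).coeFn_toLp
    change ∀ᵐ z ∂((surfaceMeasure B).prod (surfaceMeasure B)), (hq2 f).toLp _ z =
      ((hu2 f).toLp _ z.1 - (hu2 f).toLp _ z.2) / ‖z.1 - z.2‖ ^ (3 / 2 : ℝ)
    filter_upwards [ha, hb, (hq2 f).coeFn_toLp] with z ha hb hz
    rw [ha, hb, hz, halfQuotient]⟩
  have hK₀ : ∀ f, toL2 B (K₀ f) = (hu2 f).toLp := fun f => rfl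
  have hint : ∀ f : L2 B, ∀ᵐ x ∂(surfaceMeasure B),
      Integrable (fun y => npKernel B y x * f y) (surfaceMeasure B) := fun f =>
    hB.ae_integrable_kernel_mul hk (hfm f) (Lp.memLp f)
  let K₁ : L2 B →ₗ[ℝ] HHalf B :=
    { toFun := K₀
      map_add' := fun f g => by
        apply toL2_injective B
        rw [map_add, hK₀, hK₀, hK₀, ← MemLp.toLp_add]
        refine MemLp.toLp_congr _ _ ?_
        filter_upwards [hint f, hint g] with x hf hg
        simp only [hu, boundaryIntegral, Pi.add_apply]
        rw [← integral_add hf hg]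
        refine integral_congr_ae ?_
        filter_upwards [Lp.coeFn_add f g] with y hy
        rw [hy, Pi.add_apply, mul_add]
      map_smul' := fun a f => by
        apply toL2_injective B
        rw [RingHom.id_apply, map_smul, hK₀, hK₀, ← MemLp.toLp_const_smul]
        refine MemLp.toLp_congr _ _ (Eventually.of_forall fun x => ?_)
        simp only [hu, boundaryIntegral, Pi.smul_apply]
        rw [smul_eq_mul, ← integral_const_mul]
        refine integral_congr_ae ?_
        filter_upwards [Lp.coeFn_smul a f] with y hy
        rw [hy, Pi.smul_apply, smul_eq_mul]
        ring }
  refine ⟨K₁.mkContinuous ((D₁ ^ (1 / 2 : ℝ)).toReal + (D₂ ^ (1 / 2 : ℝ)).toReal) fun f => ?_,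
    fun f => (hu2 f).coeFn_toLp⟩
  have e1 : ‖K₁ f‖ = √(‖(hu2 f).toLp‖ ^ 2 + ‖(hq2 f).toLp‖ ^ 2) :=
    WithLp.prod_norm_eq_of_L2 (K₀ f).1
  have b1 := norm_toLp_le (hu2 f) hD₁ f (h₁ f (hfm f))
  have b2 := norm_toLp_le (hq2 f) hD₂ f (h₂ f (hfm f) (Lp.memLp f))
  rw [e1, add_mul]
  refine (Real.sqrt_le_left (by positivity)).2 ?_ |>.trans (add_le_add b1 b2)
  nlinarith [norm_nonneg ((hu2 f).toLp), norm_nonneg ((hq2 f).toLp)]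

/-- An eigenfunction of `K_B^*` in `H^{-1/2}(∂B)` for a nonzero eigenvalue yields an eigenfunction
in `L²(∂B)`. -/
theorem exists_L2_eigenfunction {l : ℝ} (hl : l ≠ 0) {φ : HNegHalf B} (hφ : φ ≠ 0)
    (h : neumannPoincare B φ = l • φ) : ∃ χ : L2 B, χ ≠ 0 ∧
      boundaryIntegral B (npKernel B) χ =ᵐ[surfaceMeasure B] fun x => l * χ x := by
  have hk := hB.weaklySingular_npKernel
  obtain ⟨K, hK⟩ := hB.exists_transpose
  have hdual : ∀ ψ f : L2 B, ⟪ψ, toL2 B (K f)⟫ = ⟪(hB.memLp_boundaryIntegral hk ψ).toLp, f⟫ := by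
    intro ψ f
    rw [L2.inner_def, L2.inner_def]
    have h1 := hB.integral_mul_boundaryIntegral hB.weaklySingular_npKernel_swap ψ f
    calc _ = ∫ x, ψ x * boundaryIntegral B (fun x y => npKernel B y x) f x
          ∂(surfaceMeasure B) := by
          refine integral_congr_ae ?_
          filter_upwards [hK f] with x hx
          simp [hx, mul_comm]
      _ = _ := h1
      _ = _ := by
          refine integral_congr_ae ?_
          filter_upwards [(hB.memLp_boundaryIntegral hk ψ).coeFn_toLp] with x hx
          simp [hx, mul_comm]
  -- The Banach space dual of the transposed operator satisfies the property that specifies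
  -- `neumannPoincare B`; by density of `L²` there is only one such operator.
  let T₀ : HNegHalf B →L[ℝ] HNegHalf B :=
    ContinuousLinearMap.precomp ℝ (K.comp (toL2 B))
  have hT₀ : ∀ ψ p, T₀ ψ p = ψ (K (toL2 B p)) := fun ψ p => rfl
  have hT₀' : ∀ ψ : L2 B, T₀ (ofL2 B ψ) = ofL2 B (hB.memLp_boundaryIntegral hk ψ).toLp := by
    intro ψ
    ext p
    rw [hT₀, ofL2_apply, ofL2_apply, hdual]
  have hspec : ∀ ψ : L2 B, ∃ χ : L2 B,
      (∀ᵐ x ∂(surfaceMeasure B), χ x =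
        ∫ y, ⟪x - y, normal B x⟫ / (4 * Real.pi * ‖x - y‖ ^ 3) * ψ y ∂(surfaceMeasure B)) ∧
      neumannPoincare B (ofL2 B ψ) = ofL2 B χ :=
    Classical.epsilon_spec (p := fun T : HNegHalf B →L[ℝ] HNegHalf B => ∀ ψ : L2 B, ∃ χ : L2 B,
      (∀ᵐ x ∂(surfaceMeasure B), χ x =
        ∫ y, ⟪x - y, normal B x⟫ / (4 * Real.pi * ‖x - y‖ ^ 3) * ψ y ∂(surfaceMeasure B)) ∧
      T (ofL2 B ψ) = ofL2 B χ)
      ⟨T₀, fun ψ => ⟨_, (hB.memLp_boundaryIntegral hk ψ).coeFn_toLp, hT₀' ψ⟩⟩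
  have heq : neumannPoincare B = T₀ := by
    refine ContinuousLinearMap.ext fun ξ => ?_
    refine congrFun ((denseRange_ofL2 B).equalizer (neumannPoincare B).continuous T₀.continuous
      (funext fun ψ => ?_)) ξ
    obtain ⟨χ, h1, h2⟩ := hspec ψ
    rw [Function.comp_apply, Function.comp_apply, h2, hT₀']
    congr 1
    refine Lp.ext ?_
    filter_upwards [h1, (hB.memLp_boundaryIntegral hk ψ).coeFn_toLp] with x hx hx'
    rw [hx, hx']
    rfl
  -- As `K` smooths, `φ ∘ K` is a bounded functional on `L²`. The eigenvalue equation reads `l φ(p)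
  -- = φ(K p) = ⟪χ, p⟫`, so `l φ` is the density `χ`.
  set χ : L2 B := (InnerProductSpace.toDual ℝ (L2 B)).symm (φ.comp K) with hχ
  have hχK : ∀ f : L2 B, ⟪χ, f⟫ = φ (K f) := fun f => by
    rw [hχ, InnerProductSpace.toDual_symm_apply]
    rfl
  have hφχ : ∀ p, l * φ p = ⟪χ, toL2 B p⟫ := by
    intro p
    have := congrArg (fun ξ : HNegHalf B => ξ p) h
    rw [heq] at this
    simp only [hT₀] at this
    rw [hχK, this]
    rfl
  have hfix : (hB.memLp_boundaryIntegral hk χ).toLp = l • χ := by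
    refine ext_inner_right ℝ fun f => ?_
    rw [← hdual, ← hφχ, ← hχK, inner_smul_left]
    rfl
  refine ⟨χ, fun h0 => hφ ?_, ?_⟩
  · ext p
    have := hφχ p
    rw [h0, inner_zero_left] at this
    simpa [hl] using this
  · have h1 := (hB.memLp_boundaryIntegral hk χ).coeFn_toLp
    rw [hfix] at h1
    filter_upwards [h1, Lp.coeFn_smul l χ] with x hx hx'
    rw [← hx, hx']
    rfl

end IsReferenceParticle

/-! ### Bounds for the eigenvalues of the Neumann–Poincaré operator -/

namespace IsReferenceParticle

variable {B : Set E3} (hB : IsReferenceParticle B)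

include hB

/-- With Tonelli the `x`-integral is taken first, and it is the normalised solid angle at `y`. -/
theorem lintegral_npKernel_le (g : E3 → ℝ≥0∞) (hg : Measurable g) :
    ∫⁻ x, ∫⁻ y, ENNReal.ofReal (npKernel B x y) * g y ∂(surfaceMeasure B) ∂(surfaceMeasure B) ≤
      ENNReal.ofReal (1 / 2) * ∫⁻ y, g y ∂(surfaceMeasure B) := by
  have hm : Measurable (Function.uncurry fun x y => ENNReal.ofReal (npKernel B x y) * g y) :=
    (measurable_npKernel B).ennreal_ofReal.mul (hg.comp measurable_snd)
  rw [lintegral_lintegral_swap hm.aemeasurable, ← lintegral_const_mul _ hg]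
  refine lintegral_mono_ae ?_
  filter_upwards [hB.ae_mem_frontier] with y hy
  have hmy : Measurable fun x => ENNReal.ofReal (npKernel B x y) :=
    ((measurable_npKernel B).comp measurable_prodMk_right).ennreal_ofReal
  rw [lintegral_mul_const _ hmy]
  exact mul_le_mul_left (hB.lintegral_solidAngle_le hy) _

variable {χ : L2 B} {l : ℝ}
  (h : boundaryIntegral B (npKernel B) χ =ᵐ[surfaceMeasure B] fun x => l * χ x)

include h

theorem ae_enorm_mul_le : ∀ᵐ x ∂(surfaceMeasure B), ‖l‖ₑ * ‖χ x‖ₑ ≤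
    ∫⁻ y, ENNReal.ofReal (npKernel B x y) * ‖χ y‖ₑ ∂(surfaceMeasure B) := by
  filter_upwards [h, hB.ae_mem_frontier] with x hx hxB
  rw [← enorm_mul, ← hx]
  refine (enorm_integral_le_lintegral_enorm _).trans (le_of_eq (lintegral_congr_ae ?_))
  filter_upwards [hB.ae_mem_frontier] with y hy
  rw [enorm_mul, Real.enorm_of_nonneg (hB.npKernel_nonneg hxB hy)]

/-- The eigenvalue equation is integrated in absolute value and divided by the `L¹` norm of `χ`,
which is finite since the surface measure is. -/
theorem abs_eigenvalue_le (hχ : χ ≠ 0) : |l| ≤ 1 / 2 := by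
  have := hB.isFiniteMeasure_surfaceMeasure
  have hχm : Measurable χ := (Lp.stronglyMeasurable χ).measurable
  have h0 : ∫⁻ y, ‖χ y‖ₑ ∂(surfaceMeasure B) ≠ 0 := by
    rw [Ne, lintegral_eq_zero_iff hχm.enorm]
    intro h0
    apply hχ
    rw [Lp.eq_zero_iff_ae_eq_zero]
    filter_upwards [h0] with x hx
    simpa using hx
  have hfin : ∫⁻ y, ‖χ y‖ₑ ∂(surfaceMeasure B) ≠ ⊤ :=
    ((Lp.memLp χ).integrable one_le_two).2.ne
  have h1 := (lintegral_mono_ae (hB.ae_enorm_mul_le h)).trans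
    (hB.lintegral_npKernel_le _ hχm.enorm)
  rw [lintegral_const_mul _ hχm.enorm] at h1
  have h2 := (ENNReal.mul_le_mul_iff_left h0 hfin).1 h1
  rwa [← ofReal_norm, ENNReal.ofReal_le_ofReal_iff (by norm_num), Real.norm_eq_abs] at h2

/-- The triangle inequality gives `≤` pointwise, the solid angle bound gives `≥` after integration,
so equality holds almost everywhere. -/
theorem ae_half_enorm_eq (hl : l = -(1 / 2)) : ∀ᵐ x ∂(surfaceMeasure B),
    ENNReal.ofReal (1 / 2) * ‖χ x‖ₑ =
      ∫⁻ y, ENNReal.ofReal (npKernel B x y) * ‖χ y‖ₑ ∂(surfaceMeasure B) := by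
  have := hB.isFiniteMeasure_surfaceMeasure
  have hχm : Measurable χ := (Lp.stronglyMeasurable χ).measurable
  have hfin : ∫⁻ y, ‖χ y‖ₑ ∂(surfaceMeasure B) ≠ ⊤ :=
    ((Lp.memLp χ).integrable one_le_two).2.ne
  have hle := hB.lintegral_npKernel_le _ hχm.enorm
  have hnl : ‖l‖ₑ = ENNReal.ofReal (1 / 2) := by
    rw [← ofReal_norm, hl, norm_neg, Real.norm_of_nonneg (by norm_num)]
  have hae := hB.ae_enorm_mul_le h
  rw [hnl] at hae
  have hm : Measurable fun z : E3 × E3 => ENNReal.ofReal (npKernel B z.1 z.2) * ‖χ z.2‖ₑ :=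
    (measurable_npKernel B).ennreal_ofReal.mul (hχm.comp measurable_snd).enorm
  have hm' : Measurable fun x => ∫⁻ y, ENNReal.ofReal (npKernel B x y) * ‖χ y‖ₑ
      ∂(surfaceMeasure B) := hm.lintegral_prod_right'
  rw [← lintegral_const_mul _ hχm.enorm] at hle
  refine ae_eq_of_ae_le_of_lintegral_le hae ?_ hm'.aemeasurable hle
  rw [lintegral_const_mul _ hχm.enorm]
  exact ENNReal.mul_ne_top ENNReal.ofReal_ne_top hfin

/-- At an eigenfunction for the eigenvalue `-1/2` there is no cancellation in `K_B^*`, so that it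
takes the opposite sign of its value at almost every point. -/
theorem ae_mul_nonpos_of_eigenvalue (hl : l = -(1 / 2)) : ∀ᵐ x ∂(surfaceMeasure B),
    ∀ᵐ y ∂(surfaceMeasure B), χ x * χ y ≤ 0 := by
  have hk := hB.weaklySingular_npKernel
  have hχm : Measurable χ := (Lp.stronglyMeasurable χ).measurable
  have hkx : ∀ x, Measurable fun y => npKernel B x y := fun x => by
    unfold npKernel
    fun_prop
  have heq := hB.ae_half_enorm_eq h hl
  have hint : ∀ᵐ x ∂(surfaceMeasure B),
      Integrable (fun y => npKernel B x y * χ y) (surfaceMeasure B) :=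
    hB.ae_integrable_kernel_mul hk hχm (Lp.memLp χ)
  have h' : ∀ᵐ x ∂(surfaceMeasure B), boundaryIntegral B (npKernel B) χ x = l * χ x := h
  refine ((h'.and heq).and (hB.ae_mem_frontier.and hint)).mono ?_
  rintro x ⟨⟨hx1, hx2⟩, hxB, hi⟩
  have habs : ∫ y, npKernel B x y * |χ y| ∂(surfaceMeasure B) = 1 / 2 * |χ x| := by
    rw [integral_eq_lintegral_of_nonneg_ae]
    · have e : ∫⁻ y, ENNReal.ofReal (npKernel B x y * |χ y|) ∂(surfaceMeasure B) =
          ∫⁻ y, ENNReal.ofReal (npKernel B x y) * ‖χ y‖ₑ ∂(surfaceMeasure B) := by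
        refine lintegral_congr_ae ?_
        filter_upwards [hB.ae_mem_frontier] with y hy
        rw [ENNReal.ofReal_mul (hB.npKernel_nonneg hxB hy), ← ofReal_norm, Real.norm_eq_abs]
      rw [e]
      rw [← hx2, ENNReal.toReal_mul, toReal_enorm, Real.norm_eq_abs,
        ENNReal.toReal_ofReal (by norm_num)]
    · filter_upwards [hB.ae_mem_frontier] with y hy
      exact mul_nonneg (hB.npKernel_nonneg hxB hy) (abs_nonneg _)
    · exact ((hkx x).mul hχm.abs).aestronglyMeasurable
  have hi' : Integrable (fun y => npKernel B x y * |χ y|) (surfaceMeasure B) := by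
    refine hi.abs.congr ?_
    filter_upwards [hB.ae_mem_frontier] with y hy
    rw [abs_mul, abs_of_nonneg (hB.npKernel_nonneg hxB hy)]
  have hx1' : ∫ y, npKernel B x y * χ y ∂(surfaceMeasure B) = -(1 / 2) * χ x := by
    rw [← hl]; exact hx1
  -- The integrand is nonnegative with integral `χ(x)²/2 - χ(x)²/2 = 0`, hence zero almost
  -- everywhere. The kernel is positive off the diagonal, a null set, so `|χ(x) χ(y)| + χ(x) χ(y) =
  -- 0`.
  have hzero : ∫ y, (|χ x| * (npKernel B x y * |χ y|) + χ x * (npKernel B x y * χ y))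
      ∂(surfaceMeasure B) = 0 := by
    rw [integral_add (hi'.const_mul _) (hi.const_mul _), integral_const_mul, integral_const_mul,
      habs, hx1']
    nlinarith [abs_mul_abs_self (χ x)]
  have hnn : 0 ≤ᵐ[surfaceMeasure B] fun y =>
      |χ x| * (npKernel B x y * |χ y|) + χ x * (npKernel B x y * χ y) := by
    filter_upwards [hB.ae_mem_frontier] with y hy
    have hpos := hB.npKernel_nonneg hxB hy
    have h1 := neg_abs_le (χ x * χ y)
    rw [abs_mul] at h1
    simp only [Pi.zero_apply]
    nlinarith
  have hzero' := (integral_eq_zero_iff_of_nonneg_ae hnn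
    ((hi'.const_mul _).add (hi.const_mul _))).1 hzero
  have hne : ∀ᵐ y ∂(surfaceMeasure B), y ≠ x := by
    rw [ae_iff]
    simpa using hB.surfaceMeasure_singleton hxB
  filter_upwards [hzero', hne, hB.ae_mem_frontier] with y hy hyx hyB
  have hpos := hB.npKernel_pos hxB hyB hyx
  have e : npKernel B x y * (|χ x * χ y| + χ x * χ y) = 0 := by
    rw [abs_mul]
    simp only [Pi.zero_apply] at hy
    linarith
  have := (mul_eq_zero.1 e).resolve_left hpos.ne'
  linarith [abs_nonneg (χ x * χ y)]

/-- Three real numbers cannot have pairwise opposite signs: the product of the three pairwise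
products is a square. -/
theorem eigenvalue_ne_neg_half (hχ : χ ≠ 0) : l ≠ -(1 / 2) := by
  intro hl
  have hae := hB.ae_mul_nonpos_of_eigenvalue h hl
  have hfreq : ∃ᶠ x in ae (surfaceMeasure B), χ x ≠ 0 := by
    intro hcon
    apply hχ
    rw [Lp.eq_zero_iff_ae_eq_zero]
    filter_upwards [hcon] with x hx
    simpa using hx
  obtain ⟨x, hx0, hx⟩ := (hfreq.and_eventually hae).exists
  obtain ⟨y, hy0, hy, hxy⟩ := (hfreq.and_eventually (hae.and hx)).exists
  obtain ⟨z, hz0, hz1, hz2⟩ := (hfreq.and_eventually (hx.and hy)).exists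
  have h1 : χ x * χ y < 0 := lt_of_le_of_ne hxy (mul_ne_zero hx0 hy0)
  have h2 : χ x * χ z < 0 := lt_of_le_of_ne hz1 (mul_ne_zero hx0 hz0)
  have h3 : χ y * χ z < 0 := lt_of_le_of_ne hz2 (mul_ne_zero hy0 hz0)
  have h4 := mul_pos_of_neg_of_neg h1 h2
  nlinarith [sq_nonneg (χ x)]

omit h in
/-- The eigenvalues of `K_B^*` lie in `(-1/2, 1/2]`. -/
theorem eigenvalue_mem {l : ℝ} {φ : HNegHalf B} (h : IsNormalisedEigenpair B l φ) :
    -(1 / 2) < l ∧ l ≤ 1 / 2 := by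
  rcases eq_or_ne l 0 with rfl | hl
  · norm_num
  have hφ : φ ≠ 0 := by
    rintro rfl
    have := h.2
    simp [hstarInner] at this
  obtain ⟨χ, hχ, h1⟩ := hB.exists_L2_eigenfunction hl hφ h.1
  have h2 := abs_le.1 (hB.abs_eigenvalue_le h1 hχ)
  exact ⟨lt_of_le_of_ne h2.1 (hB.eigenvalue_ne_neg_half h1 hχ).symm, h2.2⟩

end IsReferenceParticle

/-! ### The dispersion relation -/

theorem lightSpeed_pos {εm μm : ℝ} (h1 : 0 < εm) (h2 : 0 < μm) : 0 < lightSpeed εm μm :=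
  one_div_pos.2 (Real.sqrt_pos.2 (mul_pos h1 h2))

/-- The dispersion relation in the rescaled frequency `w = Ω δ / c`, with `P = ω_p δ / c` and
`g = δ / (c T)`. -/
def Dispersion (ε₀ εm l a P g : ℝ) (w : ℂ) : Prop :=
  (w ^ 2 + Complex.I * g * w) * (ε₀ * (l + 1 / 2 - a * w ^ 2) + εm * (1 / 2 - l + a * w ^ 2)) =
    ε₀ * P ^ 2 * (l + 1 / 2 - a * w ^ 2)

theorem drude_eq {ε₀ ωp T : ℝ} {Ω : ℂ} (hD : drudeDenom T Ω ≠ 0) :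
    drude ε₀ ωp T Ω * drudeDenom T Ω = ε₀ * (drudeDenom T Ω - ωp ^ 2) := by
  rw [drude]
  field_simp

theorem tau_add_eq_zero_iff {εm l a : ℝ} {e W : ℂ} (hm : (εm : ℂ) ≠ 0) (he : e ≠ 0)
    (hem : e ≠ εm) :
    tau εm e l + W * ((εm - e) / (εm * e) * a) = 0 ↔
      e * (l + 1 / 2 - a * W) + εm * (1 / 2 - l + a * W) = 0 := by
  have h : (εm : ℂ) - e ≠ 0 := sub_ne_zero.2 hem.symm
  have key : tau εm e l + W * ((εm - e) / (εm * e) * a) =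
      (e * (l + 1 / 2 - a * W) + εm * (1 / 2 - l + a * W)) / (εm * e) := by
    rw [tau, contrast]
    field_simp
    ring
  rw [key, div_eq_zero_iff, or_iff_left (mul_ne_zero hm he)]

theorem isCorrectedResonance_iff {B : Set E3} {ε₀ εm μm ωp T δ l : ℝ} {φ : HNegHalf B} {Ω : ℂ}
    (hm : 0 < εm) (hμ : 0 < μm) (hδ : 0 < δ) (hD : drudeDenom T Ω ≠ 0)
    (he : drude ε₀ ωp T Ω ≠ 0) (hem : drude ε₀ ωp T Ω ≠ εm) :
    IsCorrectedResonance B ε₀ εm μm ωp T δ l φ Ω ↔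
      Dispersion ε₀ εm l (alpha B φ) (ωp * δ / lightSpeed εm μm) (T⁻¹ * δ / lightSpeed εm μm)
        (Ω * δ / lightSpeed εm μm) := by
  have hc := lightSpeed_pos hm hμ
  have hc' : (lightSpeed εm μm : ℂ) ≠ 0 := by exact_mod_cast hc.ne'
  have hδ' : (δ : ℂ) ≠ 0 := by exact_mod_cast hδ.ne'
  have hm' : (εm : ℂ) ≠ 0 := by exact_mod_cast hm.ne'
  rw [IsCorrectedResonance, norm_eq_zero, tauTwo, tau_add_eq_zero_iff hm' he hem]
  set W : ℂ := (Ω * δ / lightSpeed εm μm) ^ 2 with hW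
  set a := alpha B φ
  set u : ℂ := l + 1 / 2 - a * W
  set v : ℂ := 1 / 2 - l + a * W
  have h1 := drude_eq (ε₀ := ε₀) (ωp := ωp) hD
  set D := drudeDenom T Ω with hDdef
  have h2 : (Ω * δ / lightSpeed εm μm) ^ 2 + Complex.I * ((T⁻¹ * δ / lightSpeed εm μm : ℝ) : ℂ) *
      (Ω * δ / lightSpeed εm μm) = D * (δ / lightSpeed εm μm) ^ 2 := by
    rw [hDdef, drudeDenom]
    push_cast
    ring
  have h3 : (((ωp * δ / lightSpeed εm μm : ℝ) : ℂ)) ^ 2 =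
      ωp ^ 2 * (δ / lightSpeed εm μm) ^ 2 := by
    push_cast
    ring
  rw [Dispersion, h2, h3]
  have hq : ((δ : ℂ) / lightSpeed εm μm) ^ 2 ≠ 0 := pow_ne_zero 2 (div_ne_zero hδ' hc')
  constructor
  · rintro ⟨-, -, -, h⟩
    linear_combination (D * h - u * h1) * (δ / lightSpeed εm μm) ^ 2
  · intro h
    refine ⟨hD, he, hem, ?_⟩
    have h4 : (δ / lightSpeed εm μm) ^ 2 * (D * (drude ε₀ ωp T Ω * u + εm * v)) = 0 := by
      linear_combination h + u * h1 * (δ / lightSpeed εm μm) ^ 2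
    exact (mul_eq_zero.1 ((mul_eq_zero.1 h4).resolve_left hq)).resolve_left hD

theorem norm_mul_sq_lt {a x η : ℝ} {w : ℂ} (h : |a| * η ^ 2 < x) (hw : ‖w‖ < η) :
    ‖(a : ℂ) * w ^ 2‖ < x := by
  rw [norm_mul, norm_pow, Complex.norm_real, Real.norm_eq_abs]
  refine lt_of_le_of_lt ?_ h
  gcongr

/-- At low frequency, the exceptional values of the permittivity do not occur on the dispersion
curve. -/
theorem isCorrectedResonance_of_dispersion {B : Set E3} {ε₀ εm μm ωp T δ l η : ℝ} {φ : HNegHalf B}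
    {Ω : ℂ} (h0 : 0 < ε₀) (hm : 0 < εm) (hμ : 0 < μm) (hω : 0 < ωp) (hδ : 0 < δ)
    (h1 : |alpha B φ| * η ^ 2 < l + 1 / 2) (h2 : |alpha B φ| * η ^ 2 < 1 / 2 - l)
    (hΩ : ‖Ω * δ / lightSpeed εm μm‖ < η)
    (h : Dispersion ε₀ εm l (alpha B φ) (ωp * δ / lightSpeed εm μm) (T⁻¹ * δ / lightSpeed εm μm)
        (Ω * δ / lightSpeed εm μm)) :
    IsCorrectedResonance B ε₀ εm μm ωp T δ l φ Ω := by
  have hc := lightSpeed_pos hm hμ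
  have hc' : (lightSpeed εm μm : ℂ) ≠ 0 := by exact_mod_cast hc.ne'
  have hδ' : (δ : ℂ) ≠ 0 := by exact_mod_cast hδ.ne'
  have hm' : (εm : ℂ) ≠ 0 := by exact_mod_cast hm.ne'
  have h0' : (ε₀ : ℂ) ≠ 0 := by exact_mod_cast h0.ne'
  have hω' : (ωp : ℂ) ≠ 0 := by exact_mod_cast hω.ne'
  have hq : ((δ : ℂ) / lightSpeed εm μm) ^ 2 ≠ 0 := pow_ne_zero 2 (div_ne_zero hδ' hc')
  have hW1 := norm_mul_sq_lt h1 hΩ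
  have hW2 := norm_mul_sq_lt h2 hΩ
  set w : ℂ := Ω * δ / lightSpeed εm μm with hw
  set a := alpha B φ
  -- The smallness of `w` keeps both coefficients `u = l + 1/2 - a w²` and `v = 1/2 - l + a w²` away
  -- from zero.
  have hu : (l : ℂ) + 1 / 2 - a * w ^ 2 ≠ 0 := by
    intro e
    have e' : (a : ℂ) * w ^ 2 = ((l + 1 / 2 : ℝ) : ℂ) := by
      push_cast
      linear_combination -e
    rw [e', Complex.norm_real, Real.norm_eq_abs] at hW1
    exact absurd hW1 (not_lt.2 (le_abs_self _))
  have hv : 1 / 2 - (l : ℂ) + a * w ^ 2 ≠ 0 := by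
    intro e
    have e' : (a : ℂ) * w ^ 2 = -((1 / 2 - l : ℝ) : ℂ) := by
      push_cast
      linear_combination e
    rw [e', norm_neg, Complex.norm_real, Real.norm_eq_abs] at hW2
    exact absurd hW2 (not_lt.2 (le_abs_self _))
  have h' := h
  rw [Dispersion] at h
  have h3 : w ^ 2 + Complex.I * ((T⁻¹ * δ / lightSpeed εm μm : ℝ) : ℂ) * w =
      drudeDenom T Ω * (δ / lightSpeed εm μm) ^ 2 := by
    rw [hw, drudeDenom]
    push_cast
    ring
  have h4 : (((ωp * δ / lightSpeed εm μm : ℝ) : ℂ)) ^ 2 =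
      ωp ^ 2 * (δ / lightSpeed εm μm) ^ 2 := by
    push_cast
    ring
  rw [h3, h4] at h
  have h5 : drudeDenom T Ω * (ε₀ * (l + 1 / 2 - a * w ^ 2) + εm * (1 / 2 - l + a * w ^ 2)) =
      ε₀ * ωp ^ 2 * (l + 1 / 2 - a * w ^ 2) := by
    refine mul_left_cancel₀ hq ?_
    linear_combination h
  have hD : drudeDenom T Ω ≠ 0 := by
    intro e
    rw [e, zero_mul] at h5
    exact mul_ne_zero (mul_ne_zero h0' (pow_ne_zero 2 hω')) hu h5.symm
  have he := drude_eq (ε₀ := ε₀) (ωp := ωp) hD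
  -- This reads `ε_c u = -ε_m v`. Then `ε_c = 0` would force `v = 0`, and `ε_c = ε_m` would force `u
  -- + v = 0`, whereas `u + v = 1`.
  have h6 : drude ε₀ ωp T Ω * (l + 1 / 2 - a * w ^ 2) = -(εm * (1 / 2 - l + a * w ^ 2)) := by
    refine mul_left_cancel₀ hD ?_
    linear_combination h5 + (l + 1 / 2 - a * w ^ 2) * he
  refine (isCorrectedResonance_iff hm hμ hδ hD ?_ ?_).2 h'
  · intro e
    rw [e, zero_mul] at h6
    exact mul_ne_zero hm' hv (neg_eq_zero.1 h6.symm)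
  · intro e
    rw [e] at h6
    exact hm' (by linear_combination h6)

theorem IsCorrectedResonance.dispersion {B : Set E3} {ε₀ εm μm ωp T δ l : ℝ} {φ : HNegHalf B}
    {Ω : ℂ} (hm : 0 < εm) (hμ : 0 < μm) (hδ : 0 < δ)
    (h : IsCorrectedResonance B ε₀ εm μm ωp T δ l φ Ω) :
    Dispersion ε₀ εm l (alpha B φ) (ωp * δ / lightSpeed εm μm) (T⁻¹ * δ / lightSpeed εm μm)
      (Ω * δ / lightSpeed εm μm) :=
  (isCorrectedResonance_iff hm hμ hδ h.1 h.2.1 h.2.2.1).1 h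

/-! ### Roots of the dispersion relation -/

theorem mul_eq_iff_re_im {a b c d e f : ℝ}
    (h : ((a : ℂ) + b * Complex.I) * (c + d * Complex.I) = e + f * Complex.I) :
    a * c - b * d = e ∧ a * d + b * c = f := by
  constructor
  · simpa using congrArg Complex.re h
  · simpa using congrArg Complex.im h

theorem Dispersion.re_im {ε₀ εm l a P g : ℝ} {w : ℂ} (h : Dispersion ε₀ εm l a P g w) {X Y : ℝ}
    (hX : X = w.re ^ 2 - w.im ^ 2) (hY : Y = 2 * w.re * w.im) :
    (X - g * w.im) * (ε₀ * (l + 1 / 2) + εm * (1 / 2 - l) + (εm - ε₀) * a * X) -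
        (Y + g * w.re) * ((εm - ε₀) * a * Y) = ε₀ * P ^ 2 * (l + 1 / 2 - a * X) ∧
      (X - g * w.im) * ((εm - ε₀) * a * Y) +
        (Y + g * w.re) * (ε₀ * (l + 1 / 2) + εm * (1 / 2 - l) + (εm - ε₀) * a * X) =
        -(ε₀ * P ^ 2 * (a * Y)) := by
  have ew : w = w.re + w.im * Complex.I := (Complex.re_add_im w).symm
  have ew2 : w ^ 2 = (X : ℂ) + Y * Complex.I := by
    conv_lhs => rw [ew]
    rw [hX, hY]
    push_cast
    linear_combination (w.im : ℂ) ^ 2 * Complex.I_sq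
  refine mul_eq_iff_re_im ?_
  rw [Dispersion, ew2] at h
  push_cast
  linear_combination h + (ε₀ * (l + 1 / 2 - a * (X + Y * Complex.I)) +
    εm * (1 / 2 - l + a * (X + Y * Complex.I))) * (-Complex.I * g * ew - g * w.im * Complex.I_sq)

/-- Multiplying the relation by the conjugate of `F = A + β w²` gives, in the imaginary part, `(Y +
gx) |F|² = -t c Y`. For `x ≠ 0` one divides by `x`: `(2y + g) |F|² = -2 t c y ≤ 2y |F|²`, impossible
with `g > 0`. For `x = 0` the real part of the left side is nonpositive and that of the right side
positive. -/
theorem not_dispersion_of_im_nonneg {x y X Y A β a b t c g : ℝ} (hX : X = x ^ 2 - y ^ 2)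
    (hY : Y = 2 * x * y) (hc : a * A + β * b = c) (hA : 0 < A) (ht : 0 < t) (hg : 0 < g)
    (hy : 0 ≤ y) (hF : A / 2 ≤ A + β * X) (hG : 0 < b - a * X)
    (htc : t * |c| ≤ A ^ 2 / 4)
    (hre : (X - g * y) * (A + β * X) - (Y + g * x) * (β * Y) = t * (b - a * X))
    (him : (X - g * y) * (β * Y) + (Y + g * x) * (A + β * X) = -(t * (a * Y))) : False := by
  obtain ⟨Q, hQ⟩ : ∃ Q, Q = (A + β * X) ^ 2 + (β * Y) ^ 2 := ⟨_, rfl⟩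
  have hQA : A ^ 2 / 4 ≤ Q := by
    have : (A / 2) ^ 2 ≤ (A + β * X) ^ 2 := pow_le_pow_left₀ (by positivity) hF 2
    linarith [sq_nonneg (β * Y)]
  have hcross : (Y + g * x) * Q = -(t * c * Y) := by
    rw [← hc, hQ]
    linear_combination (A + β * X) * him - (β * Y) * hre
  rcases eq_or_ne x 0 with hx | hx
  · have hY0 : Y = 0 := by rw [hY, hx]; ring
    have hXn : X - g * y ≤ 0 := by
      rw [hX, hx]
      have := mul_nonneg hg.le hy
      linarith [sq_nonneg y]
    rw [hY0] at hre
    have h5 : 0 < t * (b - a * X) := mul_pos ht hG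
    have h6 : (X - g * y) * (A + β * X) ≤ 0 :=
      mul_nonpos_of_nonpos_of_nonneg hXn (by linarith)
    linarith
  · have h4 : (2 * y + g) * Q = -(t * c) * (2 * y) := by
      refine mul_left_cancel₀ hx ?_
      rw [hY] at hcross
      linear_combination hcross
    have h5 : -(t * c) ≤ Q := by
      have h6 : t * (-c) ≤ t * |c| := mul_le_mul_of_nonneg_left (neg_le_abs c) ht.le
      linarith
    have hQ0 : 0 < Q := lt_of_lt_of_le (by positivity) hQA
    have h7 := mul_le_mul_of_nonneg_right h5 (by linarith : 0 ≤ 2 * y)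
    have h8 := mul_pos hg hQ0
    linarith

/-- A low-frequency solution of the dispersion relation lies in the lower half-plane. -/
theorem im_neg_of_dispersion {ε₀ εm l a P g η : ℝ} {w : ℂ} (h0 : 0 < ε₀) (hm : 0 < εm)
    (hl : 0 < l + 1 / 2) (hl' : 0 < 1 / 2 - l) (hP : 0 < P) (hg : 0 < g)
    (h1 : |a| * η ^ 2 < l + 1 / 2)
    (h2 : |(εm - ε₀) * a| * η ^ 2 < (ε₀ * (l + 1 / 2) + εm * (1 / 2 - l)) / 2)
    (h3 : ε₀ * P ^ 2 * |a * εm| ≤ (ε₀ * (l + 1 / 2) + εm * (1 / 2 - l)) ^ 2 / 4)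
    (hw : ‖w‖ < η) (h : Dispersion ε₀ εm l a P g w) : w.im < 0 := by
  by_contra! hy
  have hw2 : w.re ^ 2 + w.im ^ 2 ≤ η ^ 2 := by
    have e : ‖w‖ ^ 2 = w.re ^ 2 + w.im ^ 2 := by
      rw [Complex.sq_norm, Complex.normSq_apply]; ring
    rw [← e]
    exact pow_le_pow_left₀ (norm_nonneg _) hw.le 2
  obtain ⟨X, hX⟩ : ∃ X, X = w.re ^ 2 - w.im ^ 2 := ⟨_, rfl⟩
  obtain ⟨Y, hY⟩ : ∃ Y, Y = 2 * w.re * w.im := ⟨_, rfl⟩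
  obtain ⟨hre, him⟩ := h.re_im hX hY
  have hXle : |X| ≤ η ^ 2 := by
    rw [hX]
    exact abs_le.2 ⟨by linarith [sq_nonneg w.re], by linarith [sq_nonneg w.im]⟩
  have hβX := (mul_le_mul_of_nonneg_left hXle (abs_nonneg ((εm - ε₀) * a))).trans h2.le
  have haX := (mul_le_mul_of_nonneg_left hXle (abs_nonneg a)).trans_lt h1
  rw [← abs_mul] at hβX haX
  -- With these coefficients `a A + β b` simplifies to `a ε_m`.
  refine not_dispersion_of_im_nonneg (c := a * εm) hX hY (by ring) (by positivity) (by positivity)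
    hg hy ?_ ?_ h3 hre him
  · linarith [neg_abs_le ((εm - ε₀) * a * X)]
  · linarith [le_abs_self (a * X)]

/-- A low-frequency solution of the dispersion relation is at most of the order of
`max g P`. -/
theorem norm_le_of_dispersion {ε₀ εm l a P g η : ℝ} {w : ℂ} (h0 : 0 < ε₀) (hm : 0 < εm)
    (hl : 0 < l + 1 / 2) (hl' : 0 < 1 / 2 - l) (hP : 0 < P) (hg : 0 < g)
    (h1 : |a| * η ^ 2 < l + 1 / 2)
    (h2 : |(εm - ε₀) * a| * η ^ 2 < (ε₀ * (l + 1 / 2) + εm * (1 / 2 - l)) / 2)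
    (hw : ‖w‖ < η) (h : Dispersion ε₀ εm l a P g w) :
    ‖w‖ ≤ (1 + 4 * ε₀ * (l + 1 / 2) / (ε₀ * (l + 1 / 2) + εm * (1 / 2 - l))) * max g P := by
  set b := l + 1 / 2 with hb
  set A := ε₀ * b + εm * (1 / 2 - l) with hA
  have hA0 : 0 < A := by positivity
  set m := max g P with hm'
  have hm0 : 0 < m := lt_max_of_lt_left hg
  have eF : (ε₀ : ℂ) * (l + 1 / 2 - a * w ^ 2) + εm * (1 / 2 - l + a * w ^ 2) =
      (A : ℂ) + ((((εm - ε₀) * a : ℝ) : ℂ)) * w ^ 2 := by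
    rw [hA, hb]; push_cast; ring
  have eG : (l : ℂ) + 1 / 2 - a * w ^ 2 = (b : ℂ) - a * w ^ 2 := by rw [hb]; push_cast; ring
  rw [Dispersion, eF, eG] at h
  have hF : A / 2 ≤ ‖(A : ℂ) + ((((εm - ε₀) * a : ℝ) : ℂ)) * w ^ 2‖ := by
    have := norm_mul_sq_lt h2 hw
    have h4 := norm_sub_le_norm_add (A : ℂ) ((((εm - ε₀) * a : ℝ) : ℂ) * w ^ 2)
    rw [Complex.norm_real, Real.norm_of_nonneg hA0.le] at h4
    linarith
  have hG : ‖(b : ℂ) - a * w ^ 2‖ ≤ 2 * b := by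
    have := norm_mul_sq_lt h1 hw
    have h4 := norm_sub_le (b : ℂ) (a * w ^ 2)
    rw [Complex.norm_real, Real.norm_of_nonneg hl.le] at h4
    linarith
  have hn := congrArg norm h
  rw [norm_mul, norm_mul, norm_mul, norm_pow, Complex.norm_real, Complex.norm_real,
    Real.norm_of_nonneg h0.le, Real.norm_of_nonneg hP.le] at hn
  have hN : ‖w‖ ^ 2 - g * ‖w‖ ≤ ‖w ^ 2 + Complex.I * g * w‖ := by
    have := norm_sub_le_norm_add (w ^ 2) (Complex.I * g * w)
    rwa [norm_pow, norm_mul, norm_mul, Complex.norm_I, one_mul, Complex.norm_real,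
      Real.norm_of_nonneg hg.le] at this
  have h5 : ‖w ^ 2 + Complex.I * g * w‖ * (A / 2) ≤ ε₀ * P ^ 2 * (2 * b) := by
    calc _ ≤ ‖w ^ 2 + Complex.I * g * w‖ * ‖(A : ℂ) + ((((εm - ε₀) * a : ℝ) : ℂ)) * w ^ 2‖ := by
          gcongr
      _ = _ := hn
      _ ≤ _ := by gcongr
  have hPm : P ≤ m := le_max_right _ _
  have hgm : g ≤ m := le_max_left _ _
  -- From `‖F‖ ≥ A/2` and `‖u‖ ≤ 2b`; then `‖w‖² ≤ m ‖w‖ + H m²` forces `‖w‖ ≤ (1 + H) m`.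
  set H := 4 * ε₀ * b / A with hH
  have hH0 : 0 ≤ H := by positivity
  have h6 : ‖w‖ ^ 2 - g * ‖w‖ ≤ H * m ^ 2 := by
    have h7 : ‖w ^ 2 + Complex.I * g * w‖ ≤ H * P ^ 2 := by
      rw [hH, div_mul_eq_mul_div, le_div_iff₀ hA0]
      linarith
    have h8 : H * P ^ 2 ≤ H * m ^ 2 := by gcongr
    linarith
  by_contra! hcon
  have h9 : m ≤ ‖w‖ := by nlinarith
  have h10 : (1 + H) * m * ‖w‖ < ‖w‖ * ‖w‖ :=
    mul_lt_mul_of_pos_right hcon (lt_of_lt_of_le hm0 h9)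
  nlinarith [mul_le_mul_of_nonneg_left h9 (mul_nonneg hH0 hm0.le),
    mul_le_mul_of_nonneg_right hgm (norm_nonneg w)]

/-- The quartic dispersion polynomial splits off a real quadratic factor with small coefficients,
by the open mapping property of the multiplication of polynomials. -/
theorem exists_quadratic_factor {A β a b η : ℝ} (hA : 0 < A) (hη : 0 < η) :
    ∃ κ > 0, ∀ g t : ℝ, |g| < κ → |t| < κ → ∃ p q : ℝ, |p| < η / 2 ∧ |q| < η ^ 2 / 2 ∧
      A / 2 < A + t * a + β * q - β * p * (p - g) ∧ |β * (p - g)| * η < A / 4 ∧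
      p * (A + t * a + β * q - β * p * (p - g)) + q * (β * (p - g)) = g * A ∧
      q * (A + t * a + β * q - β * p * (p - g)) = t * b := by
  -- The target is `(w² + igw)(A + βw²) - t(b - aw²) = (w² + ipw - q)(βw² - irw + s)`. The `w³` and
  -- `w²` coefficients determine `r` and `s`; the `w` and constant coefficients are the two
  -- equations in `F`. The parameters `g`, `t` are kept as components, so one local surjectivity
  -- statement covers all small parameters.
  let r : ℝ × ℝ × ℝ × ℝ → ℝ := fun z => β * (z.1 - z.2.2.1)
  let s : ℝ × ℝ × ℝ × ℝ → ℝ := fun z => A + z.2.2.2 * a + β * z.2.1 - β * z.1 * (z.1 - z.2.2.1)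
  let F : ℝ × ℝ × ℝ × ℝ → ℝ × ℝ × ℝ × ℝ := fun z =>
    (z.1 * s z + z.2.1 * r z - z.2.2.1 * A, z.2.1 * s z - z.2.2.2 * b, z.2.2.1, z.2.2.2)
  have hp : HasStrictFDerivAt (fun z : ℝ × ℝ × ℝ × ℝ => z.1) (ContinuousLinearMap.fst ℝ ℝ (ℝ × ℝ × ℝ)) 0 :=
    hasStrictFDerivAt_fst
  have h2 : HasStrictFDerivAt (fun z : ℝ × ℝ × ℝ × ℝ => z.2) (ContinuousLinearMap.snd ℝ ℝ (ℝ × ℝ × ℝ)) 0 :=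
    hasStrictFDerivAt_snd
  have hq := h2.fst
  have hg := h2.snd.fst
  have ht := h2.snd.snd
  have hr : HasStrictFDerivAt r _ 0 := (hp.sub hg).const_mul β
  have hs : HasStrictFDerivAt s _ 0 :=
    (((ht.mul_const a).const_add A).add (hq.const_mul β)).sub ((hp.const_mul β).mul (hp.sub hg))
  have hF : HasStrictFDerivAt F _ 0 :=
    (((hp.mul hs).add (hq.mul hr)).sub (hg.mul_const A)).prodMk
      (((hq.mul hs).sub (ht.mul_const b)).prodMk (hg.prodMk ht))
  -- At the origin `s = A` and `r = 0`, so the derivative is triangular with diagonal `A, A, 1, 1`.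
  have hsurj := hF.map_nhds_eq_of_surj (by
    rw [LinearMap.range_eq_top]
    rintro ⟨x1, x2, x3, x4⟩
    refine ⟨(A⁻¹ * (x1 + A * x3), A⁻¹ * (x2 + b * x4), x3, x4), ?_⟩
    simp [r, s]
    constructor <;> field_simp <;> ring)
  have hF0 : F 0 = 0 := by simp [F, r, s]
  rw [hF0] at hsurj
  have hU : ∀ᶠ z : ℝ × ℝ × ℝ × ℝ in 𝓝 0, |z.1| < η / 2 ∧ |z.2.1| < η ^ 2 / 2 ∧ A / 2 < s z ∧
      |r z| * η < A / 4 := by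
    have hsc : Continuous s := by fun_prop
    have hrc : Continuous r := by fun_prop
    refine (Continuous.tendsto (by fun_prop : Continuous fun z : ℝ × ℝ × ℝ × ℝ => |z.1|) 0).eventually
      (gt_mem_nhds (by simp; positivity)) |>.and <|
      ((Continuous.tendsto (by fun_prop : Continuous fun z : ℝ × ℝ × ℝ × ℝ => |z.2.1|) 0).eventually
      (gt_mem_nhds (by simp; positivity))).and <| ((hsc.tendsto 0).eventually
      (lt_mem_nhds (by simp [s]; positivity))).and <|
      (Continuous.tendsto (by fun_prop : Continuous fun z : ℝ × ℝ × ℝ × ℝ => |r z| * η) 0).eventually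
      (gt_mem_nhds (by simp [r]; positivity))
  have hI : ∀ᶠ y : ℝ × ℝ × ℝ × ℝ in 𝓝 0, ∃ z : ℝ × ℝ × ℝ × ℝ, F z = y ∧ |z.1| < η / 2 ∧ |z.2.1| < η ^ 2 / 2 ∧
      A / 2 < s z ∧ |r z| * η < A / 4 := by
    rw [← hsurj, eventually_map]
    filter_upwards [hU] with z hz
    exact ⟨z, rfl, hz⟩
  have hc : Tendsto (fun y : ℝ × ℝ => ((0, 0, y.1, y.2) : ℝ × ℝ × ℝ × ℝ)) (𝓝 0) (𝓝 0) :=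
    Continuous.tendsto (by fun_prop : Continuous fun y : ℝ × ℝ => ((0, 0, y.1, y.2) : ℝ × ℝ × ℝ × ℝ)) 0
  obtain ⟨κ, hκ, hball⟩ := Metric.eventually_nhds_iff.1 (hc.eventually hI)
  refine ⟨κ, hκ, fun g t hgκ htκ => ?_⟩
  obtain ⟨⟨p, q, g', t'⟩, hz, h3, h4, h5, h6⟩ := hball (y := (g, t)) (by
    rw [Prod.dist_eq]
    simpa using ⟨hgκ, htκ⟩)
  simp only [F, Prod.mk.injEq] at hz
  obtain ⟨e1, e2, rfl, rfl⟩ := hz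
  simp only [s, r] at e1 e2 h5 h6
  exact ⟨p, q, h3, h4, h5, h6, by linarith, by linarith⟩

theorem exists_sq_eq (x : ℝ) : ∃ z : ℂ, (z.im = 0 ∨ z.re = 0) ∧ z ^ 2 = x := by
  rcases le_total 0 x with h | h
  · refine ⟨(√x : ℝ), Or.inl (Complex.ofReal_im _), ?_⟩
    rw [← Complex.ofReal_pow, Real.sq_sqrt h]
  · refine ⟨Complex.I * (√(-x) : ℝ), Or.inr (by simp), ?_⟩
    rw [mul_pow, Complex.I_sq, ← Complex.ofReal_pow, Real.sq_sqrt (by linarith)]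
    push_cast
    ring

/-- The low-frequency solutions of the dispersion relation form a pair `±w' + i w''`. -/
theorem exists_dispersion_pair {ε₀ εm l a η : ℝ} (h0 : 0 < ε₀) (hm : 0 < εm)
    (hl : 0 < l + 1 / 2) (hl' : 0 < 1 / 2 - l) (hη : 0 < η)
    (h2 : |(εm - ε₀) * a| * η ^ 2 < (ε₀ * (l + 1 / 2) + εm * (1 / 2 - l)) / 4) :
    ∃ κ > 0, ∀ g P : ℝ, |g| < κ → ε₀ * P ^ 2 < κ → ∃ (w' : ℂ) (w'' : ℝ),
      (w'.im = 0 ∨ w'.re = 0) ∧ ∀ w : ℂ, (Dispersion ε₀ εm l a P g w ∧ ‖w‖ < η ↔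
        w = w' + Complex.I * w'' ∨ w = -w' + Complex.I * w'') := by
  set b := l + 1 / 2 with hb
  set A := ε₀ * b + εm * (1 / 2 - l) with hA
  have hA0 : 0 < A := by positivity
  set β := (εm - ε₀) * a with hβ
  obtain ⟨κ, hκ, h⟩ := exists_quadratic_factor (A := A) (β := β) (a := a) (b := b) hA0 hη
  refine ⟨κ, hκ, fun g P hg hP => ?_⟩
  obtain ⟨p, q, hp, hq, hs, hr, e1, e2⟩ := h g (ε₀ * P ^ 2) hg
    (by rwa [abs_of_nonneg (by positivity)])
  set t := ε₀ * P ^ 2 with ht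
  set r := β * (p - g) with hrdef
  set s := A + t * a + β * q - β * p * (p - g) with hsdef
  obtain ⟨z, hz, hz2⟩ := exists_sq_eq (q - p ^ 2 / 4)
  refine ⟨z, -(p / 2), hz, fun w => ?_⟩
  have hroots : w = z + Complex.I * ((-(p / 2) : ℝ) : ℂ) ∨ w = -z + Complex.I * ((-(p / 2) : ℝ) : ℂ) ↔
      w ^ 2 + Complex.I * p * w - q = 0 := by
    have e : w ^ 2 + Complex.I * p * w - q = (w - (z + Complex.I * ((-(p / 2) : ℝ) : ℂ))) *
        (w - (-z + Complex.I * ((-(p / 2) : ℝ) : ℂ))) := by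
      push_cast at hz2 ⊢
      linear_combination hz2 - (p : ℂ) ^ 2 / 4 * Complex.I_sq
    rw [e, mul_eq_zero, sub_eq_zero, sub_eq_zero]
  have hfac : (w ^ 2 + Complex.I * g * w) *
      (ε₀ * (l + 1 / 2 - a * w ^ 2) + εm * (1 / 2 - l + a * w ^ 2)) -
        ε₀ * P ^ 2 * (l + 1 / 2 - a * w ^ 2) =
      (w ^ 2 + Complex.I * p * w - q) * (β * w ^ 2 - Complex.I * r * w + s) := by
    have e1' : (p : ℂ) * s + q * r = g * A := by exact_mod_cast e1
    have e2' : (q : ℂ) * s = t * b := by exact_mod_cast e2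
    have eA : (A : ℂ) = ε₀ * (l + 1 / 2) + εm * (1 / 2 - l) := by rw [hA, hb]; push_cast; ring
    have eβ : (β : ℂ) = (εm - ε₀) * a := by rw [hβ]; push_cast; ring
    have er : (r : ℂ) = β * (p - g) := by rw [hrdef]; push_cast; ring
    have es : (s : ℂ) = A + t * a + β * q - p * r := by rw [hsdef, hrdef]; push_cast; ring
    have eb : (b : ℂ) = l + 1 / 2 := by rw [hb]; push_cast; ring
    have et : (t : ℂ) = ε₀ * P ^ 2 := by rw [ht]; push_cast; ring
    have hL : (w ^ 2 + Complex.I * g * w) *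
        (ε₀ * (l + 1 / 2 - a * w ^ 2) + εm * (1 / 2 - l + a * w ^ 2)) -
          ε₀ * P ^ 2 * (l + 1 / 2 - a * w ^ 2) =
        (w ^ 2 + Complex.I * g * w) * (A + β * w ^ 2) - t * (b - a * w ^ 2) := by
      rw [eA, eβ, et, eb]; ring
    rw [hL]
    linear_combination Complex.I * w ^ 3 * er - w ^ 2 * es + p * r * w ^ 2 * Complex.I_sq -
      Complex.I * w * e1' + e2'
  rw [hroots]
  -- In the disc the cofactor cannot vanish: its constant term exceeds `A/2`, the other two terms
  -- are each below `A/4`.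
  have hs0 : ‖w‖ < η → (β : ℂ) * w ^ 2 - Complex.I * r * w + s ≠ 0 := by
    intro hw e
    have h3 := norm_mul_sq_lt h2 hw
    have h4 : ‖Complex.I * r * w‖ < A / 4 := by
      rw [norm_mul, norm_mul, Complex.norm_I, one_mul, Complex.norm_real, Real.norm_eq_abs]
      exact lt_of_le_of_lt (mul_le_mul_of_nonneg_left hw.le (abs_nonneg _)) hr
    have h5 : (s : ℂ) = Complex.I * r * w - β * w ^ 2 := by linear_combination e
    have h6 := norm_sub_le (Complex.I * r * w) ((β : ℂ) * w ^ 2)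
    rw [← h5, Complex.norm_real, Real.norm_eq_abs] at h6
    linarith [le_abs_self s]
  rw [Dispersion, ← sub_eq_zero, hfac, mul_eq_zero]
  constructor
  · rintro ⟨h3, hw⟩
    exact h3.resolve_right (hs0 hw)
  · intro h3
    refine ⟨Or.inl h3, ?_⟩
    -- A root outside the disc would satisfy `‖w‖² ≤ |q| + |p| ‖w‖ < η²/2 + (η/2) ‖w‖ ≤ ‖w‖²`.
    by_contra! hw
    have h4 : w ^ 2 = q - Complex.I * p * w := by linear_combination h3
    have h5 := norm_sub_le (q : ℂ) (Complex.I * p * w)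
    rw [← h4, norm_pow, norm_mul, norm_mul, Complex.norm_I, one_mul, Complex.norm_real,
      Complex.norm_real, Real.norm_eq_abs, Real.norm_eq_abs] at h5
    have h6 : |p| * ‖w‖ ≤ η / 2 * ‖w‖ := by gcongr
    nlinarith

/-! ### The explicit resonances in vacuum -/

theorem omegaPrime_sq (c ωp T δ l a : ℝ) :
    omegaPrime c ωp T δ l a ^ 2 = radicand c ωp T δ l a := by
  have h := Complex.cpow_nat_inv_pow (radicand c ωp T δ l a : ℂ) (n := 2) two_ne_zero
  rw [omegaPrime, one_div]
  exact_mod_cast h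

theorem eq_omega_iff {c ωp T δ l a : ℝ} (hX : correction c ωp δ a ≠ 0) (Ω : ℂ) :
    (Ω = omegaPlus c ωp T δ l a ∨ Ω = omegaMinus c ωp T δ l a) ↔
      correction c ωp δ a * Ω ^ 2 + Complex.I * (T : ℂ)⁻¹ * Ω = ωp ^ 2 * (l + 1 / 2) := by
  have hX' : (correction c ωp δ a : ℂ) ≠ 0 := by exact_mod_cast hX
  have hsq := omegaPrime_sq c ωp T δ l a
  have e : correction c ωp δ a * Ω ^ 2 + Complex.I * (T : ℂ)⁻¹ * Ω - ωp ^ 2 * (l + 1 / 2) =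
      correction c ωp δ a * ((Ω - omegaPlus c ωp T δ l a) * (Ω - omegaMinus c ωp T δ l a)) := by
    have h1 : (Ω - omegaPlus c ωp T δ l a) * (Ω - omegaMinus c ωp T δ l a) =
        (Ω - Complex.I * omegaDoublePrime c ωp T δ a) ^ 2 - omegaPrime c ωp T δ l a ^ 2 := by
      rw [omegaPlus, omegaMinus]; ring
    rw [h1, hsq, radicand, omegaDoublePrime]
    push_cast
    set X : ℂ := (correction c ωp δ a : ℂ)
    have h2 : X * ((Ω - Complex.I * -((T : ℂ)⁻¹ / (2 * X))) ^ 2 -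
        (ωp ^ 2 * (l + 1 / 2) / X - (T : ℂ)⁻¹ ^ 2 / (4 * X ^ 2))) =
        X * Ω ^ 2 + Complex.I * (T : ℂ)⁻¹ * Ω - ωp ^ 2 * (l + 1 / 2) +
          (Complex.I ^ 2 + 1) * (T : ℂ)⁻¹ ^ 2 / (4 * X) := by
      field_simp
      ring
    rw [h2, Complex.I_sq]
    ring
  rw [← sub_eq_zero (b := (ωp : ℂ) ^ 2 * (l + 1 / 2)), e, mul_eq_zero, or_iff_right hX',
    mul_eq_zero, sub_eq_zero, sub_eq_zero]

theorem im_neg_of_quadratic {X g t : ℝ} {w : ℂ} (hX : 0 < X) (hg : 0 < g) (ht : 0 < t)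
    (h : X * w ^ 2 + Complex.I * g * w = t) : w.im < 0 := by
  by_contra! hy
  have hre : X * (w.re ^ 2 - w.im ^ 2) - g * w.im = t := by
    have := congrArg Complex.re h
    simp [sq] at this
    linarith
  have him : w.re * (2 * X * w.im + g) = 0 := by
    have := congrArg Complex.im h
    simp [sq] at this
    linarith
  have hx : w.re = 0 := (mul_eq_zero.1 him).resolve_right (by positivity)
  rw [hx] at hre
  have h1 := mul_nonneg hg.le hy
  have h2 := mul_nonneg hX.le (sq_nonneg w.im)
  linarith

theorem norm_sq_le_of_quadratic {X g t : ℝ} {w : ℂ} (hX : 0 < X) (hg : 0 < g) (ht : 0 < t)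
    (h : X * w ^ 2 + Complex.I * g * w = t) : X * ‖w‖ ^ 2 ≤ g * ‖w‖ + t := by
  have e : (X : ℂ) * w ^ 2 = t - Complex.I * g * w := by linear_combination h
  have h1 := norm_sub_le (t : ℂ) (Complex.I * g * w)
  rwa [← e, norm_mul, norm_mul, norm_mul, norm_pow, Complex.norm_I, one_mul, Complex.norm_real,
    Complex.norm_real, Complex.norm_real, Real.norm_of_nonneg hX.le, Real.norm_of_nonneg hg.le,
    Real.norm_of_nonneg ht.le, add_comm] at h1

/-- The maximum `m` is chosen so that `g ≤ X m` and `p² b ≤ X m²`. The triangle inequality becomes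
`‖w‖² ≤ m ‖w‖ + m²`, which bounds `‖w‖` by the golden ratio times `m`. -/
theorem norm_le_of_quadratic {X g p b : ℝ} {w : ℂ} (hX : 0 < X) (hg : 0 < g) (hp : 0 < p)
    (hb : 0 < b) (h : X * w ^ 2 + Complex.I * g * w = p ^ 2 * b) :
    ‖w‖ ≤ 2 * max (g / X) (p * √b / √X) := by
  have h1 := norm_sq_le_of_quadratic (t := p ^ 2 * b) hX hg (by positivity)
    (by push_cast; exact h)
  set m := max (g / X) (p * √b / √X) with hm
  have hm0 : 0 < m := lt_max_of_lt_left (by positivity)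
  have h2 : g ≤ X * m := by
    have := le_max_left (g / X) (p * √b / √X)
    rw [div_le_iff₀ hX] at this
    linarith
  have h3 : p ^ 2 * b ≤ X * m ^ 2 := by
    have h4 : p * √b / √X ≤ m := le_max_right _ _
    have h5 := pow_le_pow_left₀ (by positivity) h4 2
    rw [div_pow, mul_pow, Real.sq_sqrt hb.le, Real.sq_sqrt hX.le, div_le_iff₀ hX] at h5
    linarith
  have h6 : ‖w‖ ^ 2 ≤ m * ‖w‖ + m ^ 2 := by
    refine le_of_mul_le_mul_left ?_ hX
    have := mul_le_mul_of_nonneg_right h2 (norm_nonneg w)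
    linarith
  by_contra! hcon
  have h7 := mul_lt_mul_of_pos_right hcon (lt_trans (by positivity) hcon : 0 < ‖w‖)
  have h8 := mul_lt_mul_of_pos_left hcon hm0
  nlinarith

theorem omega_re_im {c ωp T δ l a : ℝ} (h : 0 ≤ radicand c ωp T δ l a) :
    (omegaPlus c ωp T δ l a).re = √(radicand c ωp T δ l a) ∧
    (omegaMinus c ωp T δ l a).re = -√(radicand c ωp T δ l a) ∧
    (omegaPlus c ωp T δ l a).im = omegaDoublePrime c ωp T δ a ∧
    (omegaMinus c ωp T δ l a).im = omegaDoublePrime c ωp T δ a := by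
  have e : omegaPrime c ωp T δ l a = (√(radicand c ωp T δ l a) : ℝ) := by
    rw [omegaPrime, Real.sqrt_eq_rpow, Complex.ofReal_cpow h]
    norm_num
  simp [omegaPlus, omegaMinus, e]

/-- For equal permittivities the two coefficients add up to one, so the quartic term disappears and
`α` only rescales the leading coefficient. -/
theorem dispersion_vacuum_iff {ε₀ ωp T δ l a c : ℝ} (h0 : 0 < ε₀) (hc : 0 < c) (hδ : 0 < δ)
    (Ω : ℂ) :
    Dispersion ε₀ ε₀ l a (ωp * δ / c) (T⁻¹ * δ / c) (Ω * δ / c) ↔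
      correction c ωp δ a * Ω ^ 2 + Complex.I * (T : ℂ)⁻¹ * Ω = ωp ^ 2 * (l + 1 / 2) := by
  have hc' : (c : ℂ) ≠ 0 := by exact_mod_cast hc.ne'
  have hδ' : (δ : ℂ) ≠ 0 := by exact_mod_cast hδ.ne'
  have h0' : (ε₀ : ℂ) ≠ 0 := by exact_mod_cast h0.ne'
  have hk : (ε₀ : ℂ) * (δ / c) ^ 2 ≠ 0 := mul_ne_zero h0' (pow_ne_zero 2 (div_ne_zero hδ' hc'))
  rw [Dispersion, correction]
  push_cast
  constructor
  · intro h
    refine mul_left_cancel₀ hk ?_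
    linear_combination h
  · intro h
    linear_combination (ε₀ : ℂ) * (δ / c) ^ 2 * h

/-! ### Smallness of the parameters -/

theorem eventually_mul_sq_lt (K : ℝ) {x : ℝ} (hx : 0 < x) :
    ∀ᶠ η : ℝ in 𝓝[>] 0, K * η ^ 2 < x := by
  have h : Tendsto (fun η : ℝ => K * η ^ 2) (𝓝 0) (𝓝 (K * 0 ^ 2)) :=
    Continuous.tendsto (by fun_prop) 0
  exact nhdsWithin_le_nhds (h.eventually (gt_mem_nhds (by simpa using hx)))

theorem norm_scaled {Ω : ℂ} {δ c : ℝ} (hδ : 0 < δ) (hc : 0 < c) :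
    ‖Ω * δ / c‖ = ‖Ω‖ * δ / c := by
  rw [norm_div, norm_mul, Complex.norm_real, Complex.norm_real, Real.norm_of_nonneg hδ.le,
    Real.norm_of_nonneg hc.le]

theorem im_scaled (Ω : ℂ) (δ c : ℝ) : (Ω * δ / c).im = Ω.im * δ / c := by
  rw [Complex.div_ofReal_im, Complex.im_mul_ofReal]

theorem scaled_eq_iff {Ω z : ℂ} {δ c : ℝ} (hδ : 0 < δ) (hc : 0 < c) :
    Ω * δ / c = z ↔ Ω = z * (c / δ : ℝ) := by
  have hc' : (c : ℂ) ≠ 0 := by exact_mod_cast hc.ne'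
  have hδ' : (δ : ℂ) ≠ 0 := by exact_mod_cast hδ.ne'
  push_cast
  rw [div_eq_iff hc', ← mul_div_assoc, eq_div_iff hδ']

/-! ### Assembly of the two cases, with constants uniform in the finitely many indices. -/

variable {B : Set E3} {J : ℕ} {lam : Fin J → ℝ} {φ : Fin J → HNegHalf B}

/-- The resonances in a general medium. -/
theorem resonances_general (h1 : ∀ j, 0 < lam j + 1 / 2) (h2 : ∀ j, 0 < 1 / 2 - lam j)
    {ε₀ εm : ℝ} (h0 : 0 < ε₀) (hm : 0 < εm) :
    ∃ κ > (0 : ℝ), ∃ η > (0 : ℝ), ∃ M > (0 : ℝ),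
      ∀ μm ωp T δ : ℝ, 0 < μm → 0 < ωp → 0 < T → 0 < δ →
        ωp * δ / lightSpeed εm μm < κ → ∀ j,
          (∀ Ω : ℂ, IsCorrectedResonance B ε₀ εm μm ωp T δ (lam j) (φ j) Ω →
            ‖Ω‖ * δ / lightSpeed εm μm < η →
            Ω.im < 0 ∧ ‖Ω‖ ≤ M * max T⁻¹ ωp) ∧
          (T⁻¹ * δ / lightSpeed εm μm < κ →
            ∃ (Ω' : ℂ) (Ω'' : ℝ), (Ω'.im = 0 ∨ Ω'.re = 0) ∧
              {Ω : ℂ | IsCorrectedResonance B ε₀ εm μm ωp T δ (lam j) (φ j) Ω ∧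
                ‖Ω‖ * δ / lightSpeed εm μm < η} =
              {Ω' + Complex.I * Ω'', -Ω' + Complex.I * Ω''}) := by
  set a : Fin J → ℝ := fun j => alpha B (φ j) with ha
  set A : Fin J → ℝ := fun j => ε₀ * (lam j + 1 / 2) + εm * (1 / 2 - lam j) with hA
  have hA0 : ∀ j, 0 < A j := fun j => by
    have := h1 j; have := h2 j; positivity
  -- The first two conditions keep the coefficients of `ε_c` and `ε_m` nonzero; the third keeps `A +
  -- β w²` near `A`, with a quarter of `A` to spare for the factorisation.
  obtain ⟨η, hη, hη0⟩ : ∃ η : ℝ, (∀ j, |a j| * η ^ 2 < lam j + 1 / 2 ∧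
      |a j| * η ^ 2 < 1 / 2 - lam j ∧ |(εm - ε₀) * a j| * η ^ 2 < A j / 4) ∧ 0 < η :=
    ((eventually_all.2 fun j => (eventually_mul_sq_lt _ (h1 j)).and
      ((eventually_mul_sq_lt _ (h2 j)).and (eventually_mul_sq_lt _ (by have := hA0 j; positivity :
        0 < A j / 4)))).and self_mem_nhdsWithin).exists
  choose κ₁ hκ₁ hpair using fun j =>
    exists_dispersion_pair h0 hm (h1 j) (h2 j) hη0 (hη j).2.2
  obtain ⟨κ, hκ, hκ0⟩ : ∃ κ : ℝ, (∀ j, ε₀ * |a j * εm| * κ ^ 2 < A j ^ 2 / 4 ∧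
      ε₀ * κ ^ 2 < κ₁ j ∧ κ < κ₁ j) ∧ 0 < κ :=
    ((eventually_all.2 fun j => (eventually_mul_sq_lt _ (by have := hA0 j; positivity :
      0 < A j ^ 2 / 4)).and ((eventually_mul_sq_lt _ (hκ₁ j)).and
        (nhdsWithin_le_nhds (gt_mem_nhds (hκ₁ j))))).and self_mem_nhdsWithin).exists
  obtain ⟨M, hM, hM0⟩ : ∃ M : ℝ, (∀ j, 1 + 4 * ε₀ * (lam j + 1 / 2) / A j ≤ M) ∧ 0 < M :=
    ((eventually_all.2 fun j => eventually_ge_atTop _).and (eventually_gt_atTop (0 : ℝ))).exists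
  refine ⟨κ, hκ0, η, hη0, M, hM0, fun μm ωp T δ hμ hω hT hδ hP j => ?_⟩
  have hc := lightSpeed_pos hm hμ
  set c := lightSpeed εm μm with hcdef
  have hP0 : 0 < ωp * δ / c := by positivity
  have hg0 : 0 < T⁻¹ * δ / c := by positivity
  have hP2 : (ωp * δ / c) ^ 2 ≤ κ ^ 2 := pow_le_pow_left₀ hP0.le hP.le 2
  obtain ⟨b1, b2, b3⟩ := hη j
  have b3' : |(εm - ε₀) * a j| * η ^ 2 < A j / 2 := by linarith [hA0 j]
  refine ⟨fun Ω hΩ hsmall => ?_, fun hg => ?_⟩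
  · have hd := hΩ.dispersion hm hμ hδ
    rw [← norm_scaled hδ hc] at hsmall
    have him := im_neg_of_dispersion h0 hm (h1 j) (h2 j) hP0 hg0 b1 b3' (by
      have h3 : ε₀ * (ωp * δ / c) ^ 2 * |a j * εm| ≤ ε₀ * κ ^ 2 * |a j * εm| := by gcongr
      exact h3.trans ((mul_right_comm _ _ _).trans_le (hκ j).1.le)) hsmall hd
    have hn := norm_le_of_dispersion h0 hm (h1 j) (h2 j) hP0 hg0 b1 b3' hsmall hd
    rw [im_scaled] at him
    rw [norm_scaled hδ hc] at hn
    constructor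
    · by_contra! hcon
      exact absurd him (not_lt.2 (by positivity))
    · have e : max (T⁻¹ * δ / c) (ωp * δ / c) = max T⁻¹ ωp * (δ / c) := by
        rw [mul_div_assoc, mul_div_assoc, max_mul_of_nonneg _ _ (by positivity)]
      rw [e, mul_div_assoc, ← mul_assoc] at hn
      refine (le_of_mul_le_mul_right hn (by positivity)).trans ?_
      have : 0 ≤ max T⁻¹ ωp := le_max_of_le_right hω.le
      gcongr
      exact hM j
  · obtain ⟨w', w'', hw, hiff⟩ := hpair j (T⁻¹ * δ / c) (ωp * δ / c)
      (by rw [abs_of_pos hg0]; exact hg.trans (hκ j).2.2)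
      (lt_of_le_of_lt (by gcongr) (hκ j).2.1)
    refine ⟨w' * (c / δ : ℝ), w'' * (c / δ), ?_, ?_⟩
    · rw [Complex.im_mul_ofReal, Complex.re_mul_ofReal]
      rcases hw with hw | hw <;> simp [hw]
    · ext Ω
      rw [mem_ofPred_eq, mem_insert_iff, mem_singleton_iff, ← norm_scaled hδ hc]
      have e1 : Ω = w' * (c / δ : ℝ) + Complex.I * ((w'' * (c / δ) : ℝ) : ℂ) ↔
          Ω * δ / c = w' + Complex.I * w'' := by
        rw [scaled_eq_iff hδ hc]
        push_cast
        ring_nf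
      have e2 : Ω = -(w' * (c / δ : ℝ)) + Complex.I * ((w'' * (c / δ) : ℝ) : ℂ) ↔
          Ω * δ / c = -w' + Complex.I * w'' := by
        rw [scaled_eq_iff hδ hc]
        push_cast
        ring_nf
      rw [e1, e2, ← hiff]
      exact ⟨fun h => ⟨h.1.dispersion hm hμ hδ, h.2⟩, fun h =>
        ⟨isCorrectedResonance_of_dispersion h0 hm hμ hω hδ b1 b2 h.2 h.1, h.2⟩⟩

/-- The resonances in vacuum. -/
theorem resonances_vacuum (h1 : ∀ j, 0 < lam j + 1 / 2) (h2 : ∀ j, 0 < 1 / 2 - lam j) :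
    ∃ κ > (0 : ℝ), ∀ ε₀ μm ωp T δ : ℝ, 0 < ε₀ → 0 < μm → 0 < ωp → 0 < T → 0 < δ →
      ∀ c : ℝ, c = lightSpeed ε₀ μm → ωp * δ / c < κ →
      ∀ j, ∀ a : ℝ, a = alpha B (φ j) →
        0 < lam j + 1 / 2 ∧
        0 < 1 + (ωp * δ / c) ^ 2 * a ∧
        (∀ Ω : ℂ, drudeDenom T Ω ≠ 0 → drude ε₀ ωp T Ω ≠ 0 →
          (IsCorrectedResonance B ε₀ ε₀ μm ωp T δ (lam j) (φ j) Ω ↔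
            Ω = omegaPlus c ωp T δ (lam j) a ∨ Ω = omegaMinus c ωp T δ (lam j) a)) ∧
        (T⁻¹ * δ / c < κ →
          {Ω : ℂ | IsCorrectedResonance B ε₀ ε₀ μm ωp T δ (lam j) (φ j) Ω} =
            {omegaPlus c ωp T δ (lam j) a, omegaMinus c ωp T δ (lam j) a}) ∧
        (0 ≤ radicand c ωp T δ (lam j) a →
          (omegaPlus c ωp T δ (lam j) a).re = √(radicand c ωp T δ (lam j) a) ∧
          (omegaMinus c ωp T δ (lam j) a).re = -√(radicand c ωp T δ (lam j) a) ∧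
          (omegaPlus c ωp T δ (lam j) a).im = omegaDoublePrime c ωp T δ a ∧
          (omegaMinus c ωp T δ (lam j) a).im = omegaDoublePrime c ωp T δ a) ∧
        (∀ Ω : ℂ, (Ω = omegaPlus c ωp T δ (lam j) a ∨ Ω = omegaMinus c ωp T δ (lam j) a) →
          Ω.im < 0 ∧
          ‖Ω‖ ≤ 2 * max (T⁻¹ / |1 + (ωp * δ / c) ^ 2 * a|)
            (ωp * √(lam j + 1 / 2) / √|1 + (ωp * δ / c) ^ 2 * a|)) := by
  -- The first condition makes the correction exceed `1/2`. The rescaled roots are then below `(3 +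
  -- 2(λ_j + 1/2)) κ`, and the other two conditions are the low-frequency requirements at that
  -- radius.
  obtain ⟨κ, hκ, hκ0⟩ : ∃ κ : ℝ, (∀ j, |alpha B (φ j)| * κ ^ 2 < 1 / 2 ∧
      |alpha B (φ j)| * (3 + 2 * (lam j + 1 / 2)) ^ 2 * κ ^ 2 < lam j + 1 / 2 ∧
      |alpha B (φ j)| * (3 + 2 * (lam j + 1 / 2)) ^ 2 * κ ^ 2 < 1 / 2 - lam j) ∧ 0 < κ :=
    ((eventually_all.2 fun j => (eventually_mul_sq_lt _ one_half_pos).and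
      ((eventually_mul_sq_lt _ (h1 j)).and (eventually_mul_sq_lt _ (h2 j)))).and
        self_mem_nhdsWithin).exists
  refine ⟨κ, hκ0, ?_⟩
  rintro ε₀ μm ωp T δ h0 hμ hω hT hδ c rfl hP j a rfl
  obtain ⟨k1, k2, k3⟩ := hκ j
  have hb := h1 j
  have hc := lightSpeed_pos h0 hμ
  set c := lightSpeed ε₀ μm with hcdef
  set a := alpha B (φ j) with ha
  have hT' : 0 < T⁻¹ := inv_pos.2 hT
  have hP0 : 0 < ωp * δ / c := by positivity
  have hP2 : (ωp * δ / c) ^ 2 ≤ κ ^ 2 := pow_le_pow_left₀ hP0.le hP.le 2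
  have hX2 : 1 / 2 < correction c ωp δ a := by
    have h3 : |(ωp * δ / c) ^ 2 * a| ≤ |a| * κ ^ 2 := by
      rw [abs_mul, abs_of_nonneg (sq_nonneg _), mul_comm]
      gcongr
    rw [correction]
    linarith [neg_abs_le ((ωp * δ / c) ^ 2 * a)]
  have hX : 0 < correction c ωp δ a := by linarith
  have hquad : ∀ {Ω : ℂ}, (Ω = omegaPlus c ωp T δ (lam j) a ∨ Ω = omegaMinus c ωp T δ (lam j) a) →
      correction c ωp δ a * Ω ^ 2 + Complex.I * ((T⁻¹ : ℝ) : ℂ) * Ω =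
        ωp ^ 2 * ((lam j + 1 / 2 : ℝ) : ℂ) := fun {Ω} h => by
    push_cast
    exact (eq_omega_iff hX.ne' Ω).1 h
  refine ⟨hb, hX, fun Ω hD he => ?_, fun hg => ?_, omega_re_im, fun Ω hΩ => ?_⟩
  -- In vacuum the contrast never degenerates, as `ω_p ≠ 0`.
  · have hne : drude ε₀ ωp T Ω ≠ ε₀ := by
      intro e
      have h3 := drude_eq (ε₀ := ε₀) (ωp := ωp) hD
      rw [e] at h3
      have h0' : (ε₀ : ℂ) ≠ 0 := by exact_mod_cast h0.ne'
      have hω' : (ωp : ℂ) ≠ 0 := by exact_mod_cast hω.ne'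
      have h4 := mul_left_cancel₀ h0' h3
      exact pow_ne_zero 2 hω' (by linear_combination h4)
    rw [isCorrectedResonance_iff h0 hμ hδ hD he hne, eq_omega_iff hX.ne',
      dispersion_vacuum_iff h0 hc hδ]
  · ext Ω
    rw [mem_ofPred_eq, mem_insert_iff, mem_singleton_iff]
    refine ⟨fun h => (eq_omega_iff hX.ne' Ω).2 ((dispersion_vacuum_iff h0 hc hδ Ω).1
      (h.dispersion h0 hμ hδ)), fun h => ?_⟩
    have h3 := norm_sq_le_of_quadratic (t := ωp ^ 2 * (lam j + 1 / 2)) hX hT' (by positivity)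
      (by rw [hquad h]; push_cast; ring)
    have hd := (dispersion_vacuum_iff (a := a) h0 hc hδ Ω).2 ((eq_omega_iff hX.ne' Ω).1 h)
    -- No frequency restriction is imposed here: `x²/2 ≤ κ x + κ² (λ_j + 1/2)` already forces the
    -- rescaled roots into the low-frequency disc.
    have hk : 0 < δ / c := by positivity
    have h4 : ‖Ω * δ / c‖ < (3 + 2 * (lam j + 1 / 2)) * κ := by
      rw [norm_scaled hδ hc]
      set x := ‖Ω‖ * δ / c with hx
      have hx0 : 0 ≤ x := by positivity
      have h5 : correction c ωp δ a * x ^ 2 ≤ T⁻¹ * δ / c * x +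
          (ωp * δ / c) ^ 2 * (lam j + 1 / 2) := by
        have := mul_le_mul_of_nonneg_right h3 (sq_nonneg (δ / c))
        calc _ = correction c ωp δ a * ‖Ω‖ ^ 2 * (δ / c) ^ 2 := by rw [hx]; ring
          _ ≤ _ := this
          _ = _ := by rw [hx]; ring
      have h6 : 1 / 2 * x ^ 2 ≤ κ * x + κ ^ 2 * (lam j + 1 / 2) := by
        have h7 : 1 / 2 * x ^ 2 ≤ correction c ωp δ a * x ^ 2 := by gcongr
        have h8 : T⁻¹ * δ / c * x ≤ κ * x := by gcongr
        have h9 : (ωp * δ / c) ^ 2 * (lam j + 1 / 2) ≤ κ ^ 2 * (lam j + 1 / 2) := by gcongr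
        linarith
      by_contra! hcon
      have h10 : κ ≤ x := by nlinarith
      have h11 := mul_le_mul_of_nonneg_right hcon hx0
      have h12 := mul_le_mul_of_nonneg_left h10 (by positivity : 0 ≤ (lam j + 1 / 2) * κ)
      have h13 : 0 < κ * x := mul_pos hκ0 (hκ0.trans_le h10)
      nlinarith
    refine isCorrectedResonance_of_dispersion h0 h0 hμ hω hδ ?_ ?_ h4 hd
    · rw [mul_pow, ← mul_assoc]; exact k2
    · rw [mul_pow, ← mul_assoc]; exact k3
  · have hq := hquad hΩ
    refine ⟨im_neg_of_quadratic (t := ωp ^ 2 * (lam j + 1 / 2)) hX hT' (by positivity)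
      (by rw [hq]; push_cast; ring), ?_⟩
    have habs : |1 + (ωp * δ / c) ^ 2 * a| = correction c ωp δ a := abs_of_pos hX
    rw [habs]
    exact norm_le_of_quadratic hX hT' hω hb hq

end Plasmon

end

theorem mainTheorem6
    (B : Set Plasmon.E3) (hB : Plasmon.IsReferenceParticle B)
    (J : ℕ) (lam : Fin J → ℝ) (φ : Fin J → Plasmon.HNegHalf B)
    (heig : ∀ j, Plasmon.IsNormalisedEigenpair B (lam j) (φ j))
    (hlam : ∀ j, lam j ≠ 1 / 2) :
    -- arbitrary surrounding medium
    (∀ ε₀ εm : ℝ, 0 < ε₀ → 0 < εm →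
      ∃ κ > (0 : ℝ), ∃ η > (0 : ℝ), ∃ M > (0 : ℝ),
        ∀ μm ωp T δ : ℝ, 0 < μm → 0 < ωp → 0 < T → 0 < δ →
          ωp * δ / Plasmon.lightSpeed εm μm < κ → ∀ j,
            (∀ Ω : ℂ, Plasmon.IsCorrectedResonance B ε₀ εm μm ωp T δ (lam j) (φ j) Ω →
              ‖Ω‖ * δ / Plasmon.lightSpeed εm μm < η →
              Ω.im < 0 ∧ ‖Ω‖ ≤ M * max T⁻¹ ωp) ∧
            (T⁻¹ * δ / Plasmon.lightSpeed εm μm < κ →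
              ∃ (Ω' : ℂ) (Ω'' : ℝ), (Ω'.im = 0 ∨ Ω'.re = 0) ∧
                {Ω : ℂ | Plasmon.IsCorrectedResonance B ε₀ εm μm ωp T δ (lam j) (φ j) Ω ∧
                  ‖Ω‖ * δ / Plasmon.lightSpeed εm μm < η} =
                {Ω' + Complex.I * Ω'', -Ω' + Complex.I * Ω''})) ∧
    -- vacuum
    (∃ κ > (0 : ℝ), ∀ ε₀ μm ωp T δ : ℝ, 0 < ε₀ → 0 < μm → 0 < ωp → 0 < T → 0 < δ →
      ∀ c : ℝ, c = Plasmon.lightSpeed ε₀ μm → ωp * δ / c < κ →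
      ∀ j, ∀ a : ℝ, a = Plasmon.alpha B (φ j) →
        0 < lam j + 1 / 2 ∧
        0 < 1 + (ωp * δ / c) ^ 2 * a ∧
        (∀ Ω : ℂ, Plasmon.drudeDenom T Ω ≠ 0 → Plasmon.drude ε₀ ωp T Ω ≠ 0 →
          (Plasmon.IsCorrectedResonance B ε₀ ε₀ μm ωp T δ (lam j) (φ j) Ω ↔
            Ω = Plasmon.omegaPlus c ωp T δ (lam j) a ∨
            Ω = Plasmon.omegaMinus c ωp T δ (lam j) a)) ∧
        (T⁻¹ * δ / c < κ →
          {Ω : ℂ | Plasmon.IsCorrectedResonance B ε₀ ε₀ μm ωp T δ (lam j) (φ j) Ω} =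
            {Plasmon.omegaPlus c ωp T δ (lam j) a, Plasmon.omegaMinus c ωp T δ (lam j) a}) ∧
        (0 ≤ Plasmon.radicand c ωp T δ (lam j) a →
          (Plasmon.omegaPlus c ωp T δ (lam j) a).re =
              √(Plasmon.radicand c ωp T δ (lam j) a) ∧
          (Plasmon.omegaMinus c ωp T δ (lam j) a).re =
              -√(Plasmon.radicand c ωp T δ (lam j) a) ∧
          (Plasmon.omegaPlus c ωp T δ (lam j) a).im = Plasmon.omegaDoublePrime c ωp T δ a ∧
          (Plasmon.omegaMinus c ωp T δ (lam j) a).im = Plasmon.omegaDoublePrime c ωp T δ a) ∧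
        (∀ Ω : ℂ, (Ω = Plasmon.omegaPlus c ωp T δ (lam j) a ∨
            Ω = Plasmon.omegaMinus c ωp T δ (lam j) a) →
          Ω.im < 0 ∧
          ‖Ω‖ ≤ 2 * max (T⁻¹ / |1 + (ωp * δ / c) ^ 2 * a|)
            (ωp * √(lam j + 1 / 2) / √|1 + (ωp * δ / c) ^ 2 * a|))) := by
  have h1 : ∀ j, 0 < lam j + 1 / 2 := fun j => by linarith [(hB.eigenvalue_mem (heig j)).1]
  have h2 : ∀ j, 0 < 1 / 2 - lam j := fun j =>
    sub_pos.2 (lt_of_le_of_ne (hB.eigenvalue_mem (heig j)).2 (hlam j))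
  exact ⟨fun _ _ h0 hm => Plasmon.resonances_general h1 h2 h0 hm,
    Plasmon.resonances_vacuum h1 h2⟩
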